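/- **Setting.** Let $\underline p=(p_1\ge\dots\ge p_r>0)$ be a partition with $r\ge1$ parts and let $r_1$ be the multiplicity of $p_1$. Times $t_j^{(a)}$ ($1\le a\le r$, $j\ge1$) are real or complex; functions are complex valued, defined on a set of times that is open with respect to variations of finitely many times, and smooth in the times (every restriction to finitely many variables is $C^\infty$, i.e. holomorphic for complex times). For $\underline m\in\mathbb Z^r$ put $|\underline m|=\sum_i m_i$, $|\underline m|_a=\sum_{i\le a}m_i$; $\underline e_a$ is the standard basis. Put $$e_+^{(a)}(\underline{t},z)=\exp\Big(\sum_{j\ge1}z^jt_j^{(a)}\Big),\qquad e_-^{(a)}\big(\tfrac{\partial}{\partial\underline t},z\big)=\exp\Big(-\sum_{j\ge1}\tfrac{z^{-j}}{j}\tfrac{\partial}{\partial t_j^{(a)}}\Big).$$ Let $k\in\mathbb Z$ and let $\{\tau^{\underline m}(\underline t)\}_{|\underline m|=k}$ be a tau-function of charge $k$ of the $\underline p$-KdV hierarchy, that is, $$\operatorname{Res}_z\sum_{a=1}^r(-1)^{|\underline m'+\underline m''|_{a-1}}z^{m_a'-m_a''+\ell p_a-2}\,e_+^{(a)}(\underline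 t'-\underline t'',z)\,e_-^{(a)}\big(\tfrac{\partial}{\partial\underline t'}-\tfrac{\partial}{\partial\underline t''},z\big)\tau^{\underline m'-\underline e_a}(\underline t')\tau^{\underline m''+\underline e_a}(\underline t'')=0$$ for all $\ell\ge0$, $|\underline m'|=k+1$, $|\underline m''|=k-1$, where the equation means the collection of all equations obtained by applying a finite product of derivatives $\partial/\partial t_j'^{(b)}$ inside the residue and then setting $\underline t'=\underline t''$. Fix $\underline m$ with $|\underline m|=k$. **The operators.** Where $\tau^{\underline m}\ne0$, define $P^\pm_{ab}(\underline t,z)$ ($1\le a,b\le r$) by $$P^{\pm}_{ab}(\underline t,\pm z)=(-1)^{|\underline e_a|_{b-1}}\frac{z^{\delta_{ab}-1}}{\tau^{\underline m}(\underline t)}\,e_-^{(b)}\big(\pm\tfrac{\partial}{\partial\underline t},z\big)\tau^{\underline m\pm\underline e_a\mp\underline e_b}(\underline t).$$ Let $Q^\pm_{ab}(x,\underline t,z)=\sum_{n\ge0}Q^\pm_{ab;n}(x,\underline t)z^{-n}$ be obtained from $P^\pm_{ab}$ by setting $t_j^{(a)}=0$ for $a>r_1$ and replacing $t_1^{(a)}$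 by $t_1^{(a)}+x$ for $a\le r_1$. Let $\partial=\partial/\partial x$, let $Q_{11}=\big(Q^+_{ab}(x,\underline t,\partial)\big)_{a,b\le r_1}$ be the matrix pseudodifferential operator with these symbols ($z^{-n}\mapsto\partial^{-n}$), and put $$\mathcal L_a=Q_{11}\circ E_{aa}\partial\circ Q_{11}^{-1}\ (a\le r_1),\qquad \widetilde{\mathcal L}(x,t,\partial)=\sum_{a=1}^{r_1}\mathcal L_a^{p_1}\Big|_{t_j^{(a)}=t_j\ \forall a\le r_1},$$ an $r_1\times r_1$ matrix pseudodifferential operator whose coefficients are smooth functions of $x$ and $t=(t_j)_{j\ge1}$ on the set where the correspondingly restricted $\tau^{\underline m}$ does not vanish. The subscript $+$ denotes the differential part. Let $\varepsilon$ be any $p_1$-th root of $-1$ in the field of times, $\tilde t=(\varepsilon^jt_j)_j$, and let all $Q^\pm$ below be taken at identified times. Define differential operators $W_{ab}=\sum_{j=0}^{\min(p_a,p_b)-1}w_{ba;j}(x,t)(-\partial)^j$ as follows. For $a\le r_1<b$: $$w_{ba;j}=-\sum_{i=0}^{j}\frac{x^i}{i!}Q^+_{ab;j-i+1}(-x,\tilde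 t).$$ For $b\le r_1<a$ the $w_{ba;j}$ are the coefficients in $$\sum_jw_{ba;j}(-\partial)^j=\sum_{j=0}^{p_a-1}\sum_{i=0}^j\partial^j\circ Q^-_{ba;j-i+1}(-x,\tilde t)\frac{x^i}{i!}.$$ For $a,b\le r_1$ they are the coefficients of $(-\partial)^j$, $0\le j<p_1$, in the entries of $$-\widetilde{\mathcal L}(-x,\tilde t,-\partial)_++\mathbb 1(-\partial)^{p_1}-\big(W_{12}\circ(-\partial)^{-\underline q}\circ W_{21}\big)_+,$$ where $W_{11},W_{12},W_{21}$ are the blocks of $(W_{ab})$ for the splitting $\{1,\dots,r_1\}\sqcup\{r_1+1,\dots,r\}$ and $(-\partial)^{-\underline q}=\sum_{a>r_1}E_{aa}(-\partial)^{-p_a}$. Put $$\mathcal L(x,t,\partial)=-\mathbb 1(-\partial)^{p_1}+W_{11}+W_{12}\circ(-\partial)^{-\underline q}\circ W_{21}.$$ **Theorem.** The operator $Q_{11}$ is invertible, and: 1. $\widetilde{\mathcal L}$ has a unique $p_1$-th root $\widetilde{\mathcal L}^{1/p_1}$ of the form $\mathbb 1\partial+(\text{order}\le0)$, and $$\frac{\partial\widetilde{\mathcal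 L}}{\partial t_j}=\big[(\widetilde{\mathcal L}^{j/p_1})_+,\widetilde{\mathcal L}\big]\qquad\text{for all }j\ge1.$$ 2. For every $\varepsilon$ as above, $\mathcal L(x,t,\partial)=-\widetilde{\mathcal L}(-x,\tilde t,-\partial)$; moreover $\mathcal L$ has a unique $p_1$-th root $\mathcal L^{1/p_1}$ of the form $-\varepsilon\mathbb 1\partial+(\text{order}\le0)$, and $$\frac{\partial\mathcal L}{\partial t_j}=\big[(\mathcal L^{j/p_1})_+,\mathcal L\big]\qquad\text{for all }j\ge1.$$ -/

import Mathlib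

open scoped BigOperators Topology ContDiff

noncomputable section


/-! ### Pseudodifferential operators over a differential ring -/

/-- Formal series `∑ a_i ∂^i` (`i ∈ ℤ`) whose coefficients vanish for all large `i`. -/
def psiSubgroup (R : Type*) [CommRing R] : AddSubgroup (ℤ → R) where
  carrier := {f | ∃ N : ℤ, ∀ i, N < i → f i = 0}
  zero_mem' := ⟨0, fun _ _ => rfl⟩
  add_mem' := by
    rintro f g ⟨N, hN⟩ ⟨M, hM⟩
    refine ⟨max N M, fun i hi => ?_⟩
    simp [hN i (lt_of_le_of_lt (le_max_left _ _) hi), hM i (lt_of_le_of_lt (le_max_right _ _) hi)]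
  neg_mem' := by
    rintro f ⟨N, hN⟩
    exact ⟨N, fun i hi => by simp [hN i hi]⟩

/-- The ring `R((∂⁻¹))` of scalar pseudodifferential operators over the differential ring `R`. -/
def PsiDO (R : Type*) [CommRing R] : Type _ := psiSubgroup R

namespace PsiDO

variable {R : Type*} [CommRing R]

instance : AddCommGroup (PsiDO R) := inferInstanceAs (AddCommGroup (psiSubgroup R))

/-- The coefficient of `∂^i` (coefficients are written to the left of the powers of `∂`). -/
def coeff (A : PsiDO R) (i : ℤ) : R := A.1 i

/-- Build an operator from its coefficients. -/
def mk (f : ℤ → R) (h : ∃ N : ℤ, ∀ i, N < i → f i = 0) : PsiDO R := ⟨f, h⟩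

theorem bdd (A : PsiDO R) : ∃ N : ℤ, ∀ i, N < i → A.coeff i = 0 := A.2

@[simp] theorem coeff_mk (f : ℤ → R) (h : ∃ N : ℤ, ∀ i, N < i → f i = 0) (i : ℤ) :
    (mk f h).coeff i = f i := rfl

@[ext] theorem ext {A B : PsiDO R} (h : ∀ i, A.coeff i = B.coeff i) : A = B :=
  Subtype.ext (funext h)

@[simp] theorem coeff_zero (i : ℤ) : (0 : PsiDO R).coeff i = 0 := rfl

@[simp] theorem coeff_add (A B : PsiDO R) (i : ℤ) :
    (A + B).coeff i = A.coeff i + B.coeff i := rfl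

/-- The monomial `a ∂^n`. -/
def mono (a : R) (n : ℤ) : PsiDO R :=
  mk (fun i => if i = n then a else 0) ⟨n, fun _ hi => if_neg hi.ne'⟩

/-- The operator `∑_{n ≥ 0} c_n ∂^{-n}`. -/
def ofSymbol (c : ℕ → R) : PsiDO R :=
  mk (fun i => if i ≤ 0 then c (-i).toNat else 0) ⟨0, fun _ hi => if_neg hi.not_ge⟩

/-- The differential part `A_+`. -/
def pos (A : PsiDO R) : PsiDO R :=
  mk (fun i => if 0 ≤ i then A.coeff i else 0)
    (A.bdd.imp fun N hN i hi => by simp [hN i hi])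

/-- Apply an additive map to all coefficients. -/
def mapCoeff {S : Type*} [CommRing S] (φ : R →+ S) (A : PsiDO R) : PsiDO S :=
  mk (fun i => φ (A.coeff i)) (A.bdd.imp fun N hN i hi => by simp [hN i hi])

/-- Apply a ring homomorphism to all coefficients and replace `∂` by `-∂`. -/
def reflect {S : Type*} [CommRing S] (φ : R →+* S) (A : PsiDO R) : PsiDO S :=
  mk (fun i => (Int.negOnePow i : ℤ) • φ (A.coeff i))
    (A.bdd.imp fun N hN i hi => by simp [hN i hi])

instance : One (PsiDO R) := ⟨mono 1 0⟩

theorem coeff_one (k : ℤ) : (1 : PsiDO R).coeff k = if k = 0 then 1 else 0 := rfl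

/-- A common bound for three operators. -/
theorem exists_bound (A B C : PsiDO R) : ∃ N : ℤ, 0 ≤ N ∧ (∀ i, N < i → A.coeff i = 0) ∧
    (∀ i, N < i → B.coeff i = 0) ∧ (∀ i, N < i → C.coeff i = 0) := by
  obtain ⟨a, ha⟩ := A.bdd
  obtain ⟨b, hb⟩ := B.bdd
  obtain ⟨c, hc⟩ := C.bdd
  exact ⟨max 0 (max a (max b c)), by omega, fun i hi => ha i (by omega),
    fun i hi => hb i (by omega), fun i hi => hc i (by omega)⟩

variable [Differential R]

/-- The coefficient of `∂^k` in `A ∘ B`, from the rule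
`a ∂^i ∘ b ∂^j = ∑_{n ≥ 0} (i choose n) a b^{(n)} ∂^{i+j-n}` (with `j = k - i + n`);
only finitely many terms are nonzero. -/
def mulCoeff (A B : PsiDO R) (k : ℤ) : R :=
  ∑ᶠ (i : ℤ) (n : ℕ), Ring.choose i n •
    (A.coeff i * (Differential.deriv (R := R))^[n] (B.coeff (k - i + n)))

theorem iter_zero (n : ℕ) : (Differential.deriv (R := R))^[n] (0 : R) = 0 :=
  Function.iterate_fixed (map_zero _) n

theorem iter_add (n : ℕ) (a b : R) : (Differential.deriv (R := R))^[n] (a + b) =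
    (Differential.deriv (R := R))^[n] a + (Differential.deriv (R := R))^[n] b := by
  induction n generalizing a b with
  | zero => rfl
  | succ n ih => simp [Function.iterate_succ_apply, ih]

theorem iter_sum {ι : Type*} (s : Finset ι) (n : ℕ) (f : ι → R) :
    (Differential.deriv (R := R))^[n] (∑ i ∈ s, f i) =
      ∑ i ∈ s, (Differential.deriv (R := R))^[n] (f i) := by
  classical
  induction s using Finset.induction_on with
  | empty => simp
  | insert a s ha ih => simp [Finset.sum_insert ha, ih]

theorem iter_zsmul (n : ℕ) (c : ℤ) (a : R) : (Differential.deriv (R := R))^[n] (c • a) =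
    c • (Differential.deriv (R := R))^[n] a := by
  induction n generalizing a with
  | zero => rfl
  | succ n ih => simp only [Function.iterate_succ_apply, Derivation.map_smul, ih]

theorem iter_mul (n : ℕ) (a b : R) : (Differential.deriv (R := R))^[n] (a * b) =
    ∑ x ∈ Finset.HasAntidiagonal.antidiagonal n, (n.choose x.1 : ℤ) •
      ((Differential.deriv (R := R))^[x.1] a * (Differential.deriv (R := R))^[x.2] b) := by
  induction n with
  | zero => simp
  | succ n ih =>
    rw [Function.iterate_succ_apply', ih, map_sum]
    have h1 := Finset.sum_antidiagonal_choose_succ_nsmul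
      (fun i j => (Differential.deriv (R := R))^[i] a * (Differential.deriv (R := R))^[j] b) n
    simp only [natCast_zsmul]
    rw [h1, ← Finset.sum_add_distrib]
    refine Finset.sum_congr rfl fun x hx => ?_
    have hx' : x.1 + x.2 = n := Finset.HasAntidiagonal.mem_antidiagonal.mp hx
    have h2 : n.choose x.2 = n.choose x.1 := by
      rw [← hx', Nat.choose_symm_add]
    simp only [map_nsmul, Derivation.leibniz, Function.iterate_succ_apply', smul_eq_mul, h2]
    rw [← smul_add]
    congr 1
    ring

/-- The contribution of the coefficients of `∂^i` and `∂^j` to that of `∂^k`. -/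
def mulTerm (a b : R) (i j k : ℤ) : R :=
  if k ≤ i + j then
    Ring.choose i (i + j - k).toNat •
      (a * (Differential.deriv (R := R))^[(i + j - k).toNat] b) else 0

theorem mulTerm_zero_left (b : R) (i j k : ℤ) : mulTerm 0 b i j k = 0 := by
  unfold mulTerm; simp

theorem mulTerm_zero_right (a : R) (i j k : ℤ) : mulTerm a 0 i j k = 0 := by
  unfold mulTerm; simp

theorem mulTerm_of_lt (a b : R) {i j k : ℤ} (h : i + j < k) : mulTerm a b i j k = 0 :=
  if_neg h.not_ge

theorem mulCoeff_eq (A B : PsiDO R) (k N : ℤ) (S T : Finset ℤ)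
    (hA : ∀ i, N < i → A.coeff i = 0) (hB : ∀ i, N < i → B.coeff i = 0)
    (hS : ∀ i, k - N ≤ i → i ≤ N → i ∈ S) (hT : ∀ i, k - N ≤ i → i ≤ N → i ∈ T) :
    mulCoeff A B k = ∑ i ∈ S, ∑ j ∈ T, mulTerm (A.coeff i) (B.coeff j) i j k := by
  unfold mulCoeff
  rw [finsum_eq_sum_of_support_subset (s := S)]
  · refine Finset.sum_congr rfl fun i _ => ?_
    rw [← finsum_eq_sum_of_support_subset
      (f := fun j => mulTerm (A.coeff i) (B.coeff j) i j k) (s := T)]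
    · have hinj : Function.Injective (fun n : ℕ => k - i + (n : ℤ)) := by
        intro a b h
        simpa using h
      have h3 := finsum_mem_range (f := fun j => mulTerm (A.coeff i) (B.coeff j) i j k) hinj
      have h4 : (∑ᶠ j ∈ Set.range (fun n : ℕ => k - i + (n : ℤ)),
          mulTerm (A.coeff i) (B.coeff j) i j k) =
          ∑ᶠ j, mulTerm (A.coeff i) (B.coeff j) i j k := by
        refine finsum_congr fun j => ?_
        by_cases hj : j ∈ Set.range (fun n : ℕ => k - i + (n : ℤ))
        · simp only [hj, finsum_true]
        · simp only [hj, finsum_false]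
          rw [mulTerm, if_neg]
          intro hk
          exact hj ⟨(i + j - k).toNat, by simp only; omega⟩
      rw [← h4, h3]
      refine finsum_congr fun n => ?_
      have : (i + (k - i + (n : ℤ)) - k).toNat = n := by omega
      rw [mulTerm, if_pos (by omega), this]
    · intro j hj
      by_contra hc
      apply hj
      change mulTerm (A.coeff i) (B.coeff j) i j k = 0
      by_cases h1 : N < i
      · rw [hA i h1, mulTerm_zero_left]
      by_cases h2 : N < j
      · rw [hB j h2, mulTerm_zero_right]
      · refine mulTerm_of_lt _ _ ?_
        by_contra h3
        exact hc (hT j (by omega) (by omega))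
  · intro i hi
    by_contra hc
    apply hi
    rw [← finsum_zero (α := ℕ)]
    refine finsum_congr fun n => ?_
    by_cases h1 : N < i
    · rw [hA i h1]; simp
    · have h2 : i < k - N := by
        by_contra h3
        exact hc (hS i (by omega) (by omega))
      rw [hB _ (by omega), iter_zero]; simp

instance : Mul (PsiDO R) where
  mul A B := mk (mulCoeff A B) (by
    obtain ⟨N, hN⟩ := A.bdd
    obtain ⟨M, hM⟩ := B.bdd
    refine ⟨N + M, fun k hk => ?_⟩
    unfold mulCoeff
    rw [← finsum_zero (α := ℤ)]
    refine finsum_congr fun i => ?_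
    rw [← finsum_zero (α := ℕ)]
    refine finsum_congr fun n => ?_
    by_cases hi : N < i
    · rw [hN i hi]; simp
    · rw [hM _ (by omega), iter_zero]; simp)

theorem coeff_mul (A B : PsiDO R) (k : ℤ) : (A * B).coeff k = mulCoeff A B k := rfl

theorem mulTerm_add_left (a a' b : R) (i j k : ℤ) :
    mulTerm (a + a') b i j k = mulTerm a b i j k + mulTerm a' b i j k := by
  unfold mulTerm
  split_ifs
  · rw [add_mul, smul_add]
  · simp

theorem mulTerm_add_right (a b b' : R) (i j k : ℤ) :
    mulTerm a (b + b') i j k = mulTerm a b i j k + mulTerm a b' i j k := by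
  unfold mulTerm
  split_ifs
  · rw [iter_add, mul_add, smul_add]
  · simp

theorem mul_bound (A B : PsiDO R) (N : ℤ) (hA : ∀ i, N < i → A.coeff i = 0)
    (hB : ∀ i, N < i → B.coeff i = 0) (k : ℤ) (hk : 2 * N < k) : (A * B).coeff k = 0 := by
  rw [coeff_mul, mulCoeff_eq A B k N ∅ ∅ hA hB (by omega) (by omega)]
  simp

theorem assoc_aux (i j : ℤ) (s : ℕ) (b c : R) :
    (∑ x ∈ Finset.HasAntidiagonal.antidiagonal s, (Ring.choose i x.1 * Ring.choose (i + j - x.1) x.2) •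
      ((Differential.deriv (R := R))^[x.1] b * (Differential.deriv (R := R))^[x.2] c)) =
    ∑ x ∈ Finset.HasAntidiagonal.antidiagonal s, (Ring.choose i x.1 * Ring.choose j x.2) •
      (Differential.deriv (R := R))^[x.1] (b * (Differential.deriv (R := R))^[x.2] c) := by
  simp only [iter_mul, Finset.smul_sum, ← Function.iterate_add_apply]
  have hV : ∀ x : ℕ × ℕ, Ring.choose (i + j - x.1) x.2 =
      ∑ y ∈ Finset.HasAntidiagonal.antidiagonal x.2, Ring.choose (i - x.1) y.1 * Ring.choose j y.2 := by
    intro x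
    rw [← Ring.add_choose_eq x.2 (Commute.all (i - (x.1 : ℤ)) j)]
    congr 1; ring
  simp only [hV, Finset.mul_sum, Finset.sum_smul]
  rw [Finset.sum_sigma', Finset.sum_sigma']
  refine Finset.sum_bij' (fun x _ => ⟨(x.1.1 + x.2.1, x.2.2), (x.1.1, x.2.1)⟩)
    (fun x _ => ⟨(x.2.1, x.2.2 + x.1.2), (x.2.2, x.1.2)⟩) ?_ ?_ ?_ ?_ ?_
  · rintro ⟨⟨n, u⟩, ⟨w, v⟩⟩ h
    simp only [Finset.mem_sigma, Finset.HasAntidiagonal.mem_antidiagonal] at h ⊢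
    obtain ⟨h1, h2⟩ := h
    change n + u = s at h1
    exact ⟨by omega, by simp⟩
  · rintro ⟨⟨n, u⟩, ⟨w, v⟩⟩ h
    simp only [Finset.mem_sigma, Finset.HasAntidiagonal.mem_antidiagonal] at h ⊢
    obtain ⟨h1, h2⟩ := h
    change n + u = s at h1
    exact ⟨by omega, by simp⟩
  · rintro ⟨⟨n, u⟩, ⟨w, v⟩⟩ h
    simp only [Finset.mem_sigma, Finset.HasAntidiagonal.mem_antidiagonal] at h
    obtain ⟨h1, h2⟩ := h
    subst h2; rfl
  · rintro ⟨⟨n, u⟩, ⟨w, v⟩⟩ h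
    simp only [Finset.mem_sigma, Finset.HasAntidiagonal.mem_antidiagonal] at h
    obtain ⟨h1, h2⟩ := h
    subst h2; rfl
  · rintro ⟨⟨n, u⟩, ⟨w, v⟩⟩ h
    simp only [Finset.mem_sigma, Finset.HasAntidiagonal.mem_antidiagonal] at h
    obtain ⟨h1, h2⟩ := h
    subst h2
    simp only [smul_smul]
    congr 1
    have h3 := Ring.choose_smul_choose i (Nat.le_add_right n w)
    rw [nsmul_eq_mul, Nat.add_sub_cancel_left] at h3
    linear_combination (- Ring.choose j v) * h3

theorem mulTerm_sum_left {ι : Type*} (s : Finset ι) (f : ι → R) (b : R) (i j k : ℤ) :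
    mulTerm (∑ x ∈ s, f x) b i j k = ∑ x ∈ s, mulTerm (f x) b i j k :=
  map_sum (⟨⟨fun a => mulTerm a b i j k, mulTerm_zero_left b i j k⟩,
    fun a a' => mulTerm_add_left a a' b i j k⟩ : R →+ R) f s

theorem mulTerm_sum_right {ι : Type*} (s : Finset ι) (a : R) (f : ι → R) (i j k : ℤ) :
    mulTerm a (∑ x ∈ s, f x) i j k = ∑ x ∈ s, mulTerm a (f x) i j k :=
  map_sum (⟨⟨fun b => mulTerm a b i j k, mulTerm_zero_right a i j k⟩,
    fun b b' => mulTerm_add_right a b b' i j k⟩ : R →+ R) f s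

theorem mulTerm_assoc (a b c : R) (i j q k : ℤ) (S : Finset ℤ)
    (hS : ∀ l, min (k - q) (k - i) ≤ l → l ≤ max (i + j) (j + q) → l ∈ S) :
    ∑ l ∈ S, mulTerm (mulTerm a b i j l) c l q k =
      ∑ l ∈ S, mulTerm a (mulTerm b c j q l) i l k := by
  by_cases hs : i + j + q < k
  · rw [Finset.sum_eq_zero, Finset.sum_eq_zero]
    · intro l _
      by_cases h : i + l < k
      · exact mulTerm_of_lt _ _ h
      · rw [mulTerm_of_lt b c (by omega), mulTerm_zero_right]
    · intro l _
      by_cases h : l + q < k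
      · exact mulTerm_of_lt _ _ h
      · rw [mulTerm_of_lt a b (by omega), mulTerm_zero_left]
  · obtain ⟨s, hs'⟩ : ∃ s : ℕ, i + j + q - k = s := ⟨_, (Int.toNat_of_nonneg (by omega)).symm⟩
    have key := congrArg (fun y => a * y) (assoc_aux i j s b c)
    simp only [Finset.mul_sum] at key
    refine Eq.trans (Eq.symm ?_) (key.trans ?_)
    · refine Finset.sum_of_injOn (fun x : ℕ × ℕ => i + j - (x.1 : ℤ)) ?_ ?_ ?_ ?_
      · rintro ⟨n, u⟩ h ⟨n', u'⟩ h' he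
        simp only [Finset.mem_coe, Finset.HasAntidiagonal.mem_antidiagonal] at h h' he
        ext <;> simp only <;> omega
      · rintro ⟨n, u⟩ h
        simp only [Finset.mem_coe, Finset.HasAntidiagonal.mem_antidiagonal] at h ⊢
        exact hS _ (by omega) (by omega)
      · intro l _ hl
        by_cases h : l + q < k
        · exact mulTerm_of_lt _ _ h
        by_cases h' : i + j < l
        · rw [mulTerm_of_lt a b h', mulTerm_zero_left]
        · exact absurd ⟨((i + j - l).toNat, (l + q - k).toNat), by
            simp only [Finset.mem_coe, Finset.HasAntidiagonal.mem_antidiagonal]; omega,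
            by simp only; omega⟩ hl
      · rintro ⟨n, u⟩ h
        simp only [Finset.HasAntidiagonal.mem_antidiagonal] at h ⊢
        have e1 : (i + j - (i + j - (n : ℤ))).toNat = n := by omega
        have e2 : (i + j - (n : ℤ) + q - k).toNat = u := by omega
        rw [mulTerm, if_pos (by omega), mulTerm, if_pos (by omega), e1, e2]
        simp only [zsmul_eq_mul]
        push_cast
        ring
    · refine Finset.sum_of_injOn (fun x : ℕ × ℕ => j + q - (x.2 : ℤ)) ?_ ?_ ?_ ?_
      · rintro ⟨n, u⟩ h ⟨n', u'⟩ h' he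
        simp only [Finset.mem_coe, Finset.HasAntidiagonal.mem_antidiagonal] at h h' he
        ext <;> simp only <;> omega
      · rintro ⟨n, u⟩ h
        simp only [Finset.mem_coe, Finset.HasAntidiagonal.mem_antidiagonal] at h ⊢
        exact hS _ (by omega) (by omega)
      · intro l _ hl
        by_cases h : i + l < k
        · exact mulTerm_of_lt _ _ h
        by_cases h' : j + q < l
        · rw [mulTerm_of_lt b c h', mulTerm_zero_right]
        · exact absurd ⟨((i + l - k).toNat, (j + q - l).toNat), by
            simp only [Finset.mem_coe, Finset.HasAntidiagonal.mem_antidiagonal]; omega,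
            by simp only; omega⟩ hl
      · rintro ⟨n, u⟩ h
        simp only [Finset.HasAntidiagonal.mem_antidiagonal] at h ⊢
        have e1 : (j + q - (j + q - (u : ℤ))).toNat = u := by omega
        have e2 : (i + (j + q - (u : ℤ)) - k).toNat = n := by omega
        rw [mulTerm, if_pos (by omega), mulTerm, if_pos (by omega), e1, e2, iter_zsmul]
        simp only [zsmul_eq_mul]
        push_cast
        ring

theorem mul_assoc' (A B C : PsiDO R) : A * B * C = A * (B * C) := by
  obtain ⟨N, hN, hA, hB, hC⟩ := exists_bound A B C
  ext k
  set K : ℤ := 2 * N + |k| with hK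
  have hk1 := neg_abs_le k
  have hk2 := le_abs_self k
  set S : Finset ℤ := Finset.Icc (-K) K with hSdef
  set T : Finset ℤ := Finset.Icc (-(K + N)) (K + N) with hTdef
  have hAB := mul_bound A B N hA hB
  have hBC := mul_bound B C N hB hC
  have hmS : ∀ i, k - 2 * N ≤ i → i ≤ 2 * N → i ∈ S := fun i h1 h2 => by
    rw [hSdef, Finset.mem_Icc]; omega
  have hmT : ∀ i, k - 2 * N ≤ i → i ≤ 2 * N → i ∈ T := fun i h1 h2 => by
    rw [hTdef, Finset.mem_Icc]; omega
  have hin : ∀ (X Y : PsiDO R), (∀ i, N < i → X.coeff i = 0) → (∀ i, N < i → Y.coeff i = 0) →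
      ∀ l ∈ S, (X * Y).coeff l =
        ∑ i ∈ T, ∑ j ∈ T, mulTerm (X.coeff i) (Y.coeff j) i j l := by
    intro X Y hX hY l hl
    rw [hSdef, Finset.mem_Icc] at hl
    refine mulCoeff_eq X Y l N T T hX hY ?_ ?_ <;>
      (intro i h1 h2; rw [hTdef, Finset.mem_Icc]; omega)
  rw [coeff_mul, coeff_mul,
    mulCoeff_eq (A * B) C k (2 * N) S T hAB (fun i hi => hC i (by omega)) hmS hmT,
    mulCoeff_eq A (B * C) k (2 * N) T S (fun i hi => hA i (by omega)) hBC hmT hmS]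
  have e1 : ∀ l ∈ S, ∑ q ∈ T, mulTerm ((A * B).coeff l) (C.coeff q) l q k =
      ∑ i ∈ T, ∑ j ∈ T, ∑ q ∈ T,
        mulTerm (mulTerm (A.coeff i) (B.coeff j) i j l) (C.coeff q) l q k := by
    intro l hl
    rw [hin A B hA hB l hl]
    simp only [mulTerm_sum_left]
    rw [Finset.sum_comm]
    refine Finset.sum_congr rfl fun i _ => ?_
    rw [Finset.sum_comm]
  have e2 : ∀ i ∈ T, ∑ l ∈ S, mulTerm (A.coeff i) ((B * C).coeff l) i l k =
      ∑ j ∈ T, ∑ q ∈ T, ∑ l ∈ S,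
        mulTerm (A.coeff i) (mulTerm (B.coeff j) (C.coeff q) j q l) i l k := by
    intro i _
    rw [Finset.sum_congr rfl fun l hl => by rw [hin B C hB hC l hl]]
    simp only [mulTerm_sum_right]
    rw [Finset.sum_comm]
    refine Finset.sum_congr rfl fun j _ => ?_
    rw [Finset.sum_comm]
  rw [Finset.sum_congr rfl e1, Finset.sum_congr rfl e2, Finset.sum_comm]
  refine Finset.sum_congr rfl fun i _ => ?_
  rw [Finset.sum_comm]
  refine Finset.sum_congr rfl fun j _ => ?_
  rw [Finset.sum_comm]
  refine Finset.sum_congr rfl fun q _ => ?_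
  by_cases hi : N < i
  · simp [hA i hi, mulTerm_zero_left]
  by_cases hj : N < j
  · simp [hB j hj, mulTerm_zero_left, mulTerm_zero_right]
  by_cases hq : N < q
  · simp [hC q hq, mulTerm_zero_right]
  · refine mulTerm_assoc _ _ _ _ _ _ _ _ fun l h1 h2 => hmS l (by omega) (by omega)

theorem left_distrib' (A B C : PsiDO R) : A * (B + C) = A * B + A * C := by
  obtain ⟨N, -, hA, hB, hC⟩ := exists_bound A B C
  ext k
  have hT : ∀ i, k - N ≤ i → i ≤ N → i ∈ Finset.Icc (k - N) N := fun i h1 h2 =>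
    Finset.mem_Icc.mpr ⟨h1, h2⟩
  rw [coeff_add, coeff_mul, coeff_mul, coeff_mul,
    mulCoeff_eq A (B + C) k N _ _ hA (fun i hi => by rw [coeff_add, hB i hi, hC i hi, add_zero])
      hT hT, mulCoeff_eq A B k N _ _ hA hB hT hT, mulCoeff_eq A C k N _ _ hA hC hT hT]
  simp only [coeff_add, mulTerm_add_right, Finset.sum_add_distrib]

theorem right_distrib' (A B C : PsiDO R) : (A + B) * C = A * C + B * C := by
  obtain ⟨N, -, hA, hB, hC⟩ := exists_bound A B C
  ext k
  have hT : ∀ i, k - N ≤ i → i ≤ N → i ∈ Finset.Icc (k - N) N := fun i h1 h2 =>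
    Finset.mem_Icc.mpr ⟨h1, h2⟩
  rw [coeff_add, coeff_mul, coeff_mul, coeff_mul,
    mulCoeff_eq (A + B) C k N _ _ (fun i hi => by rw [coeff_add, hA i hi, hB i hi, add_zero]) hC
      hT hT, mulCoeff_eq A C k N _ _ hA hC hT hT, mulCoeff_eq B C k N _ _ hB hC hT hT]
  simp only [coeff_add, mulTerm_add_left, Finset.sum_add_distrib]

theorem one_mul' (A : PsiDO R) : 1 * A = A := by
  ext k
  rw [coeff_mul, mulCoeff, finsum_eq_single _ (0 : ℤ), finsum_eq_single _ (0 : ℕ)]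
  · simp [coeff_one]
  · intro n hn
    rw [Ring.choose_zero_pos ℤ (Nat.pos_of_ne_zero hn)]
    simp
  · intro i hi
    rw [coeff_one, if_neg hi]
    simp

theorem mul_one' (A : PsiDO R) : A * 1 = A := by
  ext k
  rw [coeff_mul, mulCoeff, finsum_eq_single _ k, finsum_eq_single _ (0 : ℕ)]
  · simp [coeff_one]
  · intro n hn
    rw [coeff_one, if_neg (by omega), iter_zero]
    simp
  · intro i hi
    rw [← finsum_zero (α := ℕ)]
    refine finsum_congr fun n => ?_
    rw [coeff_one]
    split_ifs with h
    · obtain ⟨n, rfl⟩ : ∃ n' : ℕ, n = n' + 1 := ⟨n - 1, by omega⟩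
      rw [Function.iterate_succ_apply, Derivation.map_one_eq_zero, iter_zero]
      simp
    · rw [iter_zero]; simp

instance : Ring (PsiDO R) :=
  { (inferInstance : AddCommGroup (PsiDO R)) with
    mul := (· * ·)
    one := 1
    mul_assoc := mul_assoc'
    one_mul := one_mul'
    mul_one := mul_one'
    left_distrib := left_distrib'
    right_distrib := right_distrib'
    zero_mul := fun A => by
      have h := right_distrib' 0 0 A
      rw [add_zero] at h
      exact left_eq_add.mp h
    mul_zero := fun A => by
      have h := left_distrib' A 0 0
      rw [add_zero] at h
      exact left_eq_add.mp h }

end PsiDO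


/-! ### Smooth functions of infinitely many variables -/

/-- The point `t + ∑ y_i v_i`, for finitely many directions `v_i`, each of which moves only
finitely many of the variables. -/
def timeShift {𝕜 ι : Type*} [RCLike 𝕜] {n : ℕ} (t : ι → 𝕜) (v : Fin n → ι →₀ 𝕜)
    (y : Fin n → 𝕜) : ι → 𝕜 :=
  t + ⇑(∑ i, y i • v i)

/-- A set of values of the variables `(t_i)_{i ∈ ι}` that is open with respect to
variations of finitely many variables. -/
structure TimeDomain (𝕜 ι : Type*) [RCLike 𝕜] where
  /-- the underlying set -/
  carrier : Set (ι → 𝕜)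
  isOpen' : ∀ t ∈ carrier, ∀ (n : ℕ) (v : Fin n → ι →₀ 𝕜),
    ∀ᶠ y : Fin n → 𝕜 in 𝓝 0, timeShift t v y ∈ carrier

section Smooth

variable {𝕜 ι : Type*} [RCLike 𝕜]

open Classical in
/-- Extension by zero; only used near points of the domain. -/
def TimeDomain.zeroExt (Ω : TimeDomain 𝕜 ι) (f : Ω.carrier → ℂ) (t : ι → 𝕜) : ℂ :=
  if h : t ∈ Ω.carrier then f ⟨t, h⟩ else 0

theorem timeShift_zero {n : ℕ} (t : ι → 𝕜) (v : Fin n → ι →₀ 𝕜) : timeShift t v 0 = t := by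
  simp [timeShift]

theorem timeShift_timeShift {n k : ℕ} (t : ι → 𝕜) (v : Fin n → ι →₀ 𝕜) (w : Fin k → ι →₀ 𝕜)
    (y : Fin n → 𝕜) (z : Fin k → 𝕜) :
    timeShift (timeShift t v y) w z = timeShift t (Fin.append v w) (Fin.append y z) := by
  simp [timeShift, Fin.sum_univ_add, add_assoc]

theorem TimeDomain.zeroExt_of_mem (Ω : TimeDomain 𝕜 ι) (f : Ω.carrier → ℂ) {t : ι → 𝕜}
    (h : t ∈ Ω.carrier) : Ω.zeroExt f t = f ⟨t, h⟩ := dif_pos h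

theorem TimeDomain.zeroExt_add (Ω : TimeDomain 𝕜 ι) (f g : Ω.carrier → ℂ) (t : ι → 𝕜) :
    Ω.zeroExt (f + g) t = Ω.zeroExt f t + Ω.zeroExt g t := by
  unfold zeroExt; split_ifs <;> simp

theorem TimeDomain.zeroExt_mul (Ω : TimeDomain 𝕜 ι) (f g : Ω.carrier → ℂ) (t : ι → 𝕜) :
    Ω.zeroExt (f * g) t = Ω.zeroExt f t * Ω.zeroExt g t := by
  unfold zeroExt; split_ifs <;> simp

theorem line_eq (Ω : TimeDomain 𝕜 ι) (v : ι →₀ 𝕜) (f : Ω.carrier → ℂ) (t : ι → 𝕜) :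
    (fun s : 𝕜 => Ω.zeroExt f (t + ⇑(s • v))) =
      (fun y : Fin 1 → 𝕜 => Ω.zeroExt f (timeShift t (fun _ => v) y)) ∘ fun s _ => s := by
  funext s
  simp [timeShift]

variable [NormedAlgebra 𝕜 ℂ]

/-- `f` is smooth in the variables: its restriction to every finite-dimensional slice is `C^∞`. -/
def TimeDomain.IsSmooth (Ω : TimeDomain 𝕜 ι) (f : Ω.carrier → ℂ) : Prop :=
  ∀ t ∈ Ω.carrier, ∀ (n : ℕ) (v : Fin n → ι →₀ 𝕜),
    ContDiffAt 𝕜 ∞ (fun y : Fin n → 𝕜 => Ω.zeroExt f (timeShift t v y)) 0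

/-- To check smoothness it is enough to compare with a smooth function near each point. -/
theorem TimeDomain.isSmooth_of (Ω : TimeDomain 𝕜 ι) (f : Ω.carrier → ℂ)
    (h : ∀ t ∈ Ω.carrier, ∀ (n : ℕ) (v : Fin n → ι →₀ 𝕜), ∃ F : (Fin n → 𝕜) → ℂ,
      ContDiffAt 𝕜 ∞ F 0 ∧ ∀ (y : Fin n → 𝕜) (hy : timeShift t v y ∈ Ω.carrier),
        F y = f ⟨_, hy⟩) : Ω.IsSmooth f := by
  intro t ht n v
  obtain ⟨F, hF, hFf⟩ := h t ht n v
  refine hF.congr_of_eventuallyEq ?_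
  filter_upwards [Ω.isOpen' t ht n v] with y hy
  rw [Ω.zeroExt_of_mem f hy, hFf y hy]

/-- The algebra of smooth functions on a domain. -/
def smoothSubalgebra (Ω : TimeDomain 𝕜 ι) : Subalgebra ℂ (Ω.carrier → ℂ) where
  carrier := {f | Ω.IsSmooth f}
  add_mem' := by
    intro f g hf hg t ht n v
    simp only [Ω.zeroExt_add]
    exact (hf t ht n v).add (hg t ht n v)
  mul_mem' := by
    intro f g hf hg t ht n v
    simp only [Ω.zeroExt_mul]
    exact (hf t ht n v).mul (hg t ht n v)
  algebraMap_mem' := by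
    intro c
    refine Ω.isSmooth_of _ fun t _ n v => ⟨fun _ => c, contDiffAt_const, fun y hy => rfl⟩

/-- The algebra of smooth functions on a domain. -/
abbrev SmoothFn (Ω : TimeDomain 𝕜 ι) : Type _ := smoothSubalgebra Ω

/-- The derivative along the direction `v` at a point. -/
def dirDeriv (Ω : TimeDomain 𝕜 ι) (v : ι →₀ 𝕜) (f : Ω.carrier → ℂ) (t : Ω.carrier) : ℂ :=
  deriv (fun s : 𝕜 => Ω.zeroExt f (t.1 + ⇑(s • v))) 0

theorem line_differentiable (Ω : TimeDomain 𝕜 ι) (v : ι →₀ 𝕜) {f : Ω.carrier → ℂ}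
    (hf : Ω.IsSmooth f) {t : ι → 𝕜} (ht : t ∈ Ω.carrier) :
    DifferentiableAt 𝕜 (fun s : 𝕜 => Ω.zeroExt f (t + ⇑(s • v))) 0 := by
  rw [line_eq]
  refine DifferentiableAt.comp (0 : 𝕜) ?_ (by fun_prop)
  exact (hf t ht 1 fun _ => v).differentiableAt (by simp)

theorem dirDeriv_smooth (Ω : TimeDomain 𝕜 ι) (v : ι →₀ 𝕜) {f : Ω.carrier → ℂ}
    (hf : Ω.IsSmooth f) : Ω.IsSmooth (dirDeriv Ω v f) := by
  intro t ht n w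
  set G : (Fin (n + 1) → 𝕜) → ℂ :=
    fun y => Ω.zeroExt f (timeShift t (Fin.append w fun _ : Fin 1 => v) y) with hG
  have hG0 : ContDiffAt 𝕜 ∞ G 0 := hf t ht _ _
  set e : (Fin n → 𝕜) → (Fin (n + 1) → 𝕜) := fun y => Fin.append y (fun _ : Fin 1 => (0 : 𝕜))
    with he
  have hesm : ContDiff 𝕜 ∞ e := by
    rw [contDiff_pi]
    intro i
    refine Fin.addCases (fun i => ?_) (fun i => ?_) i
    · simp only [he, Fin.append_left]; fun_prop
    · simp only [he, Fin.append_right]; fun_prop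
  have he0 : e 0 = 0 := by
    funext i
    refine Fin.addCases (fun i => ?_) (fun i => ?_) i
    · simp only [he, Fin.append_left]; rfl
    · simp only [he, Fin.append_right]; rfl
  have hfd : ContDiffAt 𝕜 ∞ (fun y => fderiv 𝕜 G (e y) (Fin.append 0 fun _ : Fin 1 => 1)) 0 := by
    have h1 : ContDiffAt 𝕜 ∞ (fderiv 𝕜 G) (e 0) := by
      rw [he0]; exact hG0.fderiv_right (by simp)
    exact (h1.comp (0 : Fin n → 𝕜) hesm.contDiffAt).clm_apply contDiffAt_const
  refine hfd.congr_of_eventuallyEq ?_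
  have hev : ∀ᶠ y in 𝓝 (0 : Fin n → 𝕜), DifferentiableAt 𝕜 G (e y) := by
    have h2 : ∀ᶠ z in 𝓝 (0 : Fin (n + 1) → 𝕜), DifferentiableAt 𝕜 G z := by
      have h3 : ContDiffAt 𝕜 1 G 0 := hG0.of_le (by exact_mod_cast le_top)
      filter_upwards [h3.eventually (by simp)] with z hz
      exact hz.differentiableAt (by simp)
    have h4 : Filter.Tendsto e (𝓝 0) (𝓝 0) := by
      have := hesm.continuous.tendsto 0
      rwa [he0] at this
    exact h4.eventually h2
  filter_upwards [Ω.isOpen' t ht n w, hev] with y hy hdy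
  rw [Ω.zeroExt_of_mem _ hy]
  have hline : HasDerivAt (fun s : 𝕜 => (Fin.append y fun _ : Fin 1 => s : Fin (n + 1) → 𝕜))
      (Fin.append 0 fun _ : Fin 1 => 1) 0 := by
    rw [hasDerivAt_pi]
    intro i
    refine Fin.addCases (fun i => ?_) (fun i => ?_) i
    · simp only [Fin.append_left]; exact hasDerivAt_const _ _
    · simp only [Fin.append_right]; exact hasDerivAt_id _
  have hcomp := (hdy.hasFDerivAt.comp_hasDerivAt (0 : 𝕜) hline)
  have heq : (fun s : 𝕜 => Ω.zeroExt f (timeShift t w y + ⇑(s • v))) =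
      G ∘ fun s : 𝕜 => (Fin.append y fun _ : Fin 1 => s : Fin (n + 1) → 𝕜) := by
    funext s
    have h5 := timeShift_timeShift t w (fun _ : Fin 1 => v) y (fun _ => s)
    simp only [Function.comp, hG, ← h5]
    simp [timeShift]
  rw [dirDeriv, heq]
  exact hcomp.deriv

/-- The derivation `f ↦ ∂_v f` of the algebra of smooth functions. -/
def dirDerivation (Ω : TimeDomain 𝕜 ι) (v : ι →₀ 𝕜) :
    Derivation ℂ (SmoothFn Ω) (SmoothFn Ω) :=
  Derivation.mk'
    { toFun := fun f => ⟨dirDeriv Ω v f.1, dirDeriv_smooth Ω v f.2⟩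
      map_add' := by
        intro f g
        ext t
        have h := deriv_add (line_differentiable Ω v f.2 t.2) (line_differentiable Ω v g.2 t.2)
        have h' : dirDeriv Ω v (f.1 + g.1) t = dirDeriv Ω v f.1 t + dirDeriv Ω v g.1 t := by
          simp only [dirDeriv, Ω.zeroExt_add]
          exact h
        exact h'
      map_smul' := by
        intro c f
        ext t
        have h0 : ∀ s, Ω.zeroExt (c • f.1) s = c * Ω.zeroExt f.1 s := by
          intro s; unfold TimeDomain.zeroExt; split_ifs <;> simp
        have h' : dirDeriv Ω v (c • f.1) t = c * dirDeriv Ω v f.1 t := by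
          simp only [dirDeriv, h0]
          exact deriv_const_mul c (line_differentiable Ω v f.2 t.2)
        exact h' }
    (by
      intro f g
      ext t
      have h := deriv_mul (line_differentiable Ω v f.2 t.2) (line_differentiable Ω v g.2 t.2)
      have h0 : ∀ f : Ω.carrier → ℂ, Ω.zeroExt f (t.1 + ⇑((0 : 𝕜) • v)) = f t := by
        intro f
        have : t.1 + ⇑((0 : 𝕜) • v) = t.1 := by simp
        rw [this]
        exact Ω.zeroExt_of_mem f t.2
      have h' : dirDeriv Ω v (f.1 * g.1) t =
          dirDeriv Ω v f.1 t * g.1 t + f.1 t * dirDeriv Ω v g.1 t := by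
        have h1 := h0 f.1
        have h2 := h0 g.1
        simp only [dirDeriv, Ω.zeroExt_mul]
        simp only [Pi.mul_def] at h
        rw [h, h1, h2]
      simp only [LinearMap.coe_mk, AddHom.coe_mk, smul_eq_mul]
      change dirDeriv Ω v (f.1 * g.1) t =
        f.1 t * dirDeriv Ω v g.1 t + g.1 t * dirDeriv Ω v f.1 t
      rw [h']; ring)

/-- The partial derivative `∂/∂t_i`. -/
def pderivT {Ω : TimeDomain 𝕜 ι} (i : ι) : Derivation ℂ (SmoothFn Ω) (SmoothFn Ω) :=
  dirDerivation Ω (Finsupp.single i 1)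

/-- The coordinate function `t_i`. -/
def coordFn (Ω : TimeDomain 𝕜 ι) (i : ι) : SmoothFn Ω :=
  ⟨fun t => algebraMap 𝕜 ℂ (t.1 i), Ω.isSmooth_of _ fun t _ n v =>
    ⟨fun y => algebraMap 𝕜 ℂ (t i + ∑ k, y k * v k i), by
      have h : ContDiff 𝕜 ∞ (fun z : 𝕜 => algebraMap 𝕜 ℂ z) := (Algebra.linearMap 𝕜 ℂ).toContinuousLinearMap.contDiff
      exact (h.comp (by fun_prop)).contDiffAt, fun y hy => by
        simp [timeShift]⟩⟩

/-- The open set where `g` does not vanish. -/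
def nonvanishing {Ω : TimeDomain 𝕜 ι} (g : SmoothFn Ω) : TimeDomain 𝕜 ι where
  carrier := {t | ∃ h : t ∈ Ω.carrier, g.1 ⟨t, h⟩ ≠ 0}
  isOpen' := by
    rintro t ⟨ht, hgt⟩ n v
    have hc := (g.2 t ht n v).continuousAt
    have hne := hc.eventually_ne (y := 0) (by
      rw [timeShift_zero, Ω.zeroExt_of_mem _ ht]; exact hgt)
    filter_upwards [Ω.isOpen' t ht n v, hne] with y hy hy'
    exact ⟨hy, by rwa [Ω.zeroExt_of_mem _ hy] at hy'⟩

/-- The quotient `f / g` on the open set where `g` does not vanish. -/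
def quotFn {Ω : TimeDomain 𝕜 ι} (f g : SmoothFn Ω) : SmoothFn (nonvanishing g) :=
  ⟨fun t => f.1 ⟨t.1, t.2.1⟩ / g.1 ⟨t.1, t.2.1⟩,
    (nonvanishing g).isSmooth_of _ fun t ht n v =>
      ⟨fun y => Ω.zeroExt f.1 (timeShift t v y) * (Ω.zeroExt g.1 (timeShift t v y))⁻¹,
        (f.2 t ht.1 n v).mul ((g.2 t ht.1 n v).inv (by
          rw [timeShift_zero, Ω.zeroExt_of_mem _ ht.1]; exact ht.2)),
        fun y hy => by
          simp only [Ω.zeroExt_of_mem _ hy.1, div_eq_mul_inv]⟩⟩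

end Smooth

/-- A linear substitution of the variables: `toFun` expresses the variables `t_i`, `i ∈ ι`, in
terms of new variables `s_j`, `j ∈ κ`; changing `s_j` by `c` changes `t` by `c • col j`, so that
each new variable enters only finitely many old ones. -/
structure TimeMap (𝕜 κ ι : Type*) [RCLike 𝕜] where
  /-- the substitution -/
  toFun : (κ → 𝕜) → (ι → 𝕜)
  /-- the direction in which the new variable `s_j` moves the old variables -/
  col : κ → ι →₀ 𝕜
  map_single : ∀ (s : κ → 𝕜) (j : κ) (c : 𝕜),
    toFun (s + ⇑(Finsupp.single j c)) = toFun s + ⇑(c • col j)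

section Substitution

variable {𝕜 κ ι : Type*} [RCLike 𝕜]

theorem TimeMap.map_add (φ : TimeMap 𝕜 κ ι) (s : κ → 𝕜) (v : κ →₀ 𝕜) :
    φ.toFun (s + ⇑v) = φ.toFun s + ⇑(Finsupp.linearCombination 𝕜 φ.col v) := by
  induction v using Finsupp.induction_linear generalizing s with
  | zero => simp
  | add v w hv hw => rw [Finsupp.coe_add, ← add_assoc, hw, hv, _root_.map_add, Finsupp.coe_add, add_assoc]
  | single j c => rw [φ.map_single, Finsupp.linearCombination_single]

theorem TimeMap.map_shift (φ : TimeMap 𝕜 κ ι) {n : ℕ} (s : κ → 𝕜) (v : Fin n → κ →₀ 𝕜)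
    (y : Fin n → 𝕜) : φ.toFun (timeShift s v y) =
      timeShift (φ.toFun s) (fun i => Finsupp.linearCombination 𝕜 φ.col (v i)) y := by
  rw [timeShift, φ.map_add, timeShift, map_sum]
  simp only [map_smul]

/-- The preimage of a domain under a substitution. -/
def TimeDomain.comap (Ω : TimeDomain 𝕜 ι) (φ : TimeMap 𝕜 κ ι) : TimeDomain 𝕜 κ where
  carrier := φ.toFun ⁻¹' Ω.carrier
  isOpen' := by
    intro s hs n v
    filter_upwards [Ω.isOpen' _ hs n fun i => Finsupp.linearCombination 𝕜 φ.col (v i)] with y hy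
    rw [Set.mem_preimage, φ.map_shift]
    exact hy

variable [NormedAlgebra 𝕜 ℂ]

/-- Substitution `f ↦ f ∘ φ`, as a homomorphism of algebras of smooth functions. -/
def pullback {Ω : TimeDomain 𝕜 ι} (φ : TimeMap 𝕜 κ ι) :
    SmoothFn Ω →+* SmoothFn (Ω.comap φ) where
  toFun f := ⟨fun s => f.1 ⟨φ.toFun s.1, s.2⟩, (Ω.comap φ).isSmooth_of _ fun s hs n v =>
    ⟨_, f.2 _ hs n fun i => Finsupp.linearCombination 𝕜 φ.col (v i), fun y hy => by
      have hy' : φ.toFun (timeShift s v y) ∈ Ω.carrier := hy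
      rw [← φ.map_shift, Ω.zeroExt_of_mem _ hy']⟩⟩
  map_one' := rfl
  map_mul' _ _ := rfl
  map_zero' := rfl
  map_add' _ _ := rfl

end Substitution

/-! ### Tau-functions and wave operators -/

section Tau

variable {𝕜 : Type*} [RCLike 𝕜] [NormedAlgebra 𝕜 ℂ]

section Hirota

variable {r : ℕ} {Ω : TimeDomain 𝕜 (Fin r × ℕ+)}

/-- The coefficient of `z^{-k}` in
`e_-^{(a)}(σ ∂/∂t, z) f = exp(-σ ∑_{j ≥ 1} (z^{-j} / j) ∂/∂t_j^{(a)}) f`, for a sign `σ`.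
The `n`-th power in the exponential series contributes the terms
`((-σ)^n / n!) ∏_{i ≤ n} (1 / j_i) ∂/∂t_{j_i}^{(a)}` with `j_1 + ... + j_n = k`. -/
def eMinus (a : Fin r) (σ : ℤˣ) (k : ℕ) (f : SmoothFn Ω) : SmoothFn Ω :=
  ∑ c : Composition k,
    ((-((σ : ℤ) : ℂ)) ^ c.length / (c.length.factorial : ℂ) *
        ∏ i, (1 / (c.blocksFun i : ℂ))) •
      (List.ofFn fun i => (⟨c.blocksFun i, c.one_le_blocksFun i⟩ : ℕ+)).foldr
        (fun j g => pderivT (a, j) g) f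

/-- `e_-^{(a)}(σ ∂/∂t, z) f` as a series in `z`: the coefficient of `z^i`, `i ∈ ℤ`. -/
def eMinusSeries (a : Fin r) (σ : ℤˣ) (f : SmoothFn Ω) (i : ℤ) : SmoothFn Ω :=
  if i ≤ 0 then eMinus a σ (-i).toNat f else 0

/-- If `G(t', z)` is a Laurent series in `z⁻¹` with coefficients depending on `t'`, then
`∂/∂t'_j^{(b)} (e_+^{(a)}(t' - t'', z) G) = e_+^{(a)}(t' - t'', z) (∂/∂t'_j^{(b)} + δ_{ab} z^j) G`.
This is the series obtained from `G` by applying such operators for all `(b, j)` in the list;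
as `e_+^{(a)}(0, z) = 1`, it is the value at `t' = t''` of the corresponding derivative of
`e_+^{(a)}(t' - t'', z) G(t', z)`. -/
def waveDeriv (a : Fin r) (l : List (Fin r × ℕ+)) (G : ℤ → SmoothFn Ω) : ℤ → SmoothFn Ω :=
  l.foldr (fun bj H i => pderivT bj (H i) + if bj.1 = a then H (i - (bj.2 : ℕ)) else 0) G

/-- The bilinear equations, for a tau-function of charge `k` (only the `τ^m` with `|m| = k` enter):
`Res_z ∑_a (-1)^{|m' + m''|_{a-1}} z^{m'_a - m''_a + ℓ p_a - 2} e_+^{(a)}(t' - t'', z)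
  e_-^{(a)}(∂/∂t' - ∂/∂t'', z) τ^{m' - e_a}(t') τ^{m'' + e_a}(t'') = 0`,
understood as the collection of equations obtained by applying an arbitrary product of
derivatives with respect to `t'` (the list `l`) and then setting `t' = t''`.
The residue pairs the coefficient of `z^{q - 1 - (m'_a - m''_a + ℓ p_a - 2)}` of the first factor
with that of `z^{-q}` of the second one; the sum over `q` is finite. -/
def IsTauFunction (p : Fin r → ℕ) (k : ℤ) (τ : (Fin r → ℤ) → SmoothFn Ω) : Prop :=
  ∀ (ℓ : ℕ) (m' m'' : Fin r → ℤ), ∑ i, m' i = k + 1 → ∑ i, m'' i = k - 1 →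
    ∀ l : List (Fin r × ℕ+),
      ∑ a : Fin r, (Int.negOnePow (∑ i ∈ Finset.Iio a, (m' i + m'' i)) : ℤ) •
        ∑ᶠ q : ℕ,
          waveDeriv a l (eMinusSeries a 1 (τ (m' - Pi.single a 1)))
            ((q : ℤ) - 1 - (m' a - m'' a + ℓ * p a - 2)) *
          eMinus a (-1) q (τ (m'' + Pi.single a 1)) = 0

/-- `τ^m` times the coefficient of `z^{-n}` in `P^±_{ab}(m, t, z)` (sign `σ`), where
`P^±_{ab}(m, t, ±z) = (-1)^{[a < b]} (z^{δ_ab - 1} / τ^m) e_-^{(b)}(±∂/∂t, z) τ^{m ± e_a ∓ e_b}`. -/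
def waveNum (τ : (Fin r → ℤ) → SmoothFn Ω) (σ : ℤˣ) (m : Fin r → ℤ) (a b : Fin r) (n : ℕ) :
    SmoothFn Ω :=
  (((if a < b then -1 else 1) * σ ^ n : ℤˣ) : ℤ) •
    eMinusSeries b σ (τ (m + (σ : ℤ) • (Pi.single a 1 - Pi.single b 1)))
      (-(n : ℤ) + (if a = b then 0 else 1))

end Hirota

/-- Functions of a space variable `x` (index `none`) and times (indices `some _`) form a
differential ring with derivation `∂ = ∂/∂x`. -/
instance {κ : Type*} (Ω : TimeDomain 𝕜 (Option κ)) : Differential (SmoothFn Ω) :=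
  ⟨(pderivT none).restrictScalars ℤ⟩

section Reduction

variable {r : ℕ} [NeZero r] (p : Fin r → ℕ)

/-- The indices `a` with `p_a = p_1` (for a partition these are `1, ..., r_1`). -/
abbrev Blk1 : Type := {a : Fin r // p a = p 0}

/-- The indices `a` with `p_a ≠ p_1` (for a partition these are `r_1 + 1, ..., r`). -/
abbrev Blk2 : Type := {a : Fin r // p a ≠ p 0}

/-- The substitution `t_j^{(a)} ↦ t_j^{(a)} + δ_{j1} x` for `a ≤ r_1`, `t_j^{(a)} ↦ 0` for
`a > r_1`. -/
def redMap : TimeMap 𝕜 (Option (Blk1 p × ℕ+)) (Fin r × ℕ+) where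
  toFun s aj := if h : p aj.1 = p 0 then
    s (some (⟨aj.1, h⟩, aj.2)) + (if aj.2 = 1 then s none else 0) else 0
  col
    | none => ∑ a : Blk1 p, Finsupp.single (a.1, 1) 1
    | some (a, j) => Finsupp.single (a.1, j) 1
  map_single := by
    rintro s (_ | ⟨a, j⟩) c
    · funext ⟨b, i⟩
      have hsum : (∑ a : Blk1 p, Finsupp.single ((a.1, 1) : Fin r × ℕ+) (1 : 𝕜) (b, i)) =
          if p b = p 0 ∧ i = 1 then 1 else 0 := by
        split_ifs with h
        · obtain ⟨h1, rfl⟩ := h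
          rw [Finset.sum_eq_single (⟨b, h1⟩ : Blk1 p)]
          · simp
          · intro a _ ha
            exact Finsupp.single_eq_of_ne fun he => ha (Subtype.ext (Prod.ext_iff.mp he).1.symm)
          · simp
        · refine Finset.sum_eq_zero fun a _ => Finsupp.single_eq_of_ne fun he => h ?_
          have := Prod.ext_iff.mp he
          simp only at this
          exact ⟨this.1 ▸ a.2, this.2⟩
      by_cases h : p b = p 0
      · by_cases hi : i = 1
        · subst hi
          simp [hsum, h, add_assoc]
        · simp [h, hi]
      · simp [hsum, h]
    · funext ⟨b, i⟩
      by_cases h : p b = p 0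
      · by_cases hb : b = a.1 ∧ i = j
        · obtain ⟨rfl, rfl⟩ := hb
          simp [h]
          ring
        · have h1 : ((b, i) : Fin r × ℕ+) ≠ (a.1, j) := fun he => hb (Prod.ext_iff.mp he)
          have h2 : (some ((⟨b, h⟩ : Blk1 p), i)) ≠ some (a, j) := by
            intro he
            have he' := Prod.ext_iff.mp (Option.some.inj he)
            exact hb ⟨congrArg Subtype.val he'.1, he'.2⟩
          simp [h, Finsupp.single_eq_of_ne h1, Finsupp.single_eq_of_ne h2]
      · have h1 : ((b, i) : Fin r × ℕ+) ≠ (a.1, j) := fun he =>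
          h (by rw [show b = a.1 from (Prod.ext_iff.mp he).1]; exact a.2)
        simp [h, Finsupp.single_eq_of_ne h1]

/-- The identification `t_j^{(a)} = t_j` of the times. -/
def diagMap : TimeMap 𝕜 (Option ℕ+) (Option (Blk1 p × ℕ+)) where
  toFun s i := s (i.map Prod.snd)
  col
    | none => Finsupp.single none 1
    | some j => ∑ a : Blk1 p, Finsupp.single (some (a, j)) 1
  map_single := by
    rintro s (_ | j) c
    · funext i
      rcases i with _ | ⟨b, i⟩ <;> simp
    · funext i
      rcases i with _ | ⟨b, i⟩
      · simp
      · by_cases h : i = j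
        · subst h
          simp [Finsupp.single_apply]
        · simp [h]

/-- The substitution `x ↦ -x`, `t_j ↦ ε^j t_j`. -/
def flipMap (ε : 𝕜) : TimeMap 𝕜 (Option ℕ+) (Option ℕ+) where
  toFun s
    | none => - s none
    | some j => ε ^ (j : ℕ) * s (some j)
  col
    | none => Finsupp.single none (-1)
    | some j => Finsupp.single (some j) (ε ^ (j : ℕ))
  map_single := by
    rintro s (_ | j) c
    · funext i
      rcases i with _ | i
      · simp; ring
      · simp
    · funext i
      rcases i with _ | i
      · simp
      · by_cases h : i = j
        · subst h
          simp; ring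
        · have h' : (some i : Option ℕ+) ≠ some j := fun he => h (Option.some.inj he)
          simp [Finsupp.single_eq_of_ne h']

variable {Ω : TimeDomain 𝕜 (Fin r × ℕ+)} (τ : (Fin r → ℤ) → SmoothFn Ω) (m : Fin r → ℤ)

/-- The values of `x` and of the times `t_j^{(a)}`, `a ≤ r_1`, at which the reduced
`τ^m` does not vanish. -/
abbrev waveDomain : TimeDomain 𝕜 (Option (Blk1 p × ℕ+)) :=
  nonvanishing (pullback (redMap p) (τ m))

/-- The coefficient `Q^±_{ab;n}(m, x, t)` of `z^{-n}` in `Q^±_{ab}(m, x, t, z)`. -/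
def waveQ (σ : ℤˣ) (a b : Fin r) (n : ℕ) : SmoothFn (waveDomain p τ m) :=
  quotFn (pullback (redMap p) (waveNum τ σ m a b n)) (pullback (redMap p) (τ m))

/-- The operator `Q^+_{11}(m, x, t, ∂)`. -/
def waveQ11 : Matrix (Blk1 p) (Blk1 p) (PsiDO (SmoothFn (waveDomain p τ m))) :=
  Matrix.of fun a b => PsiDO.ofSymbol (waveQ p τ m 1 a.1 b.1)

/-- The reduced Lax operators `𝓛_a = Q^+_{11} ∘ E_{aa} ∂ ∘ (Q^+_{11})⁻¹`. -/
def laxA (a : Blk1 p) : Matrix (Blk1 p) (Blk1 p) (PsiDO (SmoothFn (waveDomain p τ m))) :=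
  waveQ11 p τ m * Matrix.single a a (PsiDO.mono 1 1) * Ring.inverse (waveQ11 p τ m)

/-- The values of `x` and `t = (t_j)` at which the reduced `τ^m`, with the times identified,
does not vanish. -/
abbrev laxDomain : TimeDomain 𝕜 (Option ℕ+) := (waveDomain p τ m).comap (diagMap p)

/-- The constrained Lax operator `∑_{a ≤ r_1} 𝓛_a^{p_1}` after the identification of the times. -/
def laxTilde : Matrix (Blk1 p) (Blk1 p) (PsiDO (SmoothFn (laxDomain p τ m))) :=
  (∑ a, laxA p τ m a ^ p 0).map (PsiDO.mapCoeff (pullback (diagMap p)).toAddMonoidHom)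

/-! The operator built from the coefficients `w_{ba;j}`; `ε` is a `p_1`-th root of `-1`. -/

variable (ε : 𝕜)

/-- The values of `x` and `t` for which `(-x, (ε^j t_j)_j)` lies in the previous domain. -/
abbrev solDomain : TimeDomain 𝕜 (Option ℕ+) := (laxDomain p τ m).comap (flipMap ε)

/-- `Q^±_{ab;n}(m, -x, t̃)` with identified times and `t̃_j = ε^j t_j`. -/
def solQ (σ : ℤˣ) (a b : Fin r) (n : ℕ) : SmoothFn (solDomain p τ m ε) :=
  pullback (flipMap ε) (pullback (diagMap p) (waveQ p τ m σ a b n))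

/-- The function `x^i / i!`. -/
def divPowX {κ : Type*} (V : TimeDomain 𝕜 (Option κ)) (i : ℕ) : SmoothFn V :=
  ((1 : ℂ) / (i.factorial : ℂ)) • coordFn V none ^ i

/-- `w (-∂)^j` for `j ∈ ℤ`. -/
def monoNeg {R : Type*} [CommRing R] (w : R) (j : ℤ) : PsiDO R :=
  PsiDO.mono ((Int.negOnePow j : ℤ) • w) j

/-- The differential operator `∑_{j < n} w_j (-∂)^j`. -/
def diffOp {R : Type*} [CommRing R] (n : ℕ) (w : ℕ → R) : PsiDO R :=
  ∑ j ∈ Finset.range n, monoNeg (w j) j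

/-- The functions `w_j` in the expansion `∑_j w_j (-∂)^j` of an operator. -/
def negCoeff {R : Type*} [CommRing R] (A : PsiDO R) (j : ℕ) : R :=
  (-1) ^ j * A.coeff j

/-- `w_{ba;j} = -∑_{i ≤ j} (x^i / i!) Q^+_{ab;j-i+1}(-x, t̃)` for `a ≤ r_1 < b`. -/
def w12 (a : Blk1 p) (b : Blk2 p) (j : ℕ) : SmoothFn (solDomain p τ m ε) :=
  -∑ i ∈ Finset.range (j + 1),
    divPowX (solDomain p τ m ε) i * solQ p τ m ε 1 a.1 b.1 (j - i + 1)

/-- The block `W_{12}`. -/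
def solW12 : Matrix (Blk1 p) (Blk2 p) (PsiDO (SmoothFn (solDomain p τ m ε))) :=
  Matrix.of fun a b => diffOp (p b.1) (w12 p τ m ε a b)

/-- `w_{ba;j}` for `b ≤ r_1 < a`, from the expansion of
`∑_{j < p_a} ∑_{i ≤ j} ∂^j ∘ Q^-_{ba;j-i+1}(-x, t̃) x^i / i!`. -/
def w21 (a : Blk2 p) (b : Blk1 p) (j : ℕ) : SmoothFn (solDomain p τ m ε) :=
  negCoeff (∑ j ∈ Finset.range (p a.1), ∑ i ∈ Finset.range (j + 1),
    PsiDO.mono 1 j * PsiDO.mono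
      (solQ p τ m ε (-1) b.1 a.1 (j - i + 1) * divPowX (solDomain p τ m ε) i) 0) j

/-- The block `W_{21}`. -/
def solW21 : Matrix (Blk2 p) (Blk1 p) (PsiDO (SmoothFn (solDomain p τ m ε))) :=
  Matrix.of fun a b => diffOp (p a.1) (w21 p τ m ε a b)

/-- `(-∂)^{-q} = ∑_{a > r_1} E_{aa} (-∂)^{-p_a}`. -/
def negDq : Matrix (Blk2 p) (Blk2 p) (PsiDO (SmoothFn (solDomain p τ m ε))) :=
  Matrix.diagonal fun a => monoNeg 1 (-(p a.1 : ℤ))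

/-- `1 (-∂)^{p_1}`. -/
def negDp : Matrix (Blk1 p) (Blk1 p) (PsiDO (SmoothFn (solDomain p τ m ε))) :=
  Matrix.diagonal fun _ => monoNeg 1 (p 0)

/-- The operator `L̃(m, -x, t̃, -∂)`. -/
def laxFlip : Matrix (Blk1 p) (Blk1 p) (PsiDO (SmoothFn (solDomain p τ m ε))) :=
  (laxTilde p τ m).map (PsiDO.reflect (pullback (flipMap ε)))

/-- `w_{ba;j}` for `a, b ≤ r_1`, from the expansion of
`-L̃(m, -x, t̃, -∂)_+ + 1 (-∂)^{p_1} - (W_{12} ∘ (-∂)^{-q} ∘ W_{21})_+`. -/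
def w11 (a b : Blk1 p) (j : ℕ) : SmoothFn (solDomain p τ m ε) :=
  negCoeff ((-(laxFlip p τ m ε).map PsiDO.pos + negDp p τ m ε -
    (solW12 p τ m ε * negDq p τ m ε * solW21 p τ m ε).map PsiDO.pos) a b) j

/-- The block `W_{11}`. -/
def solW11 : Matrix (Blk1 p) (Blk1 p) (PsiDO (SmoothFn (solDomain p τ m ε))) :=
  Matrix.of fun a b => diffOp (p 0) (w11 p τ m ε a b)

/-- The operator
`-1 (-∂)^{p_1} + W_{11} + W_{12} ∘ (-∂)^{-q} ∘ W_{21}`, which is the quasideterminant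
`-1 (-∂)^{p_1} + W_{11} - W_{12} ∘ (-(-∂)^q + W_{22})⁻¹ ∘ W_{21}` for `W_{22} = 0`. -/
def laxSol : Matrix (Blk1 p) (Blk1 p) (PsiDO (SmoothFn (solDomain p τ m ε))) :=
  -negDp p τ m ε + solW11 p τ m ε + solW12 p τ m ε * negDq p τ m ε * solW21 p τ m ε

end Reduction

/-! ### Lax equations -/

section LaxEquations

variable {I : Type*} [Fintype I] [DecidableEq I] {V : TimeDomain 𝕜 (Option ℕ+)}

/-- `B` is an `n`-th root of `A` of the form `c 1 ∂ + (terms of order ≤ 0)`. -/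
def IsRootWithLeading (c : ℂ) (n : ℕ) (A B : Matrix I I (PsiDO (SmoothFn V))) : Prop :=
  B ^ n = A ∧ ∀ (a b : I) (i : ℤ), 1 ≤ i →
    (B a b).coeff i = if a = b ∧ i = 1 then algebraMap ℂ (SmoothFn V) c else 0

/-- `A` has exactly one `n`-th root `A^{1/n}` of the form `c 1 ∂ + (terms of order ≤ 0)`, and
`∂A/∂t_j = [(A^{j/n})_+, A]` for all `j ≥ 1`, where `A^{j/n} = (A^{1/n})^j`. -/
def SolvesLax (c : ℂ) (n : ℕ) (A : Matrix I I (PsiDO (SmoothFn V))) : Prop :=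
  (∃! B, IsRootWithLeading c n A B) ∧
    ∀ B, IsRootWithLeading c n A B → ∀ j : ℕ+,
      A.map (PsiDO.mapCoeff (pderivT (some j)).toLinearMap.toAddMonoidHom) =
        ⁅(B ^ (j : ℕ)).map PsiDO.pos, A⁆

end LaxEquations

end Tau

end

/-! Sato's dressing method carries the argument. The bilinear equations say that a residue vanishes
after any product of derivatives in the first set of times. After reduction, `∂/∂x` acts on the
factor carrying `exp(xz)` as `∂ + z`, which is left composition with `∂` on the operator with that
symbol. Each equation therefore reads `res (∂^k ∘ A) = 0` for all `k`, up to terms from the indices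
`a > r_1`, which carry no exponential. If all these residues vanish, `A` is a differential operator
(`coeff_eq_zero_of_residues`).

For `ℓ = 0` the second block contributes nothing, because both its factors are `O(z⁻¹)`. So `Q_11`
composed with the formal adjoint of `Q^-_11` is differential with leading coefficient `1` in order
zero; it equals `1`, which gives the inverse (`waveQ11_mul_waveInv`). Differentiating the same
equation in `t_j^{(d)}` gives the Sato-Wilson equation (`waveQ11_evolution`). Conjugating the
constant operator `∂^{p_1}` and summing over `d` turns it into the Lax equation, with root `Q_11 ∘ ∂
∘ Q_11⁻¹` (`lax_of_dressing`, `sum_dressed_evolution`). Uniqueness of the root is a comparison of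
leading terms of the difference of two roots (`PsiMat.root_unique`).

For `ℓ = 1` the second block survives and gives the negative part of `Q_11 ∘ ∂^{p_1} ∘ Q_11⁻¹` as a
finite sum of terms `f ∂⁻¹ ∘ g` (`isDiff_dressed`). The powers of `x` in `W_12` and `W_21` are
arranged so that `W_12 ∘ (-∂)^{-q} ∘ W_21` has the corresponding negative part: Taylor expansion
collapses the product, and the binomial formula for `(x - x)^N` leaves only `N = 0`
(`neg_part_product`). `W_11` is defined to correct the differential part, so the two operators agree
(`laxSol_eq`).

The flip `x ↦ -x`, `∂ ↦ -∂`, `t_j ↦ ε^j t_j` rescales the `j`-th flow by `ε^j`. Multiplying the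
flipped root by `ε` absorbs this factor, and `ε^{p_1} = -1` produces the sign of the new operator
(`solvesLax_flip`). -/

noncomputable section

/-! ### Algebra of pseudodifferential operators -/

namespace PsiDO

section Additive

variable {R : Type*} [CommRing R]

/-- The coefficient of `∂^i` as an additive map. -/
def coeffHom (i : ℤ) : PsiDO R →+ R where
  toFun A := A.coeff i
  map_zero' := rfl
  map_add' _ _ := rfl

@[simp] theorem coeff_neg (A : PsiDO R) (i : ℤ) : (-A).coeff i = -A.coeff i := rfl

@[simp] theorem coeff_sub (A B : PsiDO R) (i : ℤ) :
    (A - B).coeff i = A.coeff i - B.coeff i := map_sub (coeffHom i) A B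

@[simp] theorem coeff_sum {ι : Type*} (s : Finset ι) (A : ι → PsiDO R) (i : ℤ) :
    (∑ x ∈ s, A x).coeff i = ∑ x ∈ s, (A x).coeff i := map_sum (coeffHom i) A s

theorem coeff_mono (a : R) (n i : ℤ) : (mono a n).coeff i = if i = n then a else 0 := rfl

theorem coeff_ofSymbol (c : ℕ → R) (i : ℤ) :
    (ofSymbol c).coeff i = if i ≤ 0 then c (-i).toNat else 0 := rfl

@[simp] theorem coeff_pos (A : PsiDO R) (i : ℤ) :
    A.pos.coeff i = if 0 ≤ i then A.coeff i else 0 := rfl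

@[simp] theorem coeff_mapCoeff {S : Type*} [CommRing S] (φ : R →+ S) (A : PsiDO R) (i : ℤ) :
    (mapCoeff φ A).coeff i = φ (A.coeff i) := rfl

@[simp] theorem coeff_reflect {S : Type*} [CommRing S] (φ : R →+* S) (A : PsiDO R) (i : ℤ) :
    (reflect φ A).coeff i = (Int.negOnePow i : ℤ) • φ (A.coeff i) := rfl

theorem mono_add (a b : R) (n : ℤ) : mono (a + b) n = mono a n + mono b n := by
  ext i
  simp only [coeff_mono, coeff_add]
  split_ifs <;> simp

@[simp] theorem mono_zero (n : ℤ) : mono (0 : R) n = 0 := by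
  ext i
  simp [coeff_mono]

/-- Monomials of a fixed degree as an additive map. -/
def monoHom (n : ℤ) : R →+ PsiDO R where
  toFun a := mono a n
  map_zero' := mono_zero n
  map_add' a b := mono_add a b n

theorem mono_neg (a : R) (n : ℤ) : mono (-a) n = -mono a n := map_neg (monoHom n) a

theorem mono_sum {ι : Type*} (s : Finset ι) (f : ι → R) (n : ℤ) :
    mono (∑ x ∈ s, f x) n = ∑ x ∈ s, mono (f x) n := map_sum (monoHom n) f s

theorem mono_zsmul (c : ℤ) (a : R) (n : ℤ) : mono (c • a) n = c • mono a n :=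
  map_zsmul (monoHom n) c a

theorem coeff_zsmul (c : ℤ) (A : PsiDO R) (i : ℤ) : (c • A).coeff i = c • A.coeff i :=
  map_zsmul (coeffHom i) c A

/-- `A` has order at most `N`. -/
def OrdLE (A : PsiDO R) (N : ℤ) : Prop := ∀ i, N < i → A.coeff i = 0

theorem OrdLE.mono {A : PsiDO R} {N M : ℤ} (h : A.OrdLE N) (hNM : N ≤ M) : A.OrdLE M :=
  fun i hi => h i (by omega)

theorem OrdLE.add {A B : PsiDO R} {N : ℤ} (hA : A.OrdLE N) (hB : B.OrdLE N) : (A + B).OrdLE N :=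
  fun i hi => by rw [coeff_add, hA i hi, hB i hi, add_zero]

theorem OrdLE.sum {ι : Type*} {s : Finset ι} {A : ι → PsiDO R} {N : ℤ}
    (h : ∀ x ∈ s, (A x).OrdLE N) : (∑ x ∈ s, A x).OrdLE N :=
  fun i hi => by rw [coeff_sum]; exact Finset.sum_eq_zero fun x hx => h x hx i hi

theorem ordLE_mono (a : R) (n : ℤ) : (PsiDO.mono a n).OrdLE n :=
  fun _ hi => if_neg hi.ne'

theorem ordLE_ofSymbol (c : ℕ → R) : (ofSymbol c).OrdLE 0 := fun _ hi => if_neg hi.not_ge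

/-- Shift of all the exponents by `j`. -/
def shift (j : ℤ) : PsiDO R →+ PsiDO R where
  toFun A := mk (fun i => A.coeff (i - j)) (by
    obtain ⟨N, hN⟩ := A.bdd
    exact ⟨N + j, fun i hi => hN _ (by omega)⟩)
  map_zero' := rfl
  map_add' _ _ := rfl

@[simp] theorem coeff_shift (j : ℤ) (A : PsiDO R) (i : ℤ) :
    (shift j A).coeff i = A.coeff (i - j) := rfl

/-- `mapCoeff` as an additive map. -/
def mapCoeffHom {S : Type*} [CommRing S] (φ : R →+ S) : PsiDO R →+ PsiDO S where
  toFun := mapCoeff φ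
  map_zero' := by ext i; simp
  map_add' A B := by ext i; simp

@[simp] theorem mapCoeffHom_apply {S : Type*} [CommRing S] (φ : R →+ S) (A : PsiDO R) :
    mapCoeffHom φ A = mapCoeff φ A := rfl

/-- The differential part as an additive map. -/
def posHom : PsiDO R →+ PsiDO R where
  toFun := pos
  map_zero' := by ext i; simp
  map_add' A B := by ext i; simp only [coeff_pos, coeff_add]; split_ifs <;> simp

theorem pos_mapCoeff {S : Type*} [CommRing S] (φ : R →+ S) (A : PsiDO R) :
    (mapCoeff φ A).pos = mapCoeff φ A.pos := by
  ext i
  simp only [coeff_pos, coeff_mapCoeff]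
  split_ifs <;> simp

theorem pos_reflect {S : Type*} [CommRing S] (φ : R →+* S) (A : PsiDO R) :
    (reflect φ A).pos = reflect φ A.pos := by
  ext i
  simp only [coeff_pos, coeff_reflect]
  split_ifs <;> simp

end Additive

/-! ### Products, orders and residues -/

section Products

variable {R : Type*} [CommRing R] [Differential R]

/-- The product as a finite sum. -/
theorem coeff_mul_eq_sum (A B : PsiDO R) (k N : ℤ) (hA : A.OrdLE N) (hB : B.OrdLE N) :
    (A * B).coeff k = ∑ i ∈ Finset.Icc (k - N) N, ∑ j ∈ Finset.Icc (k - N) N,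
      mulTerm (A.coeff i) (B.coeff j) i j k :=
  mulCoeff_eq A B k N _ _ hA hB (fun _ h1 h2 => Finset.mem_Icc.mpr ⟨h1, h2⟩)
    (fun _ h1 h2 => Finset.mem_Icc.mpr ⟨h1, h2⟩)

theorem exists_ordLE_pair (A B : PsiDO R) : ∃ N, A.OrdLE N ∧ B.OrdLE N := by
  obtain ⟨N, -, hA, hB, -⟩ := exists_bound A B 0
  exact ⟨N, hA, hB⟩

theorem OrdLE.mul {A B : PsiDO R} {N M : ℤ} (hA : A.OrdLE N) (hB : B.OrdLE M) :
    (A * B).OrdLE (N + M) := by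
  intro k hk
  rw [coeff_mul, mulCoeff, ← finsum_zero (α := ℤ)]
  refine finsum_congr fun i => ?_
  rw [← finsum_zero (α := ℕ)]
  refine finsum_congr fun n => ?_
  by_cases hi : N < i
  · rw [hA i hi]; simp
  · rw [hB _ (by omega), iter_zero]; simp

/-- Every derivative in the product lowers the order, so only the undifferentiated product of the
top coefficients reaches order `N + M`. -/
theorem coeff_mul_top {A B : PsiDO R} {N M : ℤ} (hA : A.OrdLE N) (hB : B.OrdLE M) :
    (A * B).coeff (N + M) = A.coeff N * B.coeff M := by
  rw [coeff_mul, mulCoeff, finsum_eq_single _ N, finsum_eq_single _ 0]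
  · simp
  · intro n hn
    rw [hB _ (by omega), iter_zero]; simp
  · intro i hi
    rw [← finsum_zero (α := ℕ)]
    refine finsum_congr fun n => ?_
    by_cases hi' : N < i
    · rw [hA i hi']; simp
    · rw [hB _ (by omega), iter_zero]; simp

theorem coeff_mono_mul (a : R) (i : ℤ) (B : PsiDO R) (k : ℤ) :
    (mono a i * B).coeff k = ∑ᶠ n : ℕ, Ring.choose i n •
      (a * (Differential.deriv (R := R))^[n] (B.coeff (k - i + n))) := by
  rw [coeff_mul, mulCoeff, finsum_eq_single _ i]
  · simp [coeff_mono]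
  · intro j hj
    rw [coeff_mono, if_neg hj]
    simp

@[simp] theorem coeff_mono_zero_mul (a : R) (B : PsiDO R) (k : ℤ) :
    (mono a 0 * B).coeff k = a * B.coeff k := by
  rw [coeff_mono_mul, finsum_eq_single _ 0]
  · simp
  · intro n hn
    rw [Ring.choose_zero_pos ℤ (Nat.pos_of_ne_zero hn)]
    simp

theorem coeff_d_mul (B : PsiDO R) (k : ℤ) :
    (mono 1 1 * B).coeff k = B.coeff (k - 1) + Differential.deriv (B.coeff k) := by
  rw [coeff_mono_mul, finsum_eq_sum_of_support_subset (s := Finset.range 2)]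
  · simp [Finset.sum_range_succ]
  · intro n hn
    by_contra hc
    apply hn
    have hn2 : 1 < n := by simpa using hc
    have : Ring.choose (1 : ℤ) n = 0 := by
      have := Ring.choose_natCast (R := ℤ) 1 n
      rw [Nat.choose_eq_zero_of_lt (by omega)] at this
      simpa using this
    simp [this]

theorem iter_one_pos {n : ℕ} (hn : n ≠ 0) : (Differential.deriv (R := R))^[n] (1 : R) = 0 := by
  obtain ⟨n, rfl⟩ := Nat.exists_eq_succ_of_ne_zero hn
  rw [Function.iterate_succ_apply, Derivation.map_one_eq_zero, iter_zero]

/-- Right multiplication by `∂^j` shifts the exponents. -/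
theorem mul_mono_one (A : PsiDO R) (j : ℤ) : A * mono 1 j = shift j A := by
  ext k
  rw [coeff_mul, mulCoeff, finsum_eq_single _ (k - j), finsum_eq_single _ (0 : ℕ)]
  · simp [coeff_mono]
  · intro n hn
    rw [coeff_mono, if_neg (by omega), iter_zero]
    simp
  · intro i hi
    rw [← finsum_zero (α := ℕ)]
    refine finsum_congr fun n => ?_
    rw [coeff_mono]
    split_ifs with h
    · rw [iter_one_pos (by omega)]
      simp
    · rw [iter_zero]; simp

@[simp] theorem coeff_mul_mono_one (A : PsiDO R) (j k : ℤ) :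
    (A * mono 1 j).coeff k = A.coeff (k - j) := by rw [mul_mono_one, coeff_shift]

theorem mono_mul_mono_one (a : R) (i j : ℤ) : mono a i * mono 1 j = mono a (i + j) := by
  ext k
  rw [coeff_mul_mono_one, coeff_mono, coeff_mono]
  congr 1
  exact propext ⟨fun h => by omega, fun h => by omega⟩

theorem mono_zero_mul_mono (a b : R) (j : ℤ) : mono a 0 * mono b j = mono (a * b) j := by
  ext k
  rw [coeff_mono_zero_mul, coeff_mono, coeff_mono]
  split_ifs <;> simp

theorem mono_one_pow (n : ℕ) : (mono (1 : R) 1) ^ n = mono 1 n := by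
  induction n with
  | zero => rfl
  | succ n ih => rw [pow_succ, ih, mono_mul_mono_one]; push_cast; rfl

/-- Right multiplication by a function. -/
theorem coeff_mul_mono_zero (A : PsiDO R) (b : R) (k : ℤ) :
    (A * mono b 0).coeff k = ∑ᶠ n : ℕ, Ring.choose (k + n) n •
      (A.coeff (k + n) * (Differential.deriv (R := R))^[n] b) := by
  have hinj : Function.Injective (fun n : ℕ => k + (n : ℤ)) := fun a b h => by simpa using h
  rw [coeff_mul, mulCoeff]
  have h4 := finsum_mem_range (f := fun i : ℤ => Ring.choose i (i - k).toNat •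
      (A.coeff i * (Differential.deriv (R := R))^[(i - k).toNat] b)) hinj
  have e : ∀ n : ℕ, (k + (n : ℤ) - k).toNat = n := fun n => by omega
  simp only [e] at h4
  rw [← h4]
  refine finsum_congr fun i => ?_
  by_cases hi : k ≤ i
  · rw [finsum_eq_single _ (i - k).toNat]
    · have : i ∈ Set.range fun n : ℕ => k + (n : ℤ) := ⟨(i - k).toNat, by simp only; omega⟩
      rw [coeff_mono, if_pos (by omega)]
      simp only [this, finsum_true]
    · intro n hn
      rw [coeff_mono, if_neg (by omega), iter_zero]
      simp
  · have : i ∉ Set.range fun n : ℕ => k + (n : ℤ) := by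
      rintro ⟨n, rfl⟩
      simp at hi
    simp only [this, finsum_false]
    refine finsum_eq_zero_of_forall_eq_zero fun n => ?_
    rw [coeff_mono, if_neg (by omega), iter_zero]
    simp

/-- The correction terms carry `(n - 1 choose n)` with `n ≥ 1`, which vanishes. The residue is thus
linear over functions on the right; this lets the factor depending on the second set of times be
pulled out undifferentiated. -/
theorem coeff_neg_one_mul_mono_zero (A : PsiDO R) (b : R) :
    (A * mono b 0).coeff (-1) = A.coeff (-1) * b := by
  rw [coeff_mul_mono_zero, finsum_eq_single _ 0]
  · simp
  · intro n hn
    obtain ⟨n, rfl⟩ := Nat.exists_eq_succ_of_ne_zero hn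
    have : Ring.choose (-1 + ((n + 1 : ℕ) : ℤ)) (n + 1) = 0 := by
      have := Ring.choose_natCast (R := ℤ) n (n + 1)
      rw [Nat.choose_eq_zero_of_lt (by omega)] at this
      rw [show (-1 + ((n + 1 : ℕ) : ℤ)) = (n : ℤ) by push_cast; ring]
      simpa using this
    rw [Nat.succ_eq_add_one, this, zero_smul]

/-- An operator is determined, up to a differential operator, by the residues of `∂^k A`. -/
theorem coeff_eq_zero_of_residues {A : PsiDO R}
    (h : ∀ k : ℕ, (mono 1 (k : ℤ) * A).coeff (-1) = 0) {i : ℤ} (hi : i < 0) : A.coeff i = 0 := by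
  obtain ⟨k, rfl⟩ : ∃ k : ℕ, i = -1 - (k : ℤ) := ⟨(-1 - i).toNat, by omega⟩
  -- The residue of `∂^k A` is the coefficient of order `-1 - k` plus derivatives of those of orders
  -- `-k, …, -1`, already known to vanish; the nonnegative orders are killed by `(k choose n) = 0`
  -- for `n > k`.
  induction k using Nat.strong_induction_on with
  | _ k ih =>
    have hk := h k
    rw [coeff_mono_mul, finsum_eq_single _ 0] at hk
    · simpa using hk
    · intro n hn
      by_cases hnk : n ≤ k
      · have e : (-1 - (k : ℤ) + n) = -1 - ((k - n : ℕ) : ℤ) := by omega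
        rw [e, ih (k - n) (by omega) (by omega), iter_zero]
        simp
      · rw [Ring.choose_natCast, Nat.choose_eq_zero_of_lt (by omega)]
        simp

/-- The operator `∑_{n ≥ 0} ∂^{-n} ∘ h_n`. -/
def coSymbol (h : ℕ → R) : PsiDO R :=
  ofSymbol fun k => (∑ n ∈ Finset.range (k + 1), mono 1 (-(n : ℤ)) * mono (h n) 0).coeff (-k)

theorem ordLE_coSymbol (h : ℕ → R) : (coSymbol h).OrdLE 0 := ordLE_ofSymbol _

theorem coeff_coSymbol_zero (h : ℕ → R) : (coSymbol h).coeff 0 = h 0 := by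
  simp [coSymbol, coeff_ofSymbol, coeff_mono]

/-- The term `∂^{-n} ∘ h_n` has order at most `-n`, so each coefficient of the infinite sum sees
finitely many terms. This makes the sum computable through finite truncations. -/
theorem coSymbol_sub_ordLE (h : ℕ → R) (N : ℕ) :
    (coSymbol h - ∑ n ∈ Finset.range N, mono 1 (-(n : ℤ)) * mono (h n) 0).OrdLE (-N) := by
  have hterm : ∀ n : ℕ, (mono 1 (-(n : ℤ)) * mono (h n) 0).OrdLE (-(n : ℤ)) := fun n => by
    simpa using (ordLE_mono (1 : R) (-(n : ℤ))).mul (ordLE_mono (h n) 0)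
  intro i hi
  rw [coeff_sub, sub_eq_zero]
  by_cases hi0 : 0 < i
  · rw [ordLE_coSymbol h i hi0]
    exact ((OrdLE.sum fun n _ => (hterm n).mono (by omega)) i hi0).symm
  · obtain ⟨k, rfl⟩ : ∃ k : ℕ, i = -(k : ℤ) := ⟨(-i).toNat, by omega⟩
    rw [coSymbol, coeff_ofSymbol, if_pos (by omega), neg_neg, Int.toNat_natCast,
      coeff_sum, coeff_sum]
    refine Finset.sum_subset (Finset.range_subset_range.mpr (by omega)) fun n _ hn => ?_
    have : k + 1 ≤ n := by simpa using hn
    exact hterm n _ (by omega)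

/-- The residue pairing of an operator with `∑ ∂^{-n} ∘ h_n`. -/
theorem coeff_mul_coSymbol (G : PsiDO R) (h : ℕ → R) :
    (G * coSymbol h).coeff (-1) = ∑ᶠ n : ℕ, G.coeff (n - 1) * h n := by
  obtain ⟨N, hN⟩ := G.bdd
  -- With `G` of order at most `N`, a truncation error of order `-K` changes `G * coSymbol h` only
  -- in orders `≤ -2`, below the residue.
  set K : ℕ := (N + 2).toNat with hK
  have h1 := (show G.OrdLE N from hN).mul (coSymbol_sub_ordLE h K) (-1) (by omega)
  rw [mul_sub, coeff_sub, sub_eq_zero] at h1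
  rw [h1, Finset.mul_sum, coeff_sum, finsum_eq_sum_of_support_subset (s := Finset.range K)]
  · refine Finset.sum_congr rfl fun n _ => ?_
    rw [← mul_assoc, coeff_neg_one_mul_mono_zero, coeff_mul_mono_one]
    congr 2
    ring
  · intro n hn
    by_contra hc
    apply hn
    have : K ≤ n := by simpa using hc
    simp only
    rw [hN _ (by omega), zero_mul]

end Products

/-! ### Homomorphisms and derivations of the coefficients, and the reflection `∂ ↦ -∂` -/

section Homs

variable {R S : Type*} [CommRing R] [Differential R] [CommRing S] [Differential S]

theorem map_iter (φ : R →+* S) (hφ : ∀ a, φ (Differential.deriv a) = Differential.deriv (φ a))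
    (n : ℕ) (a : R) : φ ((Differential.deriv (R := R))^[n] a) =
      (Differential.deriv (R := S))^[n] (φ a) := by
  induction n generalizing a with
  | zero => rfl
  | succ n ih => rw [Function.iterate_succ_apply, ih, hφ, Function.iterate_succ_apply]

theorem map_mulTerm (φ : R →+* S) (hφ : ∀ a, φ (Differential.deriv a) = Differential.deriv (φ a))
    (a b : R) (i j k : ℤ) : φ (mulTerm a b i j k) = mulTerm (φ a) (φ b) i j k := by
  unfold mulTerm
  split_ifs
  · rw [map_zsmul, map_mul, map_iter φ hφ]
  · simp

/-- A homomorphism of differential rings acts on pseudodifferential operators. -/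
def mapRingHom (φ : R →+* S) (hφ : ∀ a, φ (Differential.deriv a) = Differential.deriv (φ a)) :
    PsiDO R →+* PsiDO S where
  toFun := mapCoeff φ.toAddMonoidHom
  map_zero' := map_zero (mapCoeffHom φ.toAddMonoidHom)
  map_add' := map_add (mapCoeffHom φ.toAddMonoidHom)
  map_one' := by
    ext i
    simp only [coeff_mapCoeff, coeff_one]
    split_ifs <;> simp
  map_mul' A B := by
    obtain ⟨N, hA, hB⟩ := exists_ordLE_pair A B
    ext k
    rw [coeff_mapCoeff, coeff_mul_eq_sum A B k N hA hB, coeff_mul_eq_sum _ _ k N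
      (fun i hi => by rw [coeff_mapCoeff, hA i hi, map_zero])
      (fun i hi => by rw [coeff_mapCoeff, hB i hi, map_zero])]
    simp only [map_sum, coeff_mapCoeff]
    exact Finset.sum_congr rfl fun i _ => Finset.sum_congr rfl fun j _ =>
      map_mulTerm φ hφ _ _ i j k

theorem negOnePow_smul_smul {M : Type*} [AddCommGroup M] (i j : ℤ) (a : M) :
    (Int.negOnePow i : ℤ) • (Int.negOnePow j : ℤ) • a = (Int.negOnePow (i + j) : ℤ) • a := by
  rw [smul_smul, Int.negOnePow_add, Units.val_mul]

theorem map_iter_neg (φ : R →+* S)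
    (hφ : ∀ a, φ (Differential.deriv a) = -Differential.deriv (φ a))
    (n : ℕ) (a : R) : φ ((Differential.deriv (R := R))^[n] a) =
      (Int.negOnePow n : ℤ) • (Differential.deriv (R := S))^[n] (φ a) := by
  induction n generalizing a with
  | zero => simp
  | succ n ih =>
    rw [Function.iterate_succ_apply, ih, hφ, Function.iterate_succ_apply, ← neg_one_zsmul,
      iter_zsmul, smul_smul]
    congr 1
    push_cast
    rw [Int.negOnePow_succ]
    simp

/-- The term contains `i + j - k` derivatives, each changing sign under `φ`; together with `(-1)^k`
this gives `(-1)^{i+j}`, the sign of the two factors. -/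
theorem map_mulTerm_neg (φ : R →+* S)
    (hφ : ∀ a, φ (Differential.deriv a) = -Differential.deriv (φ a))
    (a b : R) (i j k : ℤ) : (Int.negOnePow k : ℤ) • φ (mulTerm a b i j k) =
      mulTerm ((Int.negOnePow i : ℤ) • φ a) ((Int.negOnePow j : ℤ) • φ b) i j k := by
  unfold mulTerm
  split_ifs with h
  · rw [map_zsmul, map_mul, map_iter_neg φ hφ, iter_zsmul]
    simp only [mul_smul_comm, smul_mul_assoc, negOnePow_smul_smul]
    rw [smul_comm (Int.negOnePow k : ℤ), negOnePow_smul_smul]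
    congr 3
    rw [Int.negOnePow_eq_iff, Int.toNat_of_nonneg (by omega)]
    exact ⟨0, by ring⟩
  · simp

/-- The substitution `∂ ↦ -∂`, combined with a homomorphism that anticommutes with the
derivations. -/
def reflectHom (φ : R →+* S)
    (hφ : ∀ a, φ (Differential.deriv a) = -Differential.deriv (φ a)) :
    PsiDO R →+* PsiDO S where
  toFun := reflect φ
  map_zero' := by ext i; simp
  map_add' A B := by ext i; simp
  map_one' := by
    ext i
    simp only [coeff_reflect, coeff_one]
    split_ifs with h
    · simp [h]
    · simp
  map_mul' A B := by
    obtain ⟨N, hA, hB⟩ := exists_ordLE_pair A B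
    ext k
    rw [coeff_reflect, coeff_mul_eq_sum A B k N hA hB, coeff_mul_eq_sum _ _ k N
      (fun i hi => by rw [coeff_reflect, hA i hi, map_zero, smul_zero])
      (fun i hi => by rw [coeff_reflect, hB i hi, map_zero, smul_zero])]
    simp only [map_sum, coeff_reflect, Finset.smul_sum]
    exact Finset.sum_congr rfl fun i _ => Finset.sum_congr rfl fun j _ =>
      map_mulTerm_neg φ hφ _ _ i j k

theorem derivation_mulTerm (δ : R →+ R) (hδ : ∀ a b, δ (a * b) = δ a * b + a * δ b)
    (hc : ∀ a, δ (Differential.deriv a) = Differential.deriv (δ a)) (a b : R) (i j k : ℤ) :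
    δ (mulTerm a b i j k) = mulTerm (δ a) b i j k + mulTerm a (δ b) i j k := by
  have hit : ∀ (n : ℕ) (a : R), δ ((Differential.deriv (R := R))^[n] a) =
      (Differential.deriv (R := R))^[n] (δ a) := by
    intro n
    induction n with
    | zero => intro a; rfl
    | succ n ih => intro a; rw [Function.iterate_succ_apply, ih, hc, Function.iterate_succ_apply]
  unfold mulTerm
  split_ifs
  · rw [map_zsmul, hδ, hit, smul_add]
  · simp

/-- A derivation of the coefficients that commutes with `∂` is a derivation of the ring of
operators. -/
theorem mapCoeff_mul (δ : R →+ R) (hδ : ∀ a b, δ (a * b) = δ a * b + a * δ b)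
    (hc : ∀ a, δ (Differential.deriv a) = Differential.deriv (δ a)) (A B : PsiDO R) :
    mapCoeff δ (A * B) = mapCoeff δ A * B + A * mapCoeff δ B := by
  obtain ⟨N, hA, hB⟩ := exists_ordLE_pair A B
  have hA' : (mapCoeff δ A).OrdLE N := fun i hi => by rw [coeff_mapCoeff, hA i hi, map_zero]
  have hB' : (mapCoeff δ B).OrdLE N := fun i hi => by rw [coeff_mapCoeff, hB i hi, map_zero]
  ext k
  rw [coeff_mapCoeff, coeff_add, coeff_mul_eq_sum A B k N hA hB,
    coeff_mul_eq_sum _ _ k N hA' hB, coeff_mul_eq_sum _ _ k N hA hB']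
  simp only [map_sum, ← Finset.sum_add_distrib, coeff_mapCoeff]
  exact Finset.sum_congr rfl fun i _ => Finset.sum_congr rfl fun j _ =>
    derivation_mulTerm δ hδ hc _ _ i j k

end Homs

end PsiDO

namespace PsiDO

/-! ### Differential operators -/

section Diff

variable {R : Type*} [CommRing R]

/-- `A` is a differential operator. -/
def IsDiff (A : PsiDO R) : Prop := ∀ i < 0, A.coeff i = 0

theorem IsDiff.add {A B : PsiDO R} (hA : A.IsDiff) (hB : B.IsDiff) : (A + B).IsDiff :=
  fun i hi => by rw [coeff_add, hA i hi, hB i hi, add_zero]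

theorem IsDiff.neg {A : PsiDO R} (hA : A.IsDiff) : (-A).IsDiff :=
  fun i hi => by rw [coeff_neg, hA i hi, neg_zero]

theorem IsDiff.zsmul {A : PsiDO R} (hA : A.IsDiff) (c : ℤ) : (c • A).IsDiff :=
  fun i hi => by rw [coeff_zsmul, hA i hi, smul_zero]

theorem IsDiff.sum {ι : Type*} {s : Finset ι} {A : ι → PsiDO R} (h : ∀ x ∈ s, (A x).IsDiff) :
    (∑ x ∈ s, A x).IsDiff :=
  fun i hi => by rw [coeff_sum]; exact Finset.sum_eq_zero fun x hx => h x hx i hi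

theorem isDiff_zero : (0 : PsiDO R).IsDiff := fun _ _ => rfl

theorem isDiff_mono (a : R) {n : ℤ} (hn : 0 ≤ n) : (mono a n).IsDiff :=
  fun i hi => by rw [coeff_mono, if_neg (by omega)]

variable [Differential R]

/-- Reaching a negative order from `∂^i` and `∂^j` with `i, j ≥ 0` takes more than `i` derivatives,
and the binomial coefficient is then zero. -/
theorem IsDiff.mul {A B : PsiDO R} (hA : A.IsDiff) (hB : B.IsDiff) : (A * B).IsDiff := by
  intro k hk
  obtain ⟨N, hA', hB'⟩ := exists_ordLE_pair A B
  rw [coeff_mul_eq_sum A B k N hA' hB']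
  refine Finset.sum_eq_zero fun i _ => Finset.sum_eq_zero fun j _ => ?_
  by_cases hi : i < 0
  · rw [hA i hi, mulTerm_zero_left]
  by_cases hj : j < 0
  · rw [hB j hj, mulTerm_zero_right]
  obtain ⟨n, rfl⟩ : ∃ n : ℕ, i = n := ⟨i.toNat, by omega⟩
  rw [mulTerm, if_pos (by omega), Ring.choose_natCast, Nat.choose_eq_zero_of_lt (by omega)]
  simp

end Diff

/-! ### The kernel with powers of `x`: negative part of `W_12 ∘ (-∂)^{-q} ∘ W_21` -/

section Kernel

variable {R : Type*} [CommRing R] {f : ℕ → R}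

/-- For `f_i = x^i / i!` this is the binomial expansion of `(x - x)^N / N!`. Only the divided power
multiplication rule enters. -/
theorem sum_divPow_mul (hmul : ∀ i j, f i * f j = ((i + j).choose i : ℤ) • f (i + j)) {N : ℕ}
    (hN : N ≠ 0) :
    ∑ i ∈ Finset.range (N + 1), ((-1) ^ (N - i) : ℤ) • (f (N - i) * f i) = 0 := by
  have h1 : ∀ i ∈ Finset.range (N + 1), ((-1) ^ (N - i) : ℤ) • (f (N - i) * f i) =
      (((-1) ^ N : ℤ) * ((-1) ^ i * (N.choose i : ℤ))) • f N := by
    intro i hi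
    have hi' : i ≤ N := by simpa [Nat.lt_succ_iff] using hi
    rw [mul_comm (f (N - i)), hmul, Nat.add_sub_cancel' hi', smul_smul, ← mul_assoc]
    congr 2
    have : ((-1 : ℤ) ^ N) = (-1) ^ (N - i) * (-1) ^ i := by
      rw [← pow_add, Nat.sub_add_cancel hi']
    rw [this, mul_assoc, ← pow_add, ← two_mul, pow_mul]
    simp
  rw [Finset.sum_congr rfl h1, ← Finset.sum_smul, ← Finset.mul_sum,
    Int.alternating_sum_range_choose_of_ne hN]
  simp

variable [Differential R]

theorem d_mul_mono (a : R) (n : ℤ) :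
    mono 1 1 * mono a n = mono a (n + 1) + mono (Differential.deriv a) n := by
  ext k
  rw [coeff_d_mul, coeff_add]
  simp only [coeff_mono]
  by_cases h1 : k = n
  · subst h1; simp
  · by_cases h2 : k = n + 1
    · subst h2; simp
    · rw [if_neg h1, if_neg (by omega), if_neg (by omega), if_neg h1, map_zero]

/-- `∑_{i ≤ n} (-1)^i f_i ∂^{i-n-1} = (-1)^n ∂^{-1} ∘ f_n` for divided powers `f_i`. -/
theorem sum_divPow_left (h0 : f 0 = 1) (hf : ∀ i, Differential.deriv (f (i + 1)) = f i) (n : ℕ) :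
    ∑ i ∈ Finset.range (n + 1), ((-1) ^ i : ℤ) • mono (f i) ((i : ℤ) - n - 1) =
      ((-1) ^ n : ℤ) • (mono 1 (-1) * mono (f n) 0) := by
  -- After composition with `∂` on the left the partial sums telescope: the derivative of `f_{k+1}`
  -- cancels what the previous terms left.
  have key : ∀ k : ℕ, mono 1 1 * ∑ i ∈ Finset.range (k + 1),
      ((-1) ^ i : ℤ) • mono (f i) ((i : ℤ) - n - 1) =
        ((-1) ^ k : ℤ) • mono (f k) ((k : ℤ) - n) := by
    intro k
    induction k with
    | zero =>
      rw [Finset.sum_range_one, mul_smul_comm, d_mul_mono, h0, Derivation.map_one_eq_zero]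
      simp
    | succ k ih =>
      rw [Finset.sum_range_succ, mul_add, ih, mul_smul_comm, d_mul_mono, hf, pow_succ]
      have e1 : ((k + 1 : ℕ) : ℤ) - n - 1 = (k : ℤ) - n := by push_cast; ring
      have e2 : ((k + 1 : ℕ) : ℤ) - n = (k : ℤ) - n + 1 := by push_cast; ring
      rw [e1, e2, smul_add]
      simp
  have h := congrArg (fun A => mono 1 (-1) * A) (key n)
  simp only [← mul_assoc, mono_mul_mono_one] at h
  rw [sub_self, mul_smul_comm] at h
  rw [← h]
  exact (one_mul _).symm

/-- Modulo differential operators, the double sum of `(-1)^i f_i ∂^{n+i+n'+i'-p} f_{i'}` over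
`i < p - n`, `i' < p - n'` reduces to `∂^{-1}` or to zero. -/
theorem sum_divPow_both (h0 : f 0 = 1) (hf : ∀ i, Differential.deriv (f (i + 1)) = f i)
    (hmul : ∀ i j, f i * f j = ((i + j).choose i : ℤ) • f (i + j)) {p n n' : ℕ} :
    (∑ i ∈ Finset.range (p - n), ∑ i' ∈ Finset.range (p - n'),
        ((-1) ^ i : ℤ) • (mono (f i) ((n : ℤ) + i + n' + i' - p) * mono (f i') 0) -
      if n + n' + 1 = p then mono 1 (-1) else 0).IsDiff := by
  rw [Finset.sum_comm]
  simp only [← smul_mul_assoc, ← Finset.sum_mul]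
  -- The exponent is negative exactly for `i ≤ p - 1 - n - n' - i'`. Those terms form the complete
  -- sum evaluated by `sum_divPow_left`; the others are differential operators.
  have inner : ∀ i' : ℕ, (∑ i ∈ Finset.range (p - n),
      ((-1) ^ i : ℤ) • mono (f i) ((n : ℤ) + i + n' + i' - p) -
      if n + n' + i' + 1 ≤ p then
        ((-1) ^ (p - 1 - n - n' - i') : ℤ) • (mono 1 (-1) * mono (f (p - 1 - n - n' - i')) 0)
      else 0).IsDiff := by
    intro i'
    split_ifs with h
    · obtain ⟨ν, hν⟩ : ∃ ν, p = n + n' + i' + 1 + ν := ⟨p - (n + n' + i' + 1), by omega⟩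
      have e : p - 1 - n - n' - i' = ν := by omega
      have e2 : p - n = (ν + 1) + (n' + i') := by omega
      rw [e, ← sum_divPow_left h0 hf ν, e2, Finset.sum_range_add]
      have e3 : ∀ i : ℕ, (n : ℤ) + i + n' + i' - p = (i : ℤ) - ν - 1 := fun i => by
        subst hν; push_cast; ring
      simp only [e3, add_sub_cancel_left]
      refine IsDiff.sum fun x _ => (isDiff_mono _ ?_).zsmul _
      push_cast; omega
    · rw [sub_zero]
      exact IsDiff.sum fun x _ => (isDiff_mono _ (by omega)).zsmul _
  have outer : (∑ i' ∈ Finset.range (p - n'), (∑ i ∈ Finset.range (p - n),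
      ((-1) ^ i : ℤ) • mono (f i) ((n : ℤ) + i + n' + i' - p)) * mono (f i') 0 -
      ∑ i' ∈ Finset.range (p - n'), (if n + n' + i' + 1 ≤ p then
        ((-1) ^ (p - 1 - n - n' - i') : ℤ) • (mono 1 (-1) * mono (f (p - 1 - n - n' - i')) 0)
      else 0) * mono (f i') 0).IsDiff := by
    rw [← Finset.sum_sub_distrib]
    refine IsDiff.sum fun i' _ => ?_
    rw [← sub_mul]
    exact (inner i').mul (isDiff_mono _ le_rfl)
  convert outer using 2
  by_cases hp : n + n' + 1 ≤ p
  -- The indices `i' ≤ N` remain, and their sum is `∂⁻¹` composed with the alternating sum of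
  -- `sum_divPow_mul`. It survives only for `N = 0`.
  · obtain ⟨N, hN⟩ : ∃ N, p = n + n' + 1 + N := ⟨p - (n + n' + 1), by omega⟩
    rw [← Finset.sum_subset (s₁ := Finset.range (N + 1))
      (Finset.range_subset_range.mpr (by omega))]
    · have e : ∀ i ∈ Finset.range (N + 1), (if n + n' + i + 1 ≤ p then
          ((-1) ^ (p - 1 - n - n' - i) : ℤ) • (mono 1 (-1) * mono (f (p - 1 - n - n' - i)) 0)
          else 0) * mono (f i) 0 =
          mono 1 (-1) * mono (((-1) ^ (N - i) : ℤ) • (f (N - i) * f i)) 0 := by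
        intro i hi
        have hi' : i ≤ N := by simpa [Nat.lt_succ_iff] using hi
        have e1 : p - 1 - n - n' - i = N - i := by omega
        rw [if_pos (by omega), e1, mono_zsmul, mul_smul_comm, smul_mul_assoc, mul_assoc,
          mono_zero_mul_mono]
      rw [Finset.sum_congr rfl e, ← Finset.mul_sum, ← mono_sum]
      by_cases hN0 : N = 0
      · subst hN0
        rw [if_pos (by omega)]
        simp [h0, mono_mul_mono_one]
      · rw [if_neg (by omega), sum_divPow_mul hmul hN0, mono_zero, mul_zero]
    · intro i _ hi
      have : N + 1 ≤ i := by simpa using hi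
      rw [if_neg (by omega), zero_mul]
  · rw [if_neg (by omega), Finset.sum_eq_zero]
    intro i _
    rw [if_neg (by omega), zero_mul]

theorem negOnePow_natCast (n : ℕ) : (Int.negOnePow n : ℤ) = (-1) ^ n := by
  rw [Int.negOnePow_def, zpow_natCast]
  push_cast
  rfl

/-- The part of `W₁₂ ∘ (-∂)^{-p} ∘ W₂₁` that is not a differential operator. -/
theorem neg_part_product (h0 : f 0 = 1) (hf : ∀ i, Differential.deriv (f (i + 1)) = f i)
    (hmul : ∀ i j, f i * f j = ((i + j).choose i : ℤ) • f (i + j)) (p : ℕ) (q q' : ℕ → R) :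
    (diffOp p (fun j => -∑ i ∈ Finset.range (j + 1), f i * q (j - i + 1)) *
        monoNeg 1 (-(p : ℤ)) *
        (∑ j ∈ Finset.range p, ∑ i ∈ Finset.range (j + 1),
          mono 1 j * mono (q' (j - i + 1) * f i) 0) +
      ∑ n ∈ Finset.range p, ((-1) ^ (p - n) : ℤ) •
        (mono (q (n + 1)) (-1) * mono (q' (p - n)) 0)).IsDiff := by
  -- Reindexing the triangle by `j = n + i` collects the terms with a fixed coefficient function `q
  -- (n + 1)`, so that functions stand outside and powers of `x` inside.
  have eL : diffOp p (fun j => -∑ i ∈ Finset.range (j + 1), f i * q (j - i + 1)) =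
      -∑ n ∈ Finset.range p, ∑ i ∈ Finset.range (p - n),
        ((-1) ^ (n + i) : ℤ) • (mono (q (n + 1)) 0 * mono (f i) ((n : ℤ) + i)) := by
    have e1 := Finset.sum_range_diag_flip p (fun n i =>
      ((-1) ^ (n + i) : ℤ) • (mono (q (n + 1)) 0 * mono (f i) ((n : ℤ) + i)))
    rw [← e1, diffOp, ← Finset.sum_neg_distrib]
    refine Finset.sum_congr rfl fun j _ => ?_
    rw [monoNeg, smul_neg, mono_neg, mono_zsmul, mono_sum, Finset.smul_sum, negOnePow_natCast]
    congr 1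
    rw [← Finset.sum_flip]
    refine Finset.sum_congr rfl fun n hn => ?_
    have hn' : n ≤ j := by simpa [Nat.lt_succ_iff] using hn
    rw [Nat.sub_sub_self hn', Nat.add_sub_cancel' hn', mono_zero_mul_mono, mul_comm]
    congr 2
    omega
  have eR : ∑ j ∈ Finset.range p, ∑ i ∈ Finset.range (j + 1),
          mono 1 (j : ℤ) * mono (q' (j - i + 1) * f i) 0 =
      ∑ n ∈ Finset.range p, ∑ i ∈ Finset.range (p - n),
        mono 1 ((n : ℤ) + i) * mono (f i) 0 * mono (q' (n + 1)) 0 := by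
    rw [← Finset.sum_range_diag_flip p (fun n i =>
      mono 1 ((n : ℤ) + i) * mono (f i) 0 * mono (q' (n + 1)) 0)]
    refine Finset.sum_congr rfl fun j _ => ?_
    rw [← Finset.sum_flip]
    refine Finset.sum_congr rfl fun n hn => ?_
    have hn' : n ≤ j := by simpa [Nat.lt_succ_iff] using hn
    rw [Nat.sub_sub_self hn', mul_assoc, mono_zero_mul_mono, mul_comm (f (j - n))]
    congr 2
    omega
  have ep : diffOp p (fun j => -∑ i ∈ Finset.range (j + 1), f i * q (j - i + 1)) *
        monoNeg 1 (-(p : ℤ)) *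
        (∑ j ∈ Finset.range p, ∑ i ∈ Finset.range (j + 1),
          mono 1 j * mono (q' (j - i + 1) * f i) 0) =
      -∑ n ∈ Finset.range p, ∑ n' ∈ Finset.range p, ((-1) ^ (n + p) : ℤ) •
        (mono (q (n + 1)) 0 * (∑ i ∈ Finset.range (p - n), ∑ i' ∈ Finset.range (p - n'),
        ((-1) ^ i : ℤ) • (mono (f i) ((n : ℤ) + i + n' + i' - p) * mono (f i') 0)) *
          mono (q' (n' + 1)) 0) := by
    rw [eL, eR, monoNeg, mono_zsmul, neg_mul, neg_mul, Finset.sum_mul, Finset.sum_mul]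
    congr 1
    refine Finset.sum_congr rfl fun n _ => ?_
    rw [Finset.mul_sum]
    refine Finset.sum_congr rfl fun n' _ => ?_
    simp only [Finset.sum_mul, Finset.mul_sum, Finset.smul_sum]
    rw [Finset.sum_comm]
    refine Finset.sum_congr rfl fun i _ => Finset.sum_congr rfl fun i' _ => ?_
    have es : (Int.negOnePow (-(p : ℤ)) : ℤ) = (-1) ^ p := by
      rw [Int.negOnePow_neg, negOnePow_natCast]
    rw [es]
    simp only [mul_smul_comm, smul_mul_assoc, smul_smul]
    have em : mono (f i) ((n : ℤ) + i) * mono 1 (-(p : ℤ)) * mono 1 ((n' : ℤ) + i') =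
        mono (f i) ((n : ℤ) + i + n' + i' - p) := by
      rw [mono_mul_mono_one, mono_mul_mono_one]
      congr 1; ring
    rw [← em]
    congr 1
    · rw [pow_add, pow_add]; ring
    · simp only [mul_assoc]
  rw [ep]
  -- The single sum is written as a double sum concentrated at `n' = p - 1 - n`, to be compared term
  -- by term with the product.
  have hsum : ∑ n ∈ Finset.range p, ((-1) ^ (p - n) : ℤ) •
        (mono (q (n + 1)) (-1) * mono (q' (p - n)) 0) =
      ∑ n ∈ Finset.range p, ∑ n' ∈ Finset.range p, ((-1) ^ (n + p) : ℤ) •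
        (mono (q (n + 1)) 0 * (if n + n' + 1 = p then mono 1 (-1) else 0) *
          mono (q' (n' + 1)) 0) := by
    refine Finset.sum_congr rfl fun n hn => ?_
    have hn' : n < p := by simpa using hn
    rw [Finset.sum_eq_single (p - 1 - n)]
    · rw [if_pos (by omega), mono_zero_mul_mono, mul_one]
      have es : ((-1 : ℤ)) ^ (n + p) = (-1) ^ (p - n) := by
        rw [show n + p = 2 * n + (p - n) by omega, pow_add, pow_mul]
        simp
      rw [es, show p - 1 - n + 1 = p - n by omega]
    · intro n' _ hne
      rw [if_neg (by omega)]
      simp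
    · intro hc
      simp at hc
      omega
  rw [hsum, neg_add_eq_sub, ← neg_sub]
  refine IsDiff.neg ?_
  simp only [← Finset.sum_sub_distrib, ← smul_sub, ← mul_sub, ← sub_mul]
  exact IsDiff.sum fun n _ => IsDiff.sum fun n' _ => IsDiff.zsmul
    (((isDiff_mono _ le_rfl).mul (sum_divPow_both h0 hf hmul)).mul (isDiff_mono _ le_rfl)) _

end Kernel

end PsiDO

/-! ### Matrix pseudodifferential operators -/

namespace PsiMat

open PsiDO

variable {R : Type*} [CommRing R] {I J K : Type*}

/-- The matrix of the coefficients of `∂^i`. -/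
def cf (A : Matrix I J (PsiDO R)) (i : ℤ) : Matrix I J R := A.map fun x => x.coeff i

/-- All the entries have order at most `N`. -/
def OrdLE (A : Matrix I J (PsiDO R)) (N : ℤ) : Prop := ∀ a b, (A a b).OrdLE N

theorem OrdLE.mono {A : Matrix I J (PsiDO R)} {N M : ℤ} (h : OrdLE A N) (hNM : N ≤ M) :
    OrdLE A M := fun a b => (h a b).mono hNM

theorem OrdLE.add {A B : Matrix I J (PsiDO R)} {N : ℤ} (hA : OrdLE A N) (hB : OrdLE B N) :
    OrdLE (A + B) N := fun a b => (hA a b).add (hB a b)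

theorem OrdLE.neg {A : Matrix I J (PsiDO R)} {N : ℤ} (hA : OrdLE A N) : OrdLE (-A) N :=
  fun a b i hi => by rw [Matrix.neg_apply, coeff_neg, hA a b i hi, neg_zero]

theorem cf_add (A B : Matrix I J (PsiDO R)) (i : ℤ) : cf (A + B) i = cf A i + cf B i := rfl

theorem ordLE_pred {A : Matrix I J (PsiDO R)} {N : ℤ} (h : OrdLE A N) (h' : cf A N = 0) :
    OrdLE A (N - 1) := by
  intro a b i hi
  by_cases hN : N < i
  · exact h a b i hN
  · rw [show i = N by omega]
    exact congrFun (congrFun h' a) b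

/-- The order filtration is separated. This converts order estimates obtained by induction into
exact identities. -/
theorem eq_zero_of_ordLE {A : Matrix I J (PsiDO R)} (h : ∀ n : ℕ, OrdLE A (-(n : ℤ))) :
    A = 0 := by
  ext a b i
  exact h (-i + 1).toNat a b i (by omega)

variable [Differential R]

section Mul

variable [Fintype J]

theorem OrdLE.mul {A : Matrix I J (PsiDO R)} {B : Matrix J K (PsiDO R)} {N M : ℤ}
    (hA : OrdLE A N) (hB : OrdLE B M) : OrdLE (A * B) (N + M) := fun a b => by
  rw [Matrix.mul_apply]
  exact PsiDO.OrdLE.sum fun c _ => (hA a c).mul (hB c b)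

theorem cf_mul_top {A : Matrix I J (PsiDO R)} {B : Matrix J K (PsiDO R)} {N M : ℤ}
    (hA : OrdLE A N) (hB : OrdLE B M) : cf (A * B) (N + M) = cf A N * cf B M := by
  ext a b
  simp only [cf, Matrix.map_apply, Matrix.mul_apply, coeff_sum]
  exact Finset.sum_congr rfl fun c _ => coeff_mul_top (hA a c) (hB c b)

end Mul

variable [Fintype I] [DecidableEq I]

omit [Fintype I] in
theorem ordLE_one : OrdLE (1 : Matrix I I (PsiDO R)) 0 := by
  intro a b i hi
  rw [Matrix.one_apply]
  split_ifs
  · rw [coeff_one, if_neg (by omega)]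
  · rfl

omit [Fintype I] in
theorem cf_one : cf (1 : Matrix I I (PsiDO R)) 0 = 1 := by
  ext a b
  simp only [cf, Matrix.map_apply, Matrix.one_apply]
  split_ifs <;> simp [coeff_one]

theorem pow_lead {B : Matrix I I (PsiDO R)} {c : R} (hB : OrdLE B 1)
    (hc : cf B 1 = c • (1 : Matrix I I R)) (k : ℕ) :
    OrdLE (B ^ k) k ∧ cf (B ^ k) k = c ^ k • (1 : Matrix I I R) := by
  induction k with
  | zero => exact ⟨by simpa using ordLE_one, by simpa using cf_one⟩
  | succ k ih =>
    rw [pow_succ, Nat.cast_succ]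
    refine ⟨ih.1.mul hB, ?_⟩
    rw [cf_mul_top ih.1 hB, ih.2, hc, smul_mul_smul_comm, mul_one, pow_succ]

/-- Telescoping `B^{k+1} - C^{k+1}` gives `k + 1` terms with a single factor `B - C`. Since the
leading coefficients are scalar, they commute with everything at top order and the terms add up. -/
theorem pow_sub_lead {B C : Matrix I I (PsiDO R)} {c : R} {e : ℤ} (hB : OrdLE B 1)
    (hC : OrdLE C 1) (hBc : cf B 1 = c • (1 : Matrix I I R))
    (hCc : cf C 1 = c • (1 : Matrix I I R)) (hD : OrdLE (B - C) e) (k : ℕ) :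
    OrdLE (B ^ (k + 1) - C ^ (k + 1)) (e + k) ∧
      cf (B ^ (k + 1) - C ^ (k + 1)) (e + k) = (((k + 1 : ℕ) : R) * c ^ k) • cf (B - C) e := by
  induction k with
  | zero => simpa using hD
  | succ k ih =>
    have e1 : B ^ (k + 1 + 1) - C ^ (k + 1 + 1) =
        B * (B ^ (k + 1) - C ^ (k + 1)) + (B - C) * C ^ (k + 1) := by
      rw [pow_succ' B (k + 1), pow_succ' C (k + 1)]
      noncomm_ring
    have e2 : e + ((k + 1 : ℕ) : ℤ) = 1 + (e + k) := by push_cast; ring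
    have hCk := pow_lead hC hCc (k + 1)
    have h1 := hB.mul ih.1
    have h2 := hD.mul hCk.1
    have h1' := cf_mul_top hB ih.1
    have h2' := cf_mul_top hD hCk.1
    rw [e2] at h2 h2'
    rw [e1, e2]
    refine ⟨h1.add h2, ?_⟩
    rw [cf_add, h1', h2', ih.2, hBc, hCk.2, smul_mul_smul_comm, one_mul, mul_smul_comm, mul_one,
      ← add_smul]
    congr 1
    push_cast
    ring

/-- Uniqueness of roots with a prescribed leading term. -/
theorem root_unique {n : ℕ} (hn : 0 < n) {c : R} (hc : ∀ x : R, ((n : R) * c ^ (n - 1)) * x = 0 → x = 0)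
    {B C : Matrix I I (PsiDO R)}
    (hB : ∀ a b i, 1 ≤ i → (B a b).coeff i = if a = b ∧ i = 1 then c else 0)
    (hC : ∀ a b i, 1 ≤ i → (C a b).coeff i = if a = b ∧ i = 1 then c else 0)
    (h : B ^ n = C ^ n) : B = C := by
  have lead : ∀ {A : Matrix I I (PsiDO R)},
      (∀ a b i, 1 ≤ i → (A a b).coeff i = if a = b ∧ i = 1 then c else 0) →
      OrdLE A 1 ∧ cf A 1 = c • (1 : Matrix I I R) := by
    intro A hA
    refine ⟨fun a b i hi => by rw [hA a b i (by omega), if_neg (by omega)], ?_⟩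
    ext a b
    simp [cf, hA a b 1 le_rfl, Matrix.one_apply]
  obtain ⟨hB1, hBc⟩ := lead hB
  obtain ⟨hC1, hCc⟩ := lead hC
  obtain ⟨k, rfl⟩ : ∃ k, n = k + 1 := ⟨n - 1, by omega⟩
  rw [← sub_eq_zero]
  refine eq_zero_of_ordLE fun e => ?_
  -- The order of `B - C` is lowered one step at a time: its top coefficient times `n c^{n-1}` is a
  -- coefficient of `B^n - C^n = 0`, hence vanishes.
  induction e with
  | zero =>
    intro a b i hi
    rw [Matrix.sub_apply, coeff_sub, hB a b i (by push_cast at hi; omega),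
      hC a b i (by push_cast at hi; omega), sub_self]
  | succ e ih =>
    have h1 := (pow_sub_lead hB1 hC1 hBc hCc ih k).2
    rw [h, sub_self] at h1
    have h2 : cf (B - C) (-(e : ℤ)) = 0 := by
      ext a b
      have h3 := congrFun (congrFun h1 a) b
      refine hc _ ?_
      rw [Nat.add_sub_cancel]
      exact h3.symm
    have := ordLE_pred ih h2
    rwa [show -((e + 1 : ℕ) : ℤ) = -(e : ℤ) - 1 by push_cast; ring]

/-- A right inverse is a left inverse, for operators that agree with the identity up to terms of
negative order. -/
theorem mul_eq_one_symm {A B : Matrix I I (PsiDO R)} (h : A * B = 1) (hK : OrdLE (B * A - 1) (-1)) :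
    B * A = 1 := by
  rw [← sub_eq_zero]
  set K := B * A - 1 with hKdef
  -- `B * A` is idempotent because `A * B = 1`. The relation `K = -K²` then pushes the order of `K`
  -- down indefinitely.
  have hKK : K = -(K * K) := by
    have : B * A * (B * A) = B * A := by
      rw [mul_assoc, ← mul_assoc A B A, h, one_mul]
    rw [hKdef, sub_mul, mul_sub, this]
    noncomm_ring
  refine eq_zero_of_ordLE fun n => ?_
  have : ∀ n : ℕ, OrdLE K (-(n : ℤ) - 1) := by
    intro n
    induction n with
    | zero => simpa using hK
    | succ n ih =>
      rw [hKK]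
      exact (ih.mul ih).neg.mono (by push_cast; omega)
  exact (this n).mono (by omega)

omit [Fintype I] [DecidableEq I] in
/-- The differential part is the operator itself, up to terms of negative order. -/
theorem eq_pos_of_ordLE {A B : Matrix I I (PsiDO R)} (hA : OrdLE A (-1))
    (h : ∀ a b, ((A + B) a b).IsDiff) : A = B.map pos - B := by
  ext a b i
  rw [Matrix.sub_apply, Matrix.map_apply, coeff_sub, coeff_pos]
  split_ifs with hi
  · rw [hA a b i (by omega), sub_self]
  · have := h a b i (by omega)
    rw [Matrix.add_apply, coeff_add] at this
    rw [zero_sub]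
    exact eq_neg_of_add_eq_zero_left this

omit [DecidableEq I] in
/-- The Leibniz rule for matrices of operators. -/
theorem map_mapCoeff_mul (δ : R →+ R) (hδ : ∀ a b, δ (a * b) = δ a * b + a * δ b)
    (hc : ∀ a, δ (Differential.deriv a) = Differential.deriv (δ a))
    (A B : Matrix I I (PsiDO R)) :
    (A * B).map (mapCoeff δ) = A.map (mapCoeff δ) * B + A * B.map (mapCoeff δ) := by
  ext1 a b
  have e := map_sum (mapCoeffHom δ) (fun c => A a c * B c b) Finset.univ
  simp only [mapCoeffHom_apply] at e
  simp only [Matrix.map_apply, Matrix.mul_apply, Matrix.add_apply, e, mapCoeff_mul δ hδ hc,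
    Finset.sum_add_distrib]

/-- The Lax equation for a dressed constant operator, from the equation for the dressing. -/
theorem lax_of_dressing (δ : R →+ R) (hδ : ∀ a b, δ (a * b) = δ a * b + a * δ b)
    (hc : ∀ a, δ (Differential.deriv a) = Differential.deriv (δ a))
    {Q T C D : Matrix I I (PsiDO R)} (hQT : Q * T = 1) (hTQ : T * Q = 1)
    (hC : C.map (mapCoeff δ) = 0) (hCD : C * D = D * C)
    (hQ : Q.map (mapCoeff δ) * T = (Q * D * T).map pos - Q * D * T) :
    (Q * C * T).map (mapCoeff δ) = ⁅(Q * D * T).map pos, Q * C * T⁆ := by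
  set Y := (Q * D * T).map pos with hY
  have h1 : (1 : Matrix I I (PsiDO R)).map (mapCoeff δ) = 0 := by
    have := map_mapCoeff_mul δ hδ hc (1 : Matrix I I (PsiDO R)) 1
    rw [mul_one, one_mul, mul_one] at this
    exact left_eq_add.mp this
  -- Obtained by differentiating `Q T = 1`.
  have hT : T.map (mapCoeff δ) = -(T * (Y - Q * D * T)) := by
    have e := map_mapCoeff_mul δ hδ hc Q T
    rw [hQT, h1, hQ] at e
    have e2 : T * (Y - Q * D * T + Q * T.map (mapCoeff δ)) = 0 := by rw [← e, mul_zero]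
    rw [mul_add, ← mul_assoc T Q (T.map _), hTQ, one_mul] at e2
    exact eq_neg_of_add_eq_zero_right e2
  have hQ' : Q.map (mapCoeff δ) = (Y - Q * D * T) * Q := by
    rw [← hQ, mul_assoc, hTQ, mul_one]
  rw [map_mapCoeff_mul δ hδ hc, map_mapCoeff_mul δ hδ hc, hC, mul_zero, add_zero, hT, hQ',
    Ring.lie_def]
  -- The non-differential part `Q D T` drops out of the commutator, since `C` and `D` commute.
  have e1 : Q * D * T * Q * C * T = Q * (D * C) * T := by
    rw [mul_assoc (Q * D) T Q, hTQ]; noncomm_ring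
  have e2 : Q * C * (T * (Q * D * T)) = Q * (C * D) * T := by
    rw [mul_assoc Q D T, ← mul_assoc T Q, hTQ]; noncomm_ring
  have e3 : (Y - Q * D * T) * Q * C * T + Q * C * -(T * (Y - Q * D * T)) =
      Y * (Q * C * T) - Q * C * T * Y - (Q * D * T * Q * C * T - Q * C * (T * (Q * D * T))) := by
    noncomm_ring
  rw [e3, e1, e2, hCD, sub_self, sub_zero]

end PsiMat

/-! ### Directional derivatives of functions of infinitely many variables -/

section Directional

variable {𝕜 ι κ : Type*} [RCLike 𝕜] [NormedAlgebra 𝕜 ℂ]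

/-- A directional derivative as a Fréchet derivative on a finite-dimensional slice. -/
theorem dirDeriv_eq_fderiv (Ω : TimeDomain 𝕜 ι) {f : Ω.carrier → ℂ} {n : ℕ}
    {t : ι → 𝕜} {w : Fin n → ι →₀ 𝕜} {z : Fin n → 𝕜} (hz : timeShift t w z ∈ Ω.carrier)
    (hd : DifferentiableAt 𝕜 (fun y : Fin n → 𝕜 => Ω.zeroExt f (timeShift t w y)) z)
    (y : Fin n → 𝕜) :
    dirDeriv Ω (∑ i, y i • w i) f ⟨_, hz⟩ =
      fderiv 𝕜 (fun y : Fin n → 𝕜 => Ω.zeroExt f (timeShift t w y)) z y := by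
  have hline : HasDerivAt (fun s : 𝕜 => z + s • y) y 0 := by
    simpa using ((hasDerivAt_id (0 : 𝕜)).smul_const y).const_add z
  have hd' := hd.hasFDerivAt
  rw [show z = z + (0 : 𝕜) • y by simp] at hd'
  have h := hd'.comp_hasDerivAt (0 : 𝕜) hline
  rw [show z + (0 : 𝕜) • y = z by simp] at h
  rw [← h.deriv, dirDeriv]
  congr 1
  funext s
  simp only [Function.comp, timeShift, add_assoc]
  congr 2
  rw [← Finsupp.coe_add]
  congr 1
  simp [add_smul, Finset.sum_add_distrib, Finset.smul_sum, smul_smul]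

theorem differentiableAt_slice (Ω : TimeDomain 𝕜 ι) {f : Ω.carrier → ℂ} (hf : Ω.IsSmooth f)
    {n : ℕ} {t : ι → 𝕜} (ht : t ∈ Ω.carrier) (w : Fin n → ι →₀ 𝕜) :
    DifferentiableAt 𝕜 (fun y : Fin n → 𝕜 => Ω.zeroExt f (timeShift t w y)) 0 :=
  (hf t ht n w).differentiableAt (by simp)

/-- All directions involved lie in one finite-dimensional slice, on which the directional
derivatives are values of a single linear Fréchet derivative. -/
theorem dirDeriv_linearCombination (Ω : TimeDomain 𝕜 ι) {f : Ω.carrier → ℂ} (hf : Ω.IsSmooth f)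
    {n : ℕ} (w : Fin n → ι →₀ 𝕜) (y : Fin n → 𝕜) (t : Ω.carrier) :
    dirDeriv Ω (∑ i, y i • w i) f t = ∑ i, y i • dirDeriv Ω (w i) f t := by
  obtain ⟨t, ht⟩ := t
  have hz : timeShift t w 0 ∈ Ω.carrier := by rwa [timeShift_zero]
  have ht' : (⟨t, ht⟩ : Ω.carrier) = ⟨timeShift t w 0, hz⟩ := Subtype.ext (timeShift_zero t w).symm
  have hd := differentiableAt_slice Ω hf ht w
  have h1 : ∀ i, dirDeriv Ω (w i) f ⟨timeShift t w 0, hz⟩ = fderiv 𝕜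
      (fun y : Fin n → 𝕜 => Ω.zeroExt f (timeShift t w y)) 0 (Pi.single i 1) := by
    intro i
    rw [← dirDeriv_eq_fderiv Ω hz hd]
    congr 1
    rw [Finset.sum_eq_single i]
    · simp
    · intro j _ hj; simp [Pi.single_eq_of_ne hj]
    · simp
  rw [ht', dirDeriv_eq_fderiv Ω hz hd]
  simp only [h1, ← map_smul, ← map_sum]
  congr 1
  funext j
  simp [Finset.sum_apply, Pi.single_apply]

theorem dirDerivation_add (Ω : TimeDomain 𝕜 ι) (v w : ι →₀ 𝕜) (f : SmoothFn Ω) :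
    dirDerivation Ω (v + w) f = dirDerivation Ω v f + dirDerivation Ω w f := by
  ext t
  have h := dirDeriv_linearCombination Ω f.2 ![v, w] 1 t
  simp only [Fin.sum_univ_two, Pi.one_apply, one_smul, Matrix.cons_val_zero,
    Matrix.cons_val_one] at h
  exact h

theorem dirDerivation_smul (Ω : TimeDomain 𝕜 ι) (c : 𝕜) (v : ι →₀ 𝕜) (f : SmoothFn Ω) :
    dirDerivation Ω (c • v) f = algebraMap 𝕜 ℂ c • dirDerivation Ω v f := by
  ext t
  have h := dirDeriv_linearCombination Ω f.2 ![v] ![c] t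
  simp only [Fin.sum_univ_one, Matrix.cons_val_zero] at h
  refine h.trans ?_
  rw [Algebra.smul_def]
  rfl

theorem dirDerivation_sum (Ω : TimeDomain 𝕜 ι) {α : Type*} (s : Finset α) (v : α → ι →₀ 𝕜)
    (f : SmoothFn Ω) : dirDerivation Ω (∑ x ∈ s, v x) f = ∑ x ∈ s, dirDerivation Ω (v x) f := by
  have h0 : dirDerivation Ω 0 f = 0 := by
    have := dirDerivation_add Ω 0 0 f
    rw [add_zero] at this
    exact left_eq_add.mp this
  exact map_sum (⟨⟨fun v => dirDerivation Ω v f, h0⟩, fun v w => dirDerivation_add Ω v w f⟩ :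
    (ι →₀ 𝕜) →+ SmoothFn Ω) v s

/-- Second directional derivatives as second Fréchet derivatives. -/
theorem dirDeriv_dirDeriv (Ω : TimeDomain 𝕜 ι) {f : Ω.carrier → ℂ} (hf : Ω.IsSmooth f)
    (u : Fin 2 → ι →₀ 𝕜) (i j : Fin 2) {t : ι → 𝕜} (ht : t ∈ Ω.carrier) :
    dirDeriv Ω (u i) (dirDeriv Ω (u j) f) ⟨t, ht⟩ =
      fderiv 𝕜 (fderiv 𝕜 fun y : Fin 2 → 𝕜 => Ω.zeroExt f (timeShift t u y)) 0
        (Pi.single i 1) (Pi.single j 1) := by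
  set F := fun y : Fin 2 → 𝕜 => Ω.zeroExt f (timeShift t u y)
  have hF0 : ContDiffAt 𝕜 ∞ F 0 := hf t ht 2 u
  have hu : ∀ k : Fin 2, ∑ x, (Pi.single k 1 : Fin 2 → 𝕜) x • u x = u k := by
    intro k
    rw [Finset.sum_eq_single k]
    · simp
    · intro j _ hj; simp [Pi.single_eq_of_ne hj]
    · simp
  -- The inner derivative must be identified on a neighbourhood, not just at the point, before it is
  -- differentiated again.
  have hev : ∀ᶠ y in 𝓝 (0 : Fin 2 → 𝕜), Ω.zeroExt (dirDeriv Ω (u j) f) (timeShift t u y) =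
      fderiv 𝕜 F y (Pi.single j 1) := by
    have h3 : ContDiffAt 𝕜 1 F 0 := hF0.of_le (by exact_mod_cast le_top)
    filter_upwards [Ω.isOpen' t ht 2 u, h3.eventually (by simp)] with y hy hy'
    rw [Ω.zeroExt_of_mem _ hy, ← dirDeriv_eq_fderiv Ω hy (hy'.differentiableAt (by simp)), hu]
  have hz : timeShift t u 0 ∈ Ω.carrier := by rwa [timeShift_zero]
  have ht' : (⟨t, ht⟩ : Ω.carrier) = ⟨timeShift t u 0, hz⟩ := Subtype.ext (timeShift_zero t u).symm
  have hd := differentiableAt_slice Ω (dirDeriv_smooth Ω (u j) hf) ht u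
  have h1 := dirDeriv_eq_fderiv Ω hz hd (Pi.single i 1)
  rw [hu] at h1
  rw [ht', h1, Filter.EventuallyEq.fderiv_eq hev]
  have hFd : DifferentiableAt 𝕜 (fderiv 𝕜 F) 0 :=
    (hF0.fderiv_right (m := ∞) (by simp)).differentiableAt (by simp)
  rw [fderiv_clm_apply hFd (differentiableAt_const _)]
  simp

/-- Symmetry of the second Fréchet derivative on the two-dimensional slice spanned by `v` and `w`.
-/
theorem dirDerivation_comm (Ω : TimeDomain 𝕜 ι) (v w : ι →₀ 𝕜) (f : SmoothFn Ω) :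
    dirDerivation Ω v (dirDerivation Ω w f) = dirDerivation Ω w (dirDerivation Ω v f) := by
  ext ⟨t, ht⟩
  have h1 := dirDeriv_dirDeriv Ω f.2 ![v, w] 0 1 ht
  have h2 := dirDeriv_dirDeriv Ω f.2 ![v, w] 1 0 ht
  have hs : IsSymmSndFDerivAt 𝕜 (fun y : Fin 2 → 𝕜 => Ω.zeroExt f.1 (timeShift t ![v, w] y)) 0 :=
    (f.2 t ht 2 ![v, w]).isSymmSndFDerivAt (by
      rw [minSmoothness_of_isRCLikeNormedField]; exact WithTop.coe_le_coe.mpr le_top)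
  rw [hs.eq] at h1
  exact h1.trans h2.symm

/-- The chain rule for a substitution of variables. -/
theorem dirDerivation_pullback {Ω : TimeDomain 𝕜 ι} (φ : TimeMap 𝕜 κ ι) (v : κ →₀ 𝕜)
    (f : SmoothFn Ω) : dirDerivation (Ω.comap φ) v (pullback φ f) =
      pullback φ (dirDerivation Ω (Finsupp.linearCombination 𝕜 φ.col v) f) := by
  ext t
  -- Substitutions carry lines to lines, so both sides differentiate literally the same function of
  -- `s`.
  change deriv _ _ = deriv _ _
  congr 1
  funext s
  have e : φ.toFun (t.1 + ⇑(s • v)) =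
      φ.toFun t.1 + ⇑(s • Finsupp.linearCombination 𝕜 φ.col v) := by
    rw [φ.map_add, map_smul]
  rw [← e]
  rfl

theorem pderivT_pullback {Ω : TimeDomain 𝕜 ι} (φ : TimeMap 𝕜 κ ι) (j : κ)
    (f : SmoothFn Ω) : pderivT j (pullback φ f) = pullback φ (dirDerivation Ω (φ.col j) f) := by
  rw [pderivT, dirDerivation_pullback, Finsupp.linearCombination_single, one_smul]

theorem pderivT_comm {Ω : TimeDomain 𝕜 ι} (i j : ι) (f : SmoothFn Ω) :
    pderivT i (pderivT j f) = pderivT j (pderivT i f) := dirDerivation_comm _ _ _ _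

/-- Restriction of functions to the set where `g` does not vanish. -/
def restrictNV {Ω : TimeDomain 𝕜 ι} (g : SmoothFn Ω) :
    SmoothFn Ω →+* SmoothFn (nonvanishing g) where
  toFun f := ⟨fun t => f.1 ⟨t.1, t.2.1⟩, (nonvanishing g).isSmooth_of _ fun t ht n v =>
    ⟨_, f.2 t ht.1 n v, fun _ hy => Ω.zeroExt_of_mem _ hy.1⟩⟩
  map_one' := rfl
  map_mul' _ _ := rfl
  map_zero' := rfl
  map_add' _ _ := rfl

/-- The set where `g` does not vanish is open along lines, so the two functions of the line
parameter agree near `0`. -/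
theorem dirDerivation_restrictNV {Ω : TimeDomain 𝕜 ι} (g : SmoothFn Ω) (v : ι →₀ 𝕜)
    (f : SmoothFn Ω) : dirDerivation _ v (restrictNV g f) =
      restrictNV g (dirDerivation Ω v f) := by
  ext t
  refine Filter.EventuallyEq.deriv_eq ?_
  have h1 := (nonvanishing g).isOpen' t.1 t.2 1 fun _ => v
  have h2 : Filter.Tendsto (fun (s : 𝕜) (_ : Fin 1) => s) (𝓝 0) (𝓝 0) :=
    (continuous_pi fun _ => continuous_id).tendsto' _ _ rfl
  filter_upwards [h2.eventually h1] with s hs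
  have hs' : t.1 + ⇑(s • v) ∈ (nonvanishing g).carrier := by simpa [timeShift] using hs
  rw [TimeDomain.zeroExt_of_mem _ _ hs', TimeDomain.zeroExt_of_mem _ _ hs'.1]
  rfl

/-- The inverse of `g` where `g` does not vanish. -/
def invNV {Ω : TimeDomain 𝕜 ι} (g : SmoothFn Ω) : SmoothFn (nonvanishing g) := quotFn 1 g

/-- Separates the division by the tau-function from a ring homomorphism, so that bilinear equations
can first be transported and then multiplied by the inverse. -/
theorem quotFn_eq {Ω : TimeDomain 𝕜 ι} (f g : SmoothFn Ω) :
    quotFn f g = invNV g * restrictNV g f := by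
  ext t
  change _ / _ = (1 : ℂ) / _ * _
  rw [one_div, div_eq_inv_mul]
  rfl

theorem invNV_mul {Ω : TimeDomain 𝕜 ι} (g : SmoothFn Ω) : invNV g * restrictNV g g = 1 := by
  ext t
  change (1 : ℂ) / _ * _ = 1
  exact one_div_mul_cancel t.2.2

theorem pderivT_coordFn (Ω : TimeDomain 𝕜 ι) (i : ι) : pderivT i (coordFn Ω i) = 1 := by
  ext t
  have h : HasDerivAt (fun s : 𝕜 => algebraMap 𝕜 ℂ (t.1 i + s)) 1 0 := by
    have h1 : HasDerivAt (fun s : 𝕜 => t.1 i + s) 1 0 := (hasDerivAt_id _).const_add _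
    have h2 := ((Algebra.linearMap 𝕜 ℂ).toContinuousLinearMap.hasFDerivAt
      (x := t.1 i + 0)).comp_hasDerivAt (0 : 𝕜) h1
    have e : (Algebra.linearMap 𝕜 ℂ).toContinuousLinearMap 1 = 1 := map_one (algebraMap 𝕜 ℂ)
    rw [e] at h2
    exact h2
  refine Eq.trans (Filter.EventuallyEq.deriv_eq ?_) h.deriv
  have h1 := Ω.isOpen' t.1 t.2 1 fun _ => Finsupp.single i 1
  have h2 : Filter.Tendsto (fun (s : 𝕜) (_ : Fin 1) => s) (𝓝 0) (𝓝 0) :=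
    (continuous_pi fun _ => continuous_id).tendsto' _ _ rfl
  filter_upwards [h2.eventually h1] with s hs
  have hs' : t.1 + ⇑(s • Finsupp.single i (1 : 𝕜)) ∈ Ω.carrier := by simpa [timeShift] using hs
  rw [TimeDomain.zeroExt_of_mem _ _ hs']
  simp [coordFn]

end Directional

/-! ### Bilinear equations for the wave operators -/

section Stable

variable {M N ι : Type*} [AddCommGroup M] [AddCommGroup N]

theorem foldr_hom_add (T : ι → M →+ M) (l : List ι) (G H : M) :
    l.foldr (fun i X => T i X) (G + H) =
      l.foldr (fun i X => T i X) G + l.foldr (fun i X => T i X) H := by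
  induction l with
  | nil => rfl
  | cons i l ih => simp only [List.foldr_cons, ih, map_add]

theorem foldr_hom_zero (T : ι → M →+ M) (l : List ι) :
    l.foldr (fun i X => T i X) (0 : M) = 0 := by
  induction l with
  | nil => rfl
  | cons i l ih => simp only [List.foldr_cons, ih, map_zero]

/-- The elements on which `π` vanishes after any product of the operators `T i`. -/
def stableKer (T : ι → M →+ M) (π : M →+ N) : AddSubgroup M where
  carrier := {G | ∀ l : List ι, π (l.foldr (fun i X => T i X) G) = 0}
  zero_mem' l := by rw [foldr_hom_zero, map_zero]
  add_mem' {G H} hG hH l := by rw [foldr_hom_add, map_add, hG l, hH l, add_zero]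
  neg_mem' {G} hG l := by
    have h := foldr_hom_add T l G (-G)
    rw [add_neg_cancel, foldr_hom_zero] at h
    rw [eq_neg_of_add_eq_zero_right h.symm, map_neg, hG l, neg_zero]

theorem map_eq_zero_of_mem_stableKer {T : ι → M →+ M} {π : M →+ N} {G : M}
    (hG : G ∈ stableKer T π) : π G = 0 := hG []

theorem apply_mem_stableKer {T : ι → M →+ M} {π : M →+ N} {G : M}
    (hG : G ∈ stableKer T π) (i : ι) : T i G ∈ stableKer T π := fun l => by
  have := hG (l ++ [i])
  rwa [List.foldr_append] at this

/-- The subgroup is stable under multiplication operators that satisfy a Leibniz rule. -/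
theorem mul_mem_stableKer {R : Type*} {T : ι → M →+ M} {π : M →+ N} (δ : ι → R → R)
    (μ : R → M → M) (hT : ∀ i f G, T i (μ f G) = μ (δ i f) G + μ f (T i G))
    (hπ : ∀ f G, π G = 0 → π (μ f G) = 0) {G : M} (hG : G ∈ stableKer T π) (f : R) :
    μ f G ∈ stableKer T π := by
  intro l
  -- The last list entry is the operator applied first, so the Leibniz rule acts directly on the
  -- product, and the two resulting terms are again of the same shape.
  induction l using List.reverseRecOn generalizing f G with
  | nil => exact hπ f G (hG [])
  | append_singleton l i ih =>
    rw [List.foldr_append]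
    simp only [List.foldr_cons, List.foldr_nil]
    rw [hT, foldr_hom_add, map_add, ih hG, ih (apply_mem_stableKer hG i), add_zero]

end Stable

/-! ### The residue pairing and the action of derivatives on exponential factors -/

section Pairing

open PsiDO

variable {C R S : Type*} [CommRing R] [CommRing S]

/-- Orders are bounded above. Finite support is what makes the `finsum` additive and compatible with
homomorphisms, instead of taking its default value. -/
theorem finite_residue_support (A : PsiDO R) (s : ℤ) (h : ℕ → R) :
    (Function.support fun n : ℕ => A.coeff ((n : ℤ) - 1 - s) * h n).Finite := by
  obtain ⟨N, hN⟩ := A.bdd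
  refine (Set.finite_Iic (N + 1 + s).toNat).subset fun n hn => ?_
  by_contra hc
  rw [Set.mem_Iic, not_le] at hc
  refine hn ?_
  simp only
  rw [hN _ (by omega), zero_mul]

/-- The residue of `∑_c z^{s_c} G_c(z) h_c(z)` with `h_c = ∑_n h_{c,n} z^{-n}`. -/
def residuePairing [Fintype C] (s : C → ℤ) (h : C → ℕ → R) : (C → PsiDO R) →+ R where
  toFun G := ∑ c, ∑ᶠ n : ℕ, (G c).coeff ((n : ℤ) - 1 - s c) * h c n
  map_zero' := by simp
  map_add' G H := by
    rw [← Finset.sum_add_distrib]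
    refine Finset.sum_congr rfl fun c _ => ?_
    rw [← finsum_add_distrib (finite_residue_support _ _ _) (finite_residue_support _ _ _)]
    simp only [Pi.add_apply, coeff_add, add_mul]

theorem residuePairing_apply [Fintype C] (s : C → ℤ) (h : C → ℕ → R) (G : C → PsiDO R) :
    residuePairing s h G = ∑ c, ∑ᶠ n : ℕ, (G c).coeff ((n : ℤ) - 1 - s c) * h c n := rfl

theorem residuePairing_map [Fintype C] (φ : R →+* S) (s : C → ℤ) (h : C → ℕ → R)
    (G : C → PsiDO R) :
    residuePairing s (fun c n => φ (h c n)) (fun c => mapCoeff φ.toAddMonoidHom (G c)) =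
      φ (residuePairing s h G) := by
  rw [residuePairing_apply, residuePairing_apply, map_sum]
  refine Finset.sum_congr rfl fun c _ => ?_
  have := (φ.toAddMonoidHom).map_finsum (finite_residue_support (G c) (s c) (h c))
  refine Eq.trans ?_ this.symm
  exact finsum_congr fun n => (map_mul φ _ _).symm

theorem residuePairing_mul_left [Fintype C] (f : R) (s : C → ℤ) (h : C → ℕ → R)
    (G : C → PsiDO R) :
    residuePairing s h (fun c => mapCoeff (AddMonoidHom.mulLeft f) (G c)) =
      f * residuePairing s h G := by
  rw [residuePairing_apply, residuePairing_apply, Finset.mul_sum]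
  refine Finset.sum_congr rfl fun c _ => ?_
  rw [← smul_eq_mul, smul_finsum' f (finite_residue_support _ _ _)]
  exact finsum_congr fun n => by simp [mul_assoc]

theorem residuePairing_mul_right [Fintype C] (f : R) (s : C → ℤ) (h : C → ℕ → R)
    (G : C → PsiDO R) :
    residuePairing s (fun c n => f * h c n) G = f * residuePairing s h G := by
  rw [← residuePairing_mul_left, residuePairing_apply, residuePairing_apply]
  exact Finset.sum_congr rfl fun c _ => finsum_congr fun n => by
    simp only [coeff_mapCoeff, AddMonoidHom.coe_mulLeft]; ring

/-- The action `G_c ↦ δ G_c + [c ∈ S] z^j G_c` of a derivation on the factors of exponentials. -/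
def waveStep (δ : R →+ R) (S : C → Prop) [DecidablePred S] (j : ℤ) :
    (C → PsiDO R) →+ (C → PsiDO R) where
  toFun G c := mapCoeff δ (G c) + if S c then shift j (G c) else 0
  map_zero' := by
    funext c
    ext i
    simp only [Pi.zero_apply, coeff_add, coeff_mapCoeff, coeff_zero, map_zero, ite_self]
    exact add_zero 0
  map_add' G H := by
    funext c
    ext i
    simp only [Pi.add_apply, coeff_add, coeff_mapCoeff, map_add]
    split_ifs
    · simp only [coeff_add]; ring
    · simp only [coeff_zero]; ring

theorem waveStep_apply (δ : R →+ R) (S : C → Prop) [DecidablePred S] (j : ℤ)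
    (G : C → PsiDO R) (c : C) :
    waveStep δ S j G c = mapCoeff δ (G c) + if S c then shift j (G c) else 0 := rfl

/-- Multiplication by `z^j` commutes with multiplication by a function, so only `δ` produces an
extra term. -/
theorem waveStep_mul (δ : R →+ R) (hδ : ∀ a b, δ (a * b) = δ a * b + a * δ b) (S : C → Prop)
    [DecidablePred S] (j : ℤ) (f : R) (G : C → PsiDO R) :
    waveStep δ S j (fun c => mapCoeff (AddMonoidHom.mulLeft f) (G c)) =
      (fun c => mapCoeff (AddMonoidHom.mulLeft (δ f)) (G c)) +
      fun c => mapCoeff (AddMonoidHom.mulLeft f) (waveStep δ S j G c) := by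
  funext c
  ext i
  simp only [waveStep_apply, Pi.add_apply, coeff_add, coeff_mapCoeff, AddMonoidHom.coe_mulLeft, hδ,
    mul_add]
  split_ifs
  · simp only [coeff_shift, coeff_mapCoeff, AddMonoidHom.coe_mulLeft]; ring
  · simp only [coeff_zero]; ring

end Pairing

/-! ### The bilinear equations for the numerators of the wave matrices -/

section BilinearNumerators

open PsiDO

variable {𝕜 : Type*} [RCLike 𝕜] [NormedAlgebra 𝕜 ℂ] {r : ℕ} {Ω : TimeDomain 𝕜 (Fin r × ℕ+)}

/-- The partial derivative as an additive map. -/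
abbrev pderivHom {ι : Type*} {Ω : TimeDomain 𝕜 ι} (i : ι) : SmoothFn Ω →+ SmoothFn Ω :=
  (pderivT i).toLinearMap.toAddMonoidHom

theorem pderivHom_mul {ι : Type*} {Ω : TimeDomain 𝕜 ι} (i : ι) (a b : SmoothFn Ω) :
    pderivHom i (a * b) = pderivHom i a * b + a * pderivHom i b := by
  have h := (pderivT i).leibniz a b
  simp only [smul_eq_mul] at h
  refine h.trans ?_
  rw [add_comm, mul_comm b]
  rfl

/-- The action of `∂/∂t_j^{(b)}`. -/
def fullStep (bj : Fin r × ℕ+) : (Fin r → PsiDO (SmoothFn Ω)) →+ (Fin r → PsiDO (SmoothFn Ω)) :=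
  waveStep (pderivHom bj) (fun c => bj.1 = c) ((bj.2 : ℕ) : ℤ)

/-- Matches the list of derivatives in the definition of a tau-function with the family of additive
operators used in `stableKer`; all components are treated simultaneously. -/
theorem coeff_foldr_fullStep (l : List (Fin r × ℕ+)) (G : Fin r → PsiDO (SmoothFn Ω)) (c : Fin r)
    (i : ℤ) : (l.foldr (fun bj X => fullStep bj X) G c).coeff i =
      waveDeriv c l (G c).coeff i := by
  induction l generalizing i with
  | nil => rfl
  | cons bj l ih =>
    simp only [List.foldr_cons, waveDeriv]
    rw [fullStep, waveStep_apply, coeff_add, coeff_mapCoeff, ih]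
    congr 1
    split_ifs
    · rw [coeff_shift, ih]; rfl
    · rfl

theorem waveDeriv_smul_shift (c : Fin r) (l : List (Fin r × ℕ+)) (s e : ℤ)
    (G : ℤ → SmoothFn Ω) (i : ℤ) :
    waveDeriv c l (fun i => s • G (i + e)) i = s • waveDeriv c l G (i + e) := by
  induction l generalizing i with
  | nil => rfl
  | cons bj l ih =>
    change pderivT bj (waveDeriv c l (fun i => s • G (i + e)) i) +
      (if bj.1 = c then waveDeriv c l (fun i => s • G (i + e)) (i - (bj.2 : ℕ)) else 0) =
      s • (pderivT bj (waveDeriv c l G (i + e)) +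
      (if bj.1 = c then waveDeriv c l G (i + e - (bj.2 : ℕ)) else 0))
    rw [ih, ih, smul_add, map_zsmul]
    congr 1
    split_ifs
    · congr 2; ring
    · simp

theorem finsum_nat_succ {M : Type*} [AddCommMonoid M] {g : ℕ → M} (h0 : g 0 = 0) :
    ∑ᶠ n, g n = ∑ᶠ n, g (n + 1) := by
  rw [← finsum_mem_range (f := g) (g := fun n : ℕ => n + 1) (fun a b h => by simpa using h)]
  refine finsum_congr fun n => ?_
  rcases n with _ | n
  · have : (0 : ℕ) ∉ Set.range fun n : ℕ => n + 1 := by rintro ⟨n, hn⟩; simp at hn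
    simp [this, h0]
  · have : n + 1 ∈ Set.range fun n : ℕ => n + 1 := ⟨n, rfl⟩
    simp only [this, finsum_true]

/-- `1` off the diagonal. -/
def offDiag (a b : Fin r) : ℕ := if a = b then 0 else 1

/-- The sign `(-1)^{[a < b]}`. -/
def ltSign (a b : Fin r) : ℤˣ := if a < b then -1 else 1

/-- The numerators of the coefficients of `P^-_{bc}(-z)`. -/
def waveNumNeg (τ : (Fin r → ℤ) → SmoothFn Ω) (m : Fin r → ℤ) (b c : Fin r) (n : ℕ) :
    SmoothFn Ω :=
  ((-1) ^ n : ℤ) • waveNum τ (-1) m b c n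

/-- The cut-off of `ofSymbol` at order `0` is harmless: for positive `i` the series coefficient
vanishes by its own cut-off. -/
theorem coeff_ofSymbol_waveNum (τ : (Fin r → ℤ) → SmoothFn Ω) (m : Fin r → ℤ) (a c : Fin r)
    (i : ℤ) : (ofSymbol (waveNum τ 1 m a c)).coeff i = (ltSign a c : ℤ) •
      eMinusSeries c 1 (τ (m + Pi.single a 1 - Pi.single c 1)) (i + offDiag a c) := by
  have e : m + ((1 : ℤˣ) : ℤ) • (Pi.single a 1 - Pi.single c 1) =
      m + Pi.single a 1 - Pi.single c (1 : ℤ) := by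
    rw [Units.val_one, one_smul, add_sub_assoc]
  rw [coeff_ofSymbol]
  split_ifs with hi
  · rw [waveNum, e, one_pow, mul_one, ltSign]
    congr 2
    rw [offDiag, Int.toNat_of_nonneg (by omega), neg_neg]
    split_ifs <;> rfl
  · rw [eMinusSeries, if_neg (by omega), smul_zero]

/-- The sign `(-1)^n` from evaluating at `-z` cancels the `σ^n` built into `waveNum` for `σ = -1`.
-/
theorem waveNumNeg_eq (τ : (Fin r → ℤ) → SmoothFn Ω) (m : Fin r → ℤ) (b c : Fin r) (n : ℕ) :
    waveNumNeg τ m b c n = (ltSign b c : ℤ) •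
      eMinusSeries c (-1) (τ (m - Pi.single b 1 + Pi.single c 1)) (-(n : ℤ) + offDiag b c) := by
  have e : m + ((-1 : ℤˣ) : ℤ) • (Pi.single b 1 - Pi.single c 1) =
      m - Pi.single b 1 + Pi.single c (1 : ℤ) := by
    rw [Units.val_neg, Units.val_one, neg_smul, one_smul]; abel
  rw [waveNumNeg, waveNum, e, smul_smul]
  congr 1
  · rw [ltSign]
    push_cast
    rw [mul_left_comm, ← pow_add, ← two_mul, pow_mul]
    simp
  · rw [offDiag]
    split_ifs <;> rfl

/-- This is the tau-function equation for `m' = m + e_a`, `m'' = m - e_b`. Its signs and powers of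
`z` split into one factor for each of the two wave matrices, because `m' + m''` is `2m` up to unit
vectors. -/
theorem bilinear_waveNum {p : Fin r → ℕ} {k : ℤ} {τ : (Fin r → ℤ) → SmoothFn Ω}
    (hτ : IsTauFunction p k τ) {m : Fin r → ℤ} (hm : ∑ a, m a = k) (a b : Fin r) (ℓ : ℕ) :
    (fun c => ofSymbol (waveNum τ 1 m a c)) ∈ stableKer fullStep
      (residuePairing (fun c => ((ℓ * p c : ℕ) : ℤ)) (waveNumNeg τ m b)) := by
  intro l
  have h := hτ ℓ (m + Pi.single a 1) (m - Pi.single b 1)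
    (by simp [Finset.sum_add_distrib, hm]) (by simp [Finset.sum_sub_distrib, hm]) l
  rw [residuePairing_apply, ← h]
  refine Finset.sum_congr rfl fun c _ => ?_
  set G := eMinusSeries c 1 (τ (m + Pi.single a 1 - Pi.single c 1)) with hG
  have hsign : (Int.negOnePow (∑ i ∈ Finset.Iio c, ((m + Pi.single a 1 : Fin r → ℤ) i +
      (m - Pi.single b 1 : Fin r → ℤ) i)) : ℤ) = (ltSign a c : ℤ) * (ltSign b c : ℤ) := by
    have e1 : ∀ x : Fin r, ∑ i ∈ Finset.Iio c, (Pi.single x (1 : ℤ) : Fin r → ℤ) i =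
        if x < c then 1 else 0 := by
      intro x
      simp [Pi.single_apply]
    have e2 : ∑ i ∈ Finset.Iio c, ((m + Pi.single a 1 : Fin r → ℤ) i + (m - Pi.single b 1 : Fin r → ℤ) i) =
        2 * (∑ i ∈ Finset.Iio c, m i) + (if a < c then 1 else 0) - (if b < c then 1 else 0) := by
      rw [← e1 a, ← e1 b, Finset.mul_sum, ← Finset.sum_add_distrib, ← Finset.sum_sub_distrib]
      refine Finset.sum_congr rfl fun i _ => ?_
      simp only [Pi.add_apply, Pi.sub_apply]
      ring
    rw [e2, Int.negOnePow_sub, Int.negOnePow_add, Int.negOnePow_two_mul, ltSign, ltSign]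
    split_ifs <;> simp
  rw [hsign]
  have hcoef : ∀ i, (l.foldr (fun bj X => fullStep bj X)
      (fun c => ofSymbol (waveNum τ 1 m a c)) c).coeff i =
      (ltSign a c : ℤ) • waveDeriv c l G (i + offDiag a c) := by
    intro i
    rw [coeff_foldr_fullStep, ← waveDeriv_smul_shift]
    congr 1
    funext i
    exact coeff_ofSymbol_waveNum τ m a c i
  -- The exponent `m'_c - m''_c - 2` is `(δ_ac - 1) + (δ_bc - 1)`, the sum of the powers of `z` in
  -- the two matrix entries.
  have hidx : (m + Pi.single a 1 : Fin r → ℤ) c - (m - Pi.single b 1 : Fin r → ℤ) c =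
      2 - (offDiag a c : ℤ) - offDiag b c := by
    simp only [Pi.add_apply, Pi.sub_apply, Pi.single_apply, offDiag, eq_comm (a := c)]
    split_ifs <;> push_cast <;> ring
  have hsm : ∀ (x y : SmoothFn Ω), ((ltSign a c : ℤ) • x) * ((ltSign b c : ℤ) • y) =
      ((ltSign a c : ℤ) * (ltSign b c : ℤ)) • (x * y) := fun x y => by
    rw [smul_mul_smul_comm]
  simp only [hcoef, waveNumNeg_eq, hsm]
  rw [hidx]
  -- Finiteness is needed to move the sign through the `finsum`. It is inherited from a residue of
  -- the same coefficients, after undoing the sign, which is its own inverse.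
  have hfin : (Function.support fun q : ℕ => waveDeriv c l G ((q : ℤ) - 1 -
      (2 - (offDiag a c : ℤ) - offDiag b c + ℓ * p c - 2)) *
      eMinus c (-1) q (τ (m - Pi.single b 1 + Pi.single c 1))).Finite := by
    have h2 := finite_residue_support (l.foldr (fun bj X => fullStep bj X)
      (fun c => ofSymbol (waveNum τ 1 m a c)) c) (ℓ * p c - offDiag b c)
      (fun q => eMinus c (-1) q (τ (m - Pi.single b 1 + Pi.single c 1)))
    refine h2.subset fun q hq hc => hq ?_
    simp only [hcoef] at hc
    rw [smul_mul_assoc] at hc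
    have hu := congrArg (fun x => (ltSign a c : ℤ) • x) hc
    simp only [smul_smul, smul_zero, ← Units.val_mul, Int.units_mul_self, Units.val_one,
      one_smul] at hu
    rw [← hu]
    simp only
    congr 2
    ring
  rw [smul_finsum' _ hfin]
  -- Off the diagonal the second factor carries an extra `z⁻¹`: its zeroth coefficient vanishes and
  -- the summation index shifts by one.
  by_cases hbc : b = c
  · have h0 : offDiag b c = 0 := if_pos hbc
    refine finsum_congr fun q => ?_
    rw [h0]
    congr 2
    · congr 1
      push_cast
      ring
    · rw [eMinusSeries, if_pos (by simp)]
      simp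
  · have h0 : offDiag b c = 1 := if_neg hbc
    rw [h0, finsum_nat_succ]
    · refine finsum_congr fun q => ?_
      congr 2
      · congr 1
        push_cast
        ring
      · rw [eMinusSeries, if_pos (by push_cast; omega)]
        congr 1
        push_cast
        omega
    · rw [eMinusSeries, if_neg (by simp)]
      simp

variable {τ : (Fin r → ℤ) → SmoothFn Ω} {m : Fin r → ℤ}

theorem waveNum_zero_of_ne (σ : ℤˣ) {a b : Fin r} (hab : a ≠ b) : waveNum τ σ m a b 0 = 0 := by
  rw [waveNum, if_neg hab, eMinusSeries, if_neg (by simp : ¬-((0 : ℕ) : ℤ) + 1 ≤ 0), smul_zero]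

theorem eMinus_zero (a : Fin r) (σ : ℤˣ) (f : SmoothFn Ω) : eMinus a σ 0 f = f := by
  have : Subsingleton (Composition 0) :=
    Fintype.card_le_one_iff_subsingleton.mp (by rw [composition_card]; simp)
  rw [eMinus, Fintype.sum_subsingleton _ (Composition.ones 0)]
  simp
  rfl

theorem waveNum_zero_diag (σ : ℤˣ) (a : Fin r) : waveNum τ σ m a a 0 = τ m := by
  rw [waveNum, if_pos (rfl : a = a), if_neg (lt_irrefl a), eMinusSeries,
    if_pos (by simp : -((0 : ℕ) : ℤ) + 0 ≤ 0)]
  simp [eMinus_zero]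

end BilinearNumerators

/-! ### Reduction of the variables and the bilinear equations for `Q` -/

section BilinearReduced

open PsiDO

variable {𝕜 : Type*} [RCLike 𝕜] [NormedAlgebra 𝕜 ℂ] {r : ℕ} [NeZero r] (p : Fin r → ℕ)
  {Ω : TimeDomain 𝕜 (Fin r × ℕ+)} (τ : (Fin r → ℤ) → SmoothFn Ω) (m : Fin r → ℤ)

/-- Reduction of the variables followed by restriction to the domain of the wave operators. -/
def redHom : SmoothFn Ω →+* SmoothFn (waveDomain p τ m) :=
  (restrictNV (pullback (redMap p) (τ m))).comp (pullback (redMap p))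

theorem pderivT_redHom (i : Option (Blk1 p × ℕ+)) (f : SmoothFn Ω) :
    pderivT i (redHom p τ m f) = redHom p τ m (dirDerivation Ω ((redMap p).col i) f) := by
  rw [redHom, RingHom.comp_apply, pderivT, dirDerivation_restrictNV]
  exact congrArg (restrictNV _) (pderivT_pullback (redMap p) i f)

theorem pderivT_some_redHom (d : Blk1 p) (j : ℕ+) (f : SmoothFn Ω) :
    pderivT (some (d, j)) (redHom p τ m f) = redHom p τ m (pderivT (d.1, j) f) :=
  pderivT_redHom p τ m _ f

/-- The variable `x` is added to every `t_1^{(d)}` with `d ≤ r_1`, so `∂/∂x` is the sum of these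
flows. -/
theorem pderivT_none_redHom (f : SmoothFn Ω) :
    pderivT none (redHom p τ m f) = redHom p τ m (∑ d : Blk1 p, pderivT (d.1, 1) f) := by
  rw [pderivT_redHom]
  congr 1
  exact dirDerivation_sum Ω _ _ f

theorem waveQ_eq (σ : ℤˣ) (a b : Fin r) (n : ℕ) : waveQ p τ m σ a b n =
    invNV (pullback (redMap p) (τ m)) * redHom p τ m (waveNum τ σ m a b n) := quotFn_eq _ _

/-- The coefficients of `Q^-_{bc}(-z)`. -/
def waveQNeg (b c : Fin r) (n : ℕ) : SmoothFn (waveDomain p τ m) :=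
  ((-1) ^ n : ℤ) • waveQ p τ m (-1) b c n

theorem waveQNeg_eq (b c : Fin r) (n : ℕ) : waveQNeg p τ m b c n =
    invNV (pullback (redMap p) (τ m)) * redHom p τ m (waveNumNeg τ m b c n) := by
  rw [waveQNeg, waveQ_eq, waveNumNeg, map_zsmul, mul_smul_comm]

variable {p τ m}

/-- The action of `∂/∂x` and of `∂/∂t_j^{(d)}`, `d ≤ r_1`, after the reduction. -/
def redStep {V : TimeDomain 𝕜 (Option (Blk1 p × ℕ+))} : Option (Blk1 p × ℕ+) →
    (Fin r → PsiDO (SmoothFn V)) →+ (Fin r → PsiDO (SmoothFn V))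
  | none => waveStep (pderivHom none) (fun c => p c = p 0) 1
  | some dj => waveStep (pderivHom (some dj)) (fun c => dj.1.1 = c) ((dj.2 : ℕ) : ℤ)

theorem redStep_mul {V : TimeDomain 𝕜 (Option (Blk1 p × ℕ+))} (i : Option (Blk1 p × ℕ+))
    (f : SmoothFn V) (G : Fin r → PsiDO (SmoothFn V)) :
    redStep i (fun c => mapCoeff (AddMonoidHom.mulLeft f) (G c)) =
      (fun c => mapCoeff (AddMonoidHom.mulLeft (pderivHom i f)) (G c)) +
      fun c => mapCoeff (AddMonoidHom.mulLeft f) (redStep i G c) := by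
  rcases i with _ | dj <;> exact waveStep_mul _ (pderivHom_mul _) _ _ _ _

/-- The action before the reduction that corresponds to `redStep`. -/
def liftStep (i : Option (Blk1 p × ℕ+)) :
    (Fin r → PsiDO (SmoothFn Ω)) →+ (Fin r → PsiDO (SmoothFn Ω)) :=
  match i with
  | none => ∑ d : Blk1 p, fullStep (d.1, 1)
  | some dj => fullStep (dj.1.1, dj.2)

theorem liftStep_mem {N : Type*} [AddCommGroup N] {π : (Fin r → PsiDO (SmoothFn Ω)) →+ N}
    {G : Fin r → PsiDO (SmoothFn Ω)} (hG : G ∈ stableKer fullStep π)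
    (i : Option (Blk1 p × ℕ+)) : liftStep i G ∈ stableKer fullStep π := by
  rcases i with _ | dj
  · rw [liftStep, AddMonoidHom.finsetSum_apply]
    exact sum_mem fun d _ => apply_mem_stableKer hG _
  · exact apply_mem_stableKer hG _

/-- Chain rule for the reduction, including the exponential factors. -/
theorem redStep_map (i : Option (Blk1 p × ℕ+)) (G : Fin r → PsiDO (SmoothFn Ω)) :
    redStep i (fun c => mapCoeff (redHom p τ m).toAddMonoidHom (G c)) =
      fun c => mapCoeff (redHom p τ m).toAddMonoidHom (liftStep i G c) := by
  funext c
  ext1 k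
  rcases i with _ | ⟨d, j⟩
  · rw [redStep, waveStep_apply, liftStep, AddMonoidHom.finsetSum_apply, Finset.sum_apply,
      coeff_add, coeff_mapCoeff, coeff_mapCoeff, coeff_mapCoeff, coeff_sum]
    have e1 : pderivHom none ((redHom p τ m).toAddMonoidHom ((G c).coeff k)) =
        redHom p τ m (∑ d : Blk1 p, pderivT (d.1, 1) ((G c).coeff k)) :=
      pderivT_none_redHom p τ m _
    have e2 : ∀ d : Blk1 p, (fullStep (d.1, 1) G c).coeff k =
        pderivT (d.1, 1) ((G c).coeff k) + if d.1 = c then (G c).coeff (k - 1) else 0 := by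
      intro d
      rw [fullStep, waveStep_apply, coeff_add, coeff_mapCoeff]
      congr 1
      simp only
      split_ifs <;> rfl
    rw [e1]
    simp only [e2, Finset.sum_add_distrib]
    refine Eq.trans ?_ (map_add (redHom p τ m) _ _).symm
    congr 1
    -- Of the summands of `∂/∂x`, only `d = c` multiplies the component `c` by `z`, and it is
    -- present exactly when `c` lies in the first block.
    by_cases hc : p c = p 0
    · rw [if_pos hc, Finset.sum_eq_single (⟨c, hc⟩ : Blk1 p)]
      · rw [if_pos rfl]; rfl
      · intro d _ hd
        exact if_neg fun he => hd (Subtype.ext he)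
      · simp
    · rw [if_neg hc, Finset.sum_eq_zero]
      · rw [map_zero]; rfl
      · intro d _
        exact if_neg fun he : d.1 = c => hc (by rw [← he]; exact d.2)
  · rw [redStep, waveStep_apply, liftStep, fullStep, waveStep_apply, coeff_add, coeff_mapCoeff,
      coeff_mapCoeff, coeff_mapCoeff, coeff_add, coeff_mapCoeff, map_add]
    congr 1
    · exact pderivT_some_redHom p τ m d j _
    · simp only
      split_ifs
      · rfl
      · exact (map_zero (redHom p τ m)).symm

/-- Any product of reduced derivatives lifts to a combination of derivatives before the reduction,
where the pairing already vanishes. -/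
theorem map_mem_stableKer {s : Fin r → ℤ} {h : Fin r → ℕ → SmoothFn Ω}
    {G : Fin r → PsiDO (SmoothFn Ω)} (hG : G ∈ stableKer fullStep (residuePairing s h)) :
    (fun c => mapCoeff (redHom p τ m).toAddMonoidHom (G c)) ∈
      stableKer (redStep (V := waveDomain p τ m))
        (residuePairing s fun c n => redHom p τ m (h c n)) := by
  intro l
  have hl : ∃ G' ∈ stableKer fullStep (residuePairing s h),
      l.foldr (fun i X => redStep i X) (fun c => mapCoeff (redHom p τ m).toAddMonoidHom (G c)) =
        fun c => mapCoeff (redHom p τ m).toAddMonoidHom (G' c) := by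
    induction l with
    | nil => exact ⟨G, hG, rfl⟩
    | cons i l ih =>
      obtain ⟨G', hG', e⟩ := ih
      refine ⟨liftStep i G', liftStep_mem hG' i, ?_⟩
      rw [List.foldr_cons, e, redStep_map]
  obtain ⟨G', hG', e⟩ := hl
  rw [e, residuePairing_map, map_eq_zero_of_mem_stableKer hG', map_zero]

/-- The bilinear equations for the reduced wave operators. -/
theorem bilinear_waveQ {k : ℤ} (hτ : IsTauFunction p k τ) (hm : ∑ a, m a = k) (a b : Fin r)
    (ℓ : ℕ) :
    (fun c => ofSymbol (waveQ p τ m 1 a c)) ∈ stableKer (redStep (V := waveDomain p τ m))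
      (residuePairing (fun c => ((ℓ * p c : ℕ) : ℤ)) (waveQNeg p τ m b)) := by
  have h1 := map_mem_stableKer (p := p) (τ := τ) (m := m) (bilinear_waveNum hτ hm a b ℓ)
  set f := invNV (pullback (redMap p) (τ m))
  have h2 : (fun c => ofSymbol (waveQ p τ m 1 a c)) = fun c => mapCoeff (AddMonoidHom.mulLeft f)
      (mapCoeff (redHom p τ m).toAddMonoidHom (ofSymbol (waveNum τ 1 m a c))) := by
    funext c
    ext1 i
    rw [coeff_mapCoeff, coeff_mapCoeff, coeff_ofSymbol, coeff_ofSymbol]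
    split_ifs
    · exact waveQ_eq p τ m 1 a c _
    · simp
  -- The denominator of the second factor is never differentiated and simply multiplies the pairing.
  have h3 : residuePairing (fun c => ((ℓ * p c : ℕ) : ℤ)) (waveQNeg p τ m b) =
      (AddMonoidHom.mulLeft f).comp (residuePairing (fun c => ((ℓ * p c : ℕ) : ℤ))
        fun c n => redHom p τ m (waveNumNeg τ m b c n)) := by
    refine AddMonoidHom.ext fun G => ?_
    have : waveQNeg p τ m b = fun c n => f * redHom p τ m (waveNumNeg τ m b c n) := by
      funext c n
      exact waveQNeg_eq p τ m b c n
    rw [this, residuePairing_mul_right]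
    rfl
  rw [h2]
  -- The denominator of the first factor is hit by the derivatives, so dividing by it uses the
  -- stability of the whole system of equations under the Leibniz rule.
  have h4 := mul_mem_stableKer (fun i => pderivHom i)
    (fun f G c => mapCoeff (AddMonoidHom.mulLeft f) (G c)) redStep_mul
    (fun f G hG => by rw [residuePairing_mul_left, hG, mul_zero]) h1 f
  intro l
  rw [h3, AddMonoidHom.comp_apply, h4 l, map_zero]

end BilinearReduced

/-! ### From residues to operators: inverse and evolution of `Q_11` -/

section Residues

open PsiDO

variable {𝕜 : Type*} [RCLike 𝕜] [NormedAlgebra 𝕜 ℂ] {r : ℕ} [NeZero r] {p : Fin r → ℕ}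

theorem deriv_eq_pderivT {κ : Type*} {V : TimeDomain 𝕜 (Option κ)} (f : SmoothFn V) :
    Differential.deriv f = pderivT none f := rfl

section Iterate

variable {V : TimeDomain 𝕜 (Option (Blk1 p × ℕ+))}

/-- On symbols, left composition with `∂` is `∂_x + z`, which is how `∂/∂x` acts on a component with
the factor `exp(xz)`. -/
theorem redStep_none_iterate_blk1 (G : Fin r → PsiDO (SmoothFn V)) (k : ℕ) (c : Blk1 p) :
    ((redStep none)^[k] G) c.1 = mono 1 (k : ℤ) * G c.1 := by
  induction k with
  | zero => exact (one_mul _).symm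
  | succ k ih =>
    have e : ∀ H : Fin r → PsiDO (SmoothFn V), redStep none H c.1 = mono 1 1 * H c.1 := by
      intro H
      ext1 i
      rw [coeff_d_mul, redStep, waveStep_apply, if_pos c.2, coeff_add, coeff_mapCoeff, coeff_shift,
        add_comm]
      rfl
    rw [Function.iterate_succ_apply', e, ih, ← mul_assoc, mono_mul_mono_one]
    congr 2
    push_cast
    ring

/-- The second block carries no exponential after the reduction, so `∂/∂x` only differentiates
coefficients. -/
theorem coeff_redStep_none_iterate_blk2 (G : Fin r → PsiDO (SmoothFn V)) (k : ℕ) (c : Blk2 p)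
    (i : ℤ) : (((redStep none)^[k] G) c.1).coeff i =
      (Differential.deriv (R := SmoothFn V))^[k] ((G c.1).coeff i) := by
  induction k with
  | zero => rfl
  | succ k ih =>
    rw [Function.iterate_succ_apply', Function.iterate_succ_apply', ← ih, redStep,
      waveStep_apply, if_neg c.2, add_zero]
    rfl

/-- The bilinear equation in terms of residues of operators. -/
theorem residue_identity {s : Fin r → ℤ} {h : Fin r → ℕ → SmoothFn V}
    {G : Fin r → PsiDO (SmoothFn V)} (hG : G ∈ stableKer redStep (residuePairing s h)) (k : ℕ) :
    (mono 1 (k : ℤ) * ∑ c : Blk1 p, G c.1 * mono 1 (s c.1) * coSymbol (h c.1)).coeff (-1) +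
      ∑ c : Blk2 p, ∑ᶠ n : ℕ, (Differential.deriv (R := SmoothFn V))^[k]
        ((G c.1).coeff ((n : ℤ) - 1 - s c.1)) * h c.1 n = 0 := by
  have hk : (redStep none)^[k] G ∈ stableKer redStep (residuePairing s h) := by
    induction k with
    | zero => exact hG
    | succ k ih =>
      rw [Function.iterate_succ_apply']
      exact apply_mem_stableKer ih none
  have h0 := map_eq_zero_of_mem_stableKer hk
  rw [residuePairing_apply, ← Fintype.sum_subtype_add_sum_subtype (fun c => p c = p 0)] at h0
  rw [← h0, Finset.mul_sum, coeff_sum]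
  congr 1
  · refine Finset.sum_congr rfl fun c _ => ?_
    rw [redStep_none_iterate_blk1, ← mul_assoc, ← mul_assoc, coeff_mul_coSymbol]
    simp only [coeff_mul_mono_one]
  · refine Finset.sum_congr rfl fun c _ => finsum_congr fun n => ?_
    rw [coeff_redStep_none_iterate_blk2]

/-- For `ℓ = 0` the components of the second block do not contribute. -/
theorem isDiff_of_mem_stableKer {h : Fin r → ℕ → SmoothFn V} {G : Fin r → PsiDO (SmoothFn V)}
    (hG : G ∈ stableKer redStep (residuePairing (fun _ => 0) h))
    (hord : ∀ c : Blk2 p, (G c.1).OrdLE (-1)) (hh : ∀ c : Blk2 p, h c.1 0 = 0) :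
    (∑ c : Blk1 p, G c.1 * coSymbol (h c.1)).IsDiff := by
  intro i hi
  refine coeff_eq_zero_of_residues (fun k => ?_) hi
  have := residue_identity hG k
  have e : ∀ A : PsiDO (SmoothFn V), A * mono 1 0 = A := mul_one
  simp only [e] at this
  -- Both factors of a second-block term are `O(z⁻¹)`, so their product has no residue.
  rw [Finset.sum_eq_zero (s := (Finset.univ : Finset (Blk2 p))), add_zero] at this
  · exact this
  · intro c _
    refine finsum_eq_zero_of_forall_eq_zero fun n => ?_
    rcases n with _ | n
    · rw [hh c, mul_zero]
    · rw [hord c _ (by push_cast; omega), iter_zero, zero_mul]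

end Iterate

/-- Identifies a second-block term of the bilinear equation, where only the first factor is
differentiated, as the residue of `∂^k` composed with `f ∂⁻¹ ∘ g`. -/
theorem coeff_residue_mono_mul_mono {R : Type*} [CommRing R] [Differential R] (k : ℕ) (f g : R) :
    (mono 1 (k : ℤ) * (mono f (-1) * mono g 0)).coeff (-1) =
      (Differential.deriv (R := R))^[k] f * g := by
  rw [← mul_assoc, coeff_neg_one_mul_mono_zero, coeff_mono_mul, finsum_eq_single _ k]
  · rw [coeff_mono, if_pos (by ring), Ring.choose_natCast]
    simp
  · intro n hn
    rw [coeff_mono, if_neg (by omega), iter_zero]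
    simp

variable {Ω : TimeDomain 𝕜 (Fin r × ℕ+)} {τ : (Fin r → ℤ) → SmoothFn Ω} {m : Fin r → ℤ}

theorem waveQ_zero (σ : ℤˣ) (a b : Fin r) : waveQ p τ m σ a b 0 = if a = b then 1 else 0 := by
  rw [waveQ_eq]
  split_ifs with h
  · subst h
    rw [waveNum_zero_diag]
    exact invNV_mul _
  · rw [waveNum_zero_of_ne σ h, map_zero, mul_zero]

theorem waveQNeg_zero (a b : Fin r) : waveQNeg p τ m a b 0 = if a = b then 1 else 0 := by
  rw [waveQNeg, waveQ_zero]
  simp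

variable (p τ m)

/-- The inverse of `Q^+_{11}`. -/
def waveInv : Matrix (Blk1 p) (Blk1 p) (PsiDO (SmoothFn (waveDomain p τ m))) :=
  Matrix.of fun c b => coSymbol (waveQNeg p τ m b.1 c.1)

variable {p τ m}

theorem ordLE_waveQ11 : PsiMat.OrdLE (waveQ11 p τ m) 0 := fun _ _ => ordLE_ofSymbol _

theorem ordLE_waveInv : PsiMat.OrdLE (waveInv p τ m) 0 := fun _ _ => ordLE_coSymbol _

theorem cf_waveQ11 : PsiMat.cf (waveQ11 p τ m) 0 = 1 := by
  ext1 a b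
  change waveQ p τ m 1 a.1 b.1 0 = _
  rw [waveQ_zero, Matrix.one_apply]
  simp only [Subtype.ext_iff]

theorem cf_waveInv : PsiMat.cf (waveInv p τ m) 0 = 1 := by
  ext1 a b
  change (coSymbol (waveQNeg p τ m b.1 a.1)).coeff 0 = _
  rw [coeff_coSymbol_zero, waveQNeg_zero, Matrix.one_apply]
  simp only [Subtype.ext_iff, eq_comm]

theorem ordLE_ofSymbol_waveQ {a : Fin r} {c : Fin r} (hac : a ≠ c) :
    (ofSymbol (waveQ p τ m 1 a c)).OrdLE (-1) := by
  intro i hi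
  rw [coeff_ofSymbol]
  split_ifs with h
  · rw [show (-i).toNat = 0 by omega, waveQ_zero, if_neg hac]
  · rfl

theorem blk_ne (a : Blk1 p) (c : Blk2 p) : a.1 ≠ c.1 := fun h => c.2 (h ▸ a.2)

section Wave

variable {k : ℤ} (hτ : IsTauFunction p k τ) (hm : ∑ a, m a = k)

include hτ hm

theorem bilinear_waveQ_zero (a b : Fin r) :
    (fun c => ofSymbol (waveQ p τ m 1 a c)) ∈ stableKer (redStep (V := waveDomain p τ m))
      (residuePairing (fun _ => 0) (waveQNeg p τ m b)) := by
  have := bilinear_waveQ hτ hm a b 0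
  simpa only [zero_mul, Nat.cast_zero] using this

/-- Negative orders vanish by the equation with `ℓ = 0`, positive orders because both factors have
order at most zero, and the order-zero coefficient is the product of two identities. -/
theorem waveQ11_mul_waveInv : waveQ11 p τ m * waveInv p τ m = 1 := by
  have ho := ordLE_waveQ11.mul (ordLE_waveInv (p := p) (τ := τ) (m := m))
  have hc := PsiMat.cf_mul_top ordLE_waveQ11 (ordLE_waveInv (p := p) (τ := τ) (m := m))
  rw [cf_waveQ11, cf_waveInv, one_mul, add_zero] at hc
  rw [add_zero] at ho
  ext1 a b
  ext1 i
  rcases lt_trichotomy i 0 with hi | rfl | hi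
  · have h := isDiff_of_mem_stableKer (bilinear_waveQ_zero hτ hm a.1 b.1)
      (fun c => ordLE_ofSymbol_waveQ (blk_ne a c))
      (fun c => by rw [waveQNeg_zero, if_neg (blk_ne b c)]) i hi
    rw [Matrix.mul_apply, Matrix.one_apply]
    refine h.trans ?_
    split_ifs
    · rw [coeff_one, if_neg (by omega)]
    · rfl
  · have h1 := congrFun (congrFun hc a) b
    have h2 := congrFun (congrFun (PsiMat.cf_one (R := SmoothFn (waveDomain p τ m))
      (I := Blk1 p)) a) b
    exact h1.trans h2.symm
  · rw [ho a b i hi, PsiMat.ordLE_one a b i hi]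

/-- The bilinear equations give the product in one order only; the other follows formally, since
both leading coefficients are `1`. -/
theorem waveInv_mul_waveQ11 : waveInv p τ m * waveQ11 p τ m = 1 := by
  refine PsiMat.mul_eq_one_symm (waveQ11_mul_waveInv hτ hm) ?_
  have ho := (ordLE_waveInv (p := p) (τ := τ) (m := m)).mul ordLE_waveQ11
  have hc := PsiMat.cf_mul_top (ordLE_waveInv (p := p) (τ := τ) (m := m)) ordLE_waveQ11
  rw [cf_waveQ11, cf_waveInv, one_mul, add_zero] at hc
  rw [add_zero] at ho
  refine PsiMat.ordLE_pred (N := 0) ?_ ?_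
  · rw [sub_eq_add_neg]
    exact ho.add PsiMat.ordLE_one.neg
  · ext1 a b
    have h1 := congrFun (congrFun hc a) b
    have h2 := congrFun (congrFun (PsiMat.cf_one (R := SmoothFn (waveDomain p τ m))
      (I := Blk1 p)) a) b
    have : (PsiMat.cf (waveInv p τ m * waveQ11 p τ m - 1) 0) a b =
        PsiMat.cf (waveInv p τ m * waveQ11 p τ m) 0 a b - PsiMat.cf 1 0 a b := rfl
    rw [this, h1, h2, sub_self]
    rfl

theorem isUnit_waveQ11 : IsUnit (waveQ11 p τ m) :=
  ⟨⟨_, _, waveQ11_mul_waveInv hτ hm, waveInv_mul_waveQ11 hτ hm⟩, rfl⟩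

theorem inverse_waveQ11 : Ring.inverse (waveQ11 p τ m) = waveInv p τ m :=
  Ring.inverse_unit ⟨_, _, waveQ11_mul_waveInv hτ hm, waveInv_mul_waveQ11 hτ hm⟩

/-- The evolution of the dressing operator. -/
theorem waveQ11_evolution (d : Blk1 p) (j : ℕ+) :
    (waveQ11 p τ m).map (mapCoeff (pderivHom (some (d, j)))) * waveInv p τ m =
      (waveQ11 p τ m * Matrix.single d d (mono 1 ((j : ℕ) : ℤ)) * waveInv p τ m).map pos -
        waveQ11 p τ m * Matrix.single d d (mono 1 ((j : ℕ) : ℤ)) * waveInv p τ m := by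
  refine PsiMat.eq_pos_of_ordLE ?_ fun a b => ?_
  -- The leading coefficient of `Q_11` is constant, so differentiation lowers the order below zero.
  · have h1 : PsiMat.OrdLE ((waveQ11 p τ m).map (mapCoeff (pderivHom (some (d, j))))) (-1) := by
      refine PsiMat.ordLE_pred (N := 0) ?_ ?_
      · intro a b i hi
        rw [Matrix.map_apply, coeff_mapCoeff, ordLE_waveQ11 a b i hi, map_zero]
      · ext1 a b
        change pderivT _ (waveQ p τ m 1 a.1 b.1 0) = 0
        rw [waveQ_zero]
        split_ifs <;> simp
    simpa using h1.mul (ordLE_waveInv (p := p) (τ := τ) (m := m))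
  -- Differentiating the equation with `ℓ = 0` in `t_j^{(d)}` replaces `Q_11` by `∂Q_11/∂t + Q_11 ∘
  -- E_dd ∂^j`: the flow multiplies only column `d` by `z^j`.
  · have h := isDiff_of_mem_stableKer
      (apply_mem_stableKer (bilinear_waveQ_zero hτ hm a.1 b.1) (some (d, j)))
      (fun c => by
        rw [redStep, waveStep_apply, if_neg (blk_ne d c), add_zero]
        intro i hi
        rw [coeff_mapCoeff, ordLE_ofSymbol_waveQ (blk_ne a c) i hi, map_zero])
      (fun c => by rw [waveQNeg_zero, if_neg (blk_ne b c)])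
    rw [← add_mul, Matrix.mul_apply]
    convert h using 2 with c
    change _ * coSymbol _ = _
    congr 1
    rw [Matrix.add_apply, redStep, waveStep_apply]
    change mapCoeff _ (ofSymbol _) + _ = _
    congr 1
    split_ifs with hdc
    · obtain rfl : d = c := Subtype.ext hdc
      rw [Matrix.mul_single_apply_same, mul_mono_one]
      rfl
    · rw [Matrix.mul_single_apply_of_ne]
      exact fun h => hdc (congrArg Subtype.val h.symm)

end Wave

end Residues

/-! ### Dressed operators and their flows -/

section ReducedLax

open PsiDO

variable {𝕜 : Type*} [RCLike 𝕜] [NormedAlgebra 𝕜 ℂ] {r : ℕ} [NeZero r] {p : Fin r → ℕ}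
  {Ω : TimeDomain 𝕜 (Fin r × ℕ+)} {τ : (Fin r → ℤ) → SmoothFn Ω} {m : Fin r → ℤ}

section Conjugation

variable {A I : Type*} [Ring A] [Fintype I] [DecidableEq I]

theorem single_pow (d : I) (x : A) {n : ℕ} (hn : 0 < n) :
    Matrix.single d d x ^ n = Matrix.single d d (x ^ n) := by
  induction n, hn using Nat.le_induction with
  | base => simp
  | succ n _ ih => rw [pow_succ, ih, Matrix.single_mul_single_same, pow_succ]

theorem dressing_pow {Q T C : Matrix I I A} (hQT : Q * T = 1) (hTQ : T * Q = 1) (n : ℕ) :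
    (Q * C * T) ^ n = Q * C ^ n * T := by
  induction n with
  | zero => simp [hQT]
  | succ n ih =>
    rw [pow_succ, ih, pow_succ]
    calc Q * C ^ n * T * (Q * C * T) = Q * C ^ n * (T * Q) * C * T := by noncomm_ring
      _ = Q * (C ^ n * C) * T := by rw [hTQ]; noncomm_ring

theorem sum_single_diag (x : A) : ∑ d : I, Matrix.single d d x = Matrix.diagonal fun _ => x := by
  ext1 a b
  rw [Matrix.sum_apply, Matrix.diagonal_apply]
  simp only [Matrix.single_apply]
  split_ifs with h
  · subst h
    simp
  · refine Finset.sum_eq_zero fun d _ => if_neg ?_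
    rintro ⟨rfl, rfl⟩
    exact h rfl

theorem diagonal_const_pow (x : A) (n : ℕ) :
    (Matrix.diagonal fun _ : I => x) ^ n = Matrix.diagonal fun _ => x ^ n := by
  rw [Matrix.diagonal_pow]
  rfl

end Conjugation

variable (p τ m) in
/-- The dressed operator `Q_{11} ∘ ∂^n ∘ Q_{11}⁻¹`. -/
def dressed (n : ℤ) : Matrix (Blk1 p) (Blk1 p) (PsiDO (SmoothFn (waveDomain p τ m))) :=
  waveQ11 p τ m * Matrix.diagonal (fun _ => mono 1 n) * waveInv p τ m

theorem ordLE_diagonal_mono {R I : Type*} [CommRing R] [DecidableEq I] (n : ℤ) :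
    PsiMat.OrdLE (Matrix.diagonal fun _ : I => (mono 1 n : PsiDO R)) n := by
  intro a b i hi
  rw [Matrix.diagonal_apply]
  split_ifs
  · exact ordLE_mono 1 n i hi
  · rfl

theorem ordLE_dressed (n : ℤ) : PsiMat.OrdLE (dressed p τ m n) n := by
  have h := (ordLE_waveQ11.mul (ordLE_diagonal_mono n)).mul
    (ordLE_waveInv (p := p) (τ := τ) (m := m))
  rw [zero_add, add_zero] at h
  exact h

theorem cf_dressed (n : ℤ) : PsiMat.cf (dressed p τ m n) n = 1 := by
  have h1 := PsiMat.cf_mul_top (ordLE_waveQ11 (p := p) (τ := τ) (m := m)) (ordLE_diagonal_mono n)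
  have h2 := PsiMat.cf_mul_top (ordLE_waveQ11.mul (ordLE_diagonal_mono n))
    (ordLE_waveInv (p := p) (τ := τ) (m := m))
  have h3 : PsiMat.cf (Matrix.diagonal fun _ : Blk1 p =>
      (mono 1 n : PsiDO (SmoothFn (waveDomain p τ m)))) n = 1 := by
    ext1 a b
    simp only [PsiMat.cf, Matrix.map_apply, Matrix.diagonal_apply, Matrix.one_apply]
    split_ifs
    · rw [coeff_mono, if_pos rfl]
    · rfl
  rw [h1, cf_waveQ11, cf_waveInv, h3, zero_add, add_zero, mul_one, mul_one] at h2
  exact h2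

theorem pderivHom_deriv {κ : Type*} {V : TimeDomain 𝕜 (Option κ)} (i : Option κ)
    (f : SmoothFn V) :
    pderivHom i (Differential.deriv f) = Differential.deriv (pderivHom i f) :=
  pderivT_comm i none f

section Wave

variable {k : ℤ} (hτ : IsTauFunction p k τ) (hm : ∑ a, m a = k)

include hτ hm

theorem laxA_pow (d : Blk1 p) {n : ℕ} (hn : 0 < n) : laxA p τ m d ^ n =
    waveQ11 p τ m * Matrix.single d d (mono 1 (n : ℤ)) * waveInv p τ m := by
  rw [laxA, inverse_waveQ11 hτ hm,
    dressing_pow (waveQ11_mul_waveInv hτ hm) (waveInv_mul_waveQ11 hτ hm), single_pow d _ hn,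
    mono_one_pow]

theorem sum_laxA_pow {n : ℕ} (hn : 0 < n) : ∑ d, laxA p τ m d ^ n = dressed p τ m n := by
  simp only [laxA_pow hτ hm _ hn]
  rw [← Finset.sum_mul, ← Finset.mul_sum, sum_single_diag, dressed]

theorem dressed_pow (n : ℕ) : dressed p τ m 1 ^ n = dressed p τ m n := by
  rw [dressed, dressing_pow (waveQ11_mul_waveInv hτ hm) (waveInv_mul_waveQ11 hτ hm),
    diagonal_const_pow, mono_one_pow, dressed]

theorem dressed_evolution (d : Blk1 p) (j : ℕ+) (n : ℤ) :
    (dressed p τ m n).map (mapCoeff (pderivHom (some (d, j)))) =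
      ⁅(waveQ11 p τ m * Matrix.single d d (mono 1 ((j : ℕ) : ℤ)) * waveInv p τ m).map pos,
        dressed p τ m n⁆ := by
  refine PsiMat.lax_of_dressing _ (pderivHom_mul _) (pderivHom_deriv _)
    (waveQ11_mul_waveInv hτ hm) (waveInv_mul_waveQ11 hτ hm) ?_ ?_ (waveQ11_evolution hτ hm d j)
  · ext1 a b
    ext1 i
    rw [Matrix.map_apply, coeff_mapCoeff, Matrix.diagonal_apply]
    split_ifs
    · rw [coeff_mono]
      split_ifs
      · exact (pderivT (some (d, j))).map_one_eq_zero
      · exact map_zero _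
    · exact map_zero _
  · ext1 a b
    rw [Matrix.diagonal_mul, Matrix.mul_diagonal, Matrix.single_apply]
    split_ifs
    · rw [mono_mul_mono_one, mono_mul_mono_one, add_comm]
    · rw [mul_zero, zero_mul]

/-- The matrices `E_dd` add up to the identity, so the generators of the individual flows add up to
a power of the dressed `∂`. -/
theorem sum_dressed_evolution (j : ℕ+) (n : ℤ) :
    ∑ d : Blk1 p, (dressed p τ m n).map (mapCoeff (pderivHom (some (d, j)))) =
      ⁅(dressed p τ m 1 ^ (j : ℕ)).map pos, dressed p τ m n⁆ := by
  have e : (dressed p τ m 1 ^ (j : ℕ)).map pos = ∑ d : Blk1 p,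
      (waveQ11 p τ m * Matrix.single d d (mono 1 ((j : ℕ) : ℤ)) * waveInv p τ m).map pos := by
    rw [dressed_pow hτ hm, dressed, ← sum_single_diag, Finset.mul_sum, Finset.sum_mul]
    exact map_sum (posHom.mapMatrix (m := Blk1 p) (n := Blk1 p)) _ _
  rw [e, Ring.lie_def, Finset.sum_mul, Finset.mul_sum, ← Finset.sum_sub_distrib]
  exact Finset.sum_congr rfl fun d _ => dressed_evolution hτ hm d j n

/-- The part of the dressed operator `Q_{11} ∘ ∂^{p_1} ∘ Q_{11}⁻¹` that is not differential. -/
theorem isDiff_dressed (a b : Blk1 p) : (dressed p τ m (p 0) a b +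
    ∑ c : Blk2 p, ∑ n ∈ Finset.range (p c.1), mono (waveQ p τ m 1 a.1 c.1 (n + 1)) (-1) *
      mono (waveQNeg p τ m b.1 c.1 (p c.1 - n)) 0).IsDiff := by
  intro i hi
  refine coeff_eq_zero_of_residues (fun k => ?_) hi
  -- The equation with `ℓ = 1` inserts `z^{p_c}`. This equals `∂^{p_1}` for every `c` in the first
  -- block and leaves a nonzero residue in the second.
  have h := residue_identity (bilinear_waveQ hτ hm a.1 b.1 1) k
  rw [mul_add, coeff_add]
  refine Eq.trans ?_ h
  congr 1
  · congr 2
    rw [dressed, Matrix.mul_apply]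
    refine Finset.sum_congr rfl fun c _ => ?_
    rw [Matrix.mul_diagonal]
    congr 3
    rw [one_mul, c.2]
  · rw [Finset.mul_sum, coeff_sum]
    refine Finset.sum_congr rfl fun c _ => ?_
    rw [Finset.mul_sum, coeff_sum]
    simp only [coeff_residue_mono_mul_mono]
    -- Off-diagonal entries start at `z⁻¹`: for `Q^+` this bounds `n` by `p_c`, for `Q^-` it removes
    -- `n = 0`. Reversing the remaining `p_c` terms gives the stated indexing.
    rw [finsum_eq_sum_of_support_subset (s := Finset.range (p c.1 + 1)), Finset.sum_range_succ',
      waveQNeg_zero, if_neg (blk_ne b c), mul_zero, add_zero, ← Finset.sum_range_reflect]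
    · refine Finset.sum_congr rfl fun n hn => ?_
      have hn' : n < p c.1 := Finset.mem_range.mp hn
      rw [coeff_ofSymbol, if_pos (by push_cast; omega)]
      congr 3
      · push_cast; omega
      · omega
    · intro n hn
      by_contra hc
      have hn' : p c.1 + 1 ≤ n := by simpa using hc
      apply hn
      simp only
      rw [ordLE_ofSymbol_waveQ (blk_ne a c) _ (by push_cast; omega), iter_zero, zero_mul]

end Wave

end ReducedLax

/-! ### Identification of the times, the flip by `ε`, and Lax equations -/

section Identification

open PsiDO

variable {𝕜 : Type*} [RCLike 𝕜] [NormedAlgebra 𝕜 ℂ]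

/-- Reduces the claim to a single known root: the coefficients form a complex algebra, where `n
c^{n-1}` is invertible, so `PsiMat.root_unique` applies. -/
theorem solvesLax_of_root {I : Type*} [Fintype I] [DecidableEq I] {V : TimeDomain 𝕜 (Option ℕ+)}
    {c : ℂ} (hc : c ≠ 0) {n : ℕ} (hn : 0 < n) {A B : Matrix I I (PsiDO (SmoothFn V))}
    (hB : IsRootWithLeading c n A B)
    (h : ∀ j : ℕ+, A.map (mapCoeff (pderivHom (some j))) = ⁅(B ^ (j : ℕ)).map pos, A⁆) :
    SolvesLax c n A := by
  have huniq : ∀ C, IsRootWithLeading c n A C → C = B := by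
    intro C hC
    refine PsiMat.root_unique hn (c := algebraMap ℂ (SmoothFn V) c) ?_ hC.2 hB.2
      (hC.1.trans hB.1.symm)
    intro x hx
    have hne : (n : ℂ) * c ^ (n - 1) ≠ 0 :=
      mul_ne_zero (Nat.cast_ne_zero.mpr hn.ne') (pow_ne_zero _ hc)
    have hx' : ((n : ℂ) * c ^ (n - 1)) • x = 0 := by
      rw [Algebra.smul_def, map_mul, map_pow, map_natCast]
      exact hx
    rw [← inv_smul_smul₀ hne x, hx', smul_zero]
  refine ⟨⟨B, hB, huniq⟩, fun C hC j => ?_⟩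
  rw [huniq C hC]
  exact h j

variable {r : ℕ} [NeZero r] {p : Fin r → ℕ}
  {Ω : TimeDomain 𝕜 (Fin r × ℕ+)} {τ : (Fin r → ℤ) → SmoothFn Ω} {m : Fin r → ℤ}

section Diagonal

variable {V : TimeDomain 𝕜 (Option (Blk1 p × ℕ+))}

theorem pullback_diagMap_deriv (f : SmoothFn V) : pullback (diagMap p) (Differential.deriv f) =
    Differential.deriv (pullback (diagMap p) f) :=
  (pderivT_pullback (diagMap p) none f).symm

/-- The common time `t_j` moves all `t_j^{(d)}` at once; this is why the flows are summed over `d`.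
-/
theorem pderivT_pullback_diagMap (j : ℕ+) (f : SmoothFn V) :
    pderivT (some j) (pullback (diagMap p) f) =
      pullback (diagMap p) (∑ d : Blk1 p, pderivT (some (d, j)) f) := by
  rw [pderivT_pullback]
  exact congrArg _ (dirDerivation_sum V _ _ f)

/-- The identification of the times, for operators. -/
def diagHom (V : TimeDomain 𝕜 (Option (Blk1 p × ℕ+))) :
    PsiDO (SmoothFn V) →+* PsiDO (SmoothFn (V.comap (diagMap p))) :=
  mapRingHom (pullback (diagMap p)) pullback_diagMap_deriv

theorem coeff_diagHom (A : PsiDO (SmoothFn V)) (i : ℤ) :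
    (diagHom V A).coeff i = pullback (diagMap p) (A.coeff i) := rfl

theorem diagHom_evolution {I : Type*} (A : Matrix I I (PsiDO (SmoothFn V))) (j : ℕ+) :
    (A.map (diagHom V)).map (mapCoeff (pderivHom (some j))) =
      (∑ d : Blk1 p, A.map (mapCoeff (pderivHom (some (d, j))))).map (diagHom V) := by
  ext1 a b
  ext1 i
  rw [Matrix.map_apply, Matrix.map_apply, Matrix.map_apply, Matrix.sum_apply, coeff_diagHom,
    coeff_sum, coeff_mapCoeff, coeff_diagHom]
  exact pderivT_pullback_diagMap j _

theorem map_pos_diagHom {I : Type*} (A : Matrix I I (PsiDO (SmoothFn V))) :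
    (A.map (diagHom V)).map pos = (A.map pos).map (diagHom V) := by
  ext1 a b
  exact pos_mapCoeff _ _

end Diagonal

section Flip

variable {V : TimeDomain 𝕜 (Option ℕ+)} (ε : 𝕜)

theorem pullback_flipMap_deriv (f : SmoothFn V) : pullback (flipMap ε) (Differential.deriv f) =
    -Differential.deriv (pullback (flipMap ε) f) := by
  have h : Differential.deriv (pullback (flipMap ε) f) =
      pullback (flipMap ε) (dirDerivation V (Finsupp.single none (-1)) f) :=
    pderivT_pullback (flipMap ε) none f
  have e : (Finsupp.single none (-1) : Option ℕ+ →₀ 𝕜) = (-1 : 𝕜) • Finsupp.single none 1 := by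
    simp
  rw [h, e, dirDerivation_smul, map_neg, map_one, neg_smul, one_smul, map_neg, neg_neg]
  rfl

theorem pderivT_pullback_flipMap (j : ℕ+) (f : SmoothFn V) :
    pderivT (some j) (pullback (flipMap ε) f) =
      algebraMap ℂ _ (algebraMap 𝕜 ℂ ε ^ (j : ℕ)) * pullback (flipMap ε) (pderivT (some j) f) := by
  have h : pderivT (some j) (pullback (flipMap ε) f) =
      pullback (flipMap ε) (dirDerivation V (Finsupp.single (some j) (ε ^ (j : ℕ))) f) :=
    pderivT_pullback (flipMap ε) (some j) f
  have e : (Finsupp.single (some j) (ε ^ (j : ℕ)) : Option ℕ+ →₀ 𝕜) =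
      (ε ^ (j : ℕ)) • Finsupp.single (some j) 1 := by simp
  rw [h, e, dirDerivation_smul, map_pow]
  rfl

/-- The substitution `x ↦ -x`, `t_j ↦ ε^j t_j`, `∂ ↦ -∂`, for operators. -/
def flipHom (V : TimeDomain 𝕜 (Option ℕ+)) (ε : 𝕜) :
    PsiDO (SmoothFn V) →+* PsiDO (SmoothFn (V.comap (flipMap ε))) :=
  reflectHom (pullback (flipMap ε)) (pullback_flipMap_deriv ε)

theorem coeff_flipHom (A : PsiDO (SmoothFn V)) (i : ℤ) : (flipHom V ε A).coeff i =
    (Int.negOnePow i : ℤ) • pullback (flipMap ε) (A.coeff i) := rfl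

theorem map_pos_flipHom {I : Type*} (A : Matrix I I (PsiDO (SmoothFn V))) :
    (A.map (flipHom V ε)).map pos = (A.map pos).map (flipHom V ε) := by
  ext1 a b
  exact pos_reflect _ _

theorem mul_mono_const {R : Type*} [CommRing R] [Differential R] {c : R}
    (hc : Differential.deriv c = 0) (A : PsiDO R) : A * mono c 0 = mono c 0 * A := by
  ext1 i
  rw [coeff_mul_mono_zero, coeff_mono_zero_mul, finsum_eq_single _ 0]
  · simp [mul_comm]
  · intro n hn
    obtain ⟨n, rfl⟩ := Nat.exists_eq_succ_of_ne_zero hn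
    rw [Function.iterate_succ_apply, hc, iter_zero]
    simp

/-- Multiplication by a constant. -/
def constMat (I : Type*) [DecidableEq I] (V : TimeDomain 𝕜 (Option ℕ+)) (c : ℂ) :
    Matrix I I (PsiDO (SmoothFn V)) :=
  Matrix.diagonal fun _ => mono (algebraMap ℂ _ c) 0

variable {I : Type*} [Fintype I] [DecidableEq I]

theorem constMat_mul_apply (c : ℂ) (A : Matrix I I (PsiDO (SmoothFn V))) (a b : I) (i : ℤ) :
    ((constMat I V c * A) a b).coeff i = algebraMap ℂ _ c * (A a b).coeff i := by
  rw [constMat, Matrix.diagonal_mul, coeff_mono_zero_mul]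

/-- Scalar matrices commute with all operators because constants are annihilated by `∂`. -/
theorem constMat_commute (c : ℂ) (A : Matrix I I (PsiDO (SmoothFn V))) :
    Commute (constMat I V c) A := by
  ext1 a b
  rw [constMat, Matrix.diagonal_mul, Matrix.mul_diagonal, mul_mono_const]
  exact (pderivT none).map_algebraMap c

theorem constMat_pow (c : ℂ) (n : ℕ) : constMat I V c ^ n = constMat I V (c ^ n) := by
  rw [constMat, diagonal_const_pow, constMat]
  congr 1
  funext _
  induction n with
  | zero => simp; rfl
  | succ n ih => rw [pow_succ, ih, mono_zero_mul_mono, ← map_mul, pow_succ]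

theorem constMat_neg_one_mul (A : Matrix I I (PsiDO (SmoothFn V))) :
    constMat I V (-1) * A = -A := by
  ext1 a b
  ext1 i
  rw [constMat_mul_apply, map_neg, map_one]
  exact neg_one_mul ((A a b).coeff i)

theorem map_pos_constMat_mul (c : ℂ) (A : Matrix I I (PsiDO (SmoothFn V))) :
    (constMat I V c * A).map pos = constMat I V c * A.map pos := by
  ext1 a b
  ext1 i
  rw [Matrix.map_apply, coeff_pos, constMat_mul_apply, constMat_mul_apply, Matrix.map_apply,
    coeff_pos]
  split_ifs <;> simp

omit [Fintype I] [DecidableEq I] in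
theorem coeff_flipHom_evolution (A : Matrix I I (PsiDO (SmoothFn V))) (j : ℕ+) (a b : I) (i : ℤ) :
    (((A.map (flipHom V ε)).map (mapCoeff (pderivHom (some j)))) a b).coeff i =
      algebraMap ℂ _ (algebraMap 𝕜 ℂ ε ^ (j : ℕ)) *
        (((A.map (mapCoeff (pderivHom (some j)))).map (flipHom V ε)) a b).coeff i := by
  rw [Matrix.map_apply, Matrix.map_apply, Matrix.map_apply, Matrix.map_apply, coeff_flipHom,
    coeff_mapCoeff, coeff_flipHom, map_zsmul, mul_smul_comm]
  exact congrArg _ (pderivT_pullback_flipMap ε j _)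

/-- The flipped operator solves the Lax equations. -/
theorem solvesLax_flip {n : ℕ} (hn : 0 < n) (hε : ε ^ n = -1)
    {A B : Matrix I I (PsiDO (SmoothFn V))} (hB : IsRootWithLeading 1 n A B)
    (h : ∀ j : ℕ+, A.map (mapCoeff (pderivHom (some j))) = ⁅(B ^ (j : ℕ)).map pos, A⁆) :
    SolvesLax (-algebraMap 𝕜 ℂ ε) n (-A.map (flipHom V ε)) := by
  have hεn : algebraMap 𝕜 ℂ ε ^ n = -1 := by rw [← map_pow, hε, map_neg, map_one]
  have hε0 : algebraMap 𝕜 ℂ ε ≠ 0 := fun h0 => by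
    rw [h0, zero_pow hn.ne'] at hεn
    exact neg_ne_zero.mpr one_ne_zero hεn.symm
  -- The new root is `ε` times the flipped one. Its `n`-th power acquires `ε^n = -1`, and its `j`-th
  -- power acquires the `ε^j` that the chain rule produces on the other side.
  have hpow : ∀ j : ℕ, (constMat I _ (algebraMap 𝕜 ℂ ε) * B.map (flipHom V ε)) ^ j =
      constMat I _ (algebraMap 𝕜 ℂ ε ^ j) * (B ^ j).map (flipHom V ε) := by
    intro j
    rw [(constMat_commute _ _).mul_pow, constMat_pow]
    congr 1
    exact (map_pow (flipHom V ε).mapMatrix B j).symm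
  refine solvesLax_of_root (neg_ne_zero.mpr hε0) hn
    (B := constMat I _ (algebraMap 𝕜 ℂ ε) * B.map (flipHom V ε)) ⟨?_, ?_⟩ fun j => ?_
  · rw [hpow, hεn, hB.1, constMat_neg_one_mul]
  · intro a b i hi
    rw [constMat_mul_apply, Matrix.map_apply, coeff_flipHom, hB.2 a b i hi]
    split_ifs with hab
    -- The flip turns `∂` into `-∂`, hence the leading coefficient `-ε`.
    · rw [hab.2, map_one, map_one]
      simp only [Int.negOnePow_one, Units.val_neg, Units.val_one, neg_smul, one_smul, map_neg]
      exact mul_neg_one (algebraMap ℂ (SmoothFn (V.comap (flipMap ε))) (algebraMap 𝕜 ℂ ε))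
    · simp
  · have e1 : (-A.map (flipHom V ε)).map (mapCoeff (pderivHom (some j))) =
        -(constMat I _ (algebraMap 𝕜 ℂ ε ^ (j : ℕ)) *
          (A.map (mapCoeff (pderivHom (some j)))).map (flipHom V ε)) := by
      ext1 a b
      ext1 i
      rw [Matrix.neg_apply, coeff_neg, constMat_mul_apply, ← coeff_flipHom_evolution]
      exact map_neg (pderivHom (some j)) _
    have e2 : (⁅(B ^ (j : ℕ)).map pos, A⁆).map (flipHom V ε) =
        ⁅((B ^ (j : ℕ)).map pos).map (flipHom V ε), A.map (flipHom V ε)⁆ := by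
      rw [Ring.lie_def, Ring.lie_def]
      have := map_sub (flipHom V ε).mapMatrix ((B ^ (j : ℕ)).map pos * A)
        (A * (B ^ (j : ℕ)).map pos)
      rw [map_mul, map_mul] at this
      exact this
    rw [e1, h j, e2, hpow, map_pos_constMat_mul, map_pos_flipHom, Ring.lie_def, Ring.lie_def,
      mul_neg, neg_mul, mul_sub, neg_sub_neg, neg_sub, ← mul_assoc (A.map _),
      ← (constMat_commute _ (A.map (flipHom V ε))).eq]
    simp only [mul_assoc]

end Flip

section Wave

variable {k : ℤ} (hτ : IsTauFunction p k τ) (hm : ∑ a, m a = k)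

include hτ hm

theorem laxTilde_eq (hp : 0 < p 0) :
    laxTilde p τ m = (dressed p τ m (p 0)).map (diagHom (waveDomain p τ m)) := by
  rw [laxTilde, sum_laxA_pow hτ hm hp]
  rfl

theorem isRootWithLeading_laxTilde (hp : 0 < p 0) : IsRootWithLeading 1 (p 0) (laxTilde p τ m)
    ((dressed p τ m 1).map (diagHom (waveDomain p τ m))) := by
  refine ⟨?_, fun a b i hi => ?_⟩
  · rw [laxTilde_eq hτ hm hp, ← dressed_pow hτ hm]
    exact (map_pow (diagHom (waveDomain p τ m)).mapMatrix _ _).symm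
  · rw [Matrix.map_apply, coeff_diagHom]
    by_cases h1 : i = 1
    · subst h1
      have e : (dressed p τ m 1 a b).coeff 1 = (1 : Matrix (Blk1 p) (Blk1 p) _) a b :=
        congrFun (congrFun (cf_dressed (p := p) (τ := τ) (m := m) 1) a) b
      rw [e, Matrix.one_apply]
      split_ifs with hab hab' hab'
      · rw [map_one, map_one]
      · exact absurd ⟨hab, rfl⟩ hab'
      · exact absurd hab'.1 hab
      · exact map_zero _
    · rw [ordLE_dressed 1 a b i (by omega), map_zero, if_neg (fun h => h1 h.2)]

theorem laxTilde_evolution (hp : 0 < p 0) (j : ℕ+) :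
    (laxTilde p τ m).map (mapCoeff (pderivHom (some j))) =
      ⁅(((dressed p τ m 1).map (diagHom (waveDomain p τ m))) ^ (j : ℕ)).map pos,
        laxTilde p τ m⁆ := by
  have e : ((dressed p τ m 1).map (diagHom (waveDomain p τ m))) ^ (j : ℕ) =
      (dressed p τ m 1 ^ (j : ℕ)).map (diagHom (waveDomain p τ m)) :=
    (map_pow (diagHom (waveDomain p τ m)).mapMatrix _ _).symm
  rw [laxTilde_eq hτ hm hp, diagHom_evolution, sum_dressed_evolution hτ hm, e, map_pos_diagHom,
    Ring.lie_def, Ring.lie_def]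
  have := map_sub (diagHom (waveDomain p τ m)).mapMatrix
    ((dressed p τ m 1 ^ (j : ℕ)).map pos * dressed p τ m (p 0))
    (dressed p τ m (p 0) * (dressed p τ m 1 ^ (j : ℕ)).map pos)
  rw [map_mul, map_mul] at this
  exact this

end Wave

end Identification

/-! ### The operator built from `W_11`, `W_12`, `W_21` -/

section Solution

open PsiDO

variable {𝕜 : Type*} [RCLike 𝕜] [NormedAlgebra 𝕜 ℂ]

section DivPow

variable {κ : Type*} (V : TimeDomain 𝕜 (Option κ))

theorem divPowX_zero : divPowX V 0 = 1 := by simp [divPowX]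

theorem deriv_divPowX_succ (i : ℕ) : Differential.deriv (divPowX V (i + 1)) = divPowX V i := by
  rw [deriv_eq_pderivT, divPowX, divPowX, Derivation.map_smul, Derivation.leibniz_pow, pderivT_coordFn,
    smul_eq_mul, mul_one, Nat.add_sub_cancel, ← Nat.cast_smul_eq_nsmul ℂ, smul_smul]
  congr 1
  have h1 : ((i + 1 : ℕ) : ℂ) ≠ 0 := Nat.cast_ne_zero.mpr (Nat.succ_ne_zero i)
  have h2 : (i.factorial : ℂ) ≠ 0 := Nat.cast_ne_zero.mpr i.factorial_ne_zero
  rw [Nat.factorial_succ, Nat.cast_mul]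
  field_simp

theorem divPowX_mul (i j : ℕ) :
    divPowX V i * divPowX V j = ((i + j).choose i : ℤ) • divPowX V (i + j) := by
  rw [divPowX, divPowX, divPowX, smul_mul_smul_comm, ← pow_add, natCast_zsmul,
    ← Nat.cast_smul_eq_nsmul ℂ, smul_smul]
  congr 1
  have h1 : (i.factorial : ℂ) ≠ 0 := Nat.cast_ne_zero.mpr i.factorial_ne_zero
  have h2 : (j.factorial : ℂ) ≠ 0 := Nat.cast_ne_zero.mpr j.factorial_ne_zero
  have h3 : ((i + j).factorial : ℂ) ≠ 0 := Nat.cast_ne_zero.mpr (i + j).factorial_ne_zero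
  have h4 : ((i + j).choose i : ℂ) * i.factorial * j.factorial = (i + j).factorial := by
    rw [Nat.choose_symm_add]
    exact_mod_cast Nat.add_choose_mul_factorial_mul_factorial i j
  field_simp
  rw [← h4]
  ring

end DivPow

section DiffOp

variable {R : Type*} [CommRing R]

theorem ordLE_monoNeg (a : R) (n : ℤ) : (monoNeg a n).OrdLE n := ordLE_mono _ _

theorem isDiff_monoNeg (a : R) {n : ℤ} (hn : 0 ≤ n) : (monoNeg a n).IsDiff := isDiff_mono _ hn

theorem ordLE_diffOp (n : ℕ) (w : ℕ → R) : (diffOp n w).OrdLE ((n : ℤ) - 1) :=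
  PsiDO.OrdLE.sum fun j hj => (ordLE_monoNeg _ _).mono (by
    have := Finset.mem_range.mp hj
    omega)

/-- A differential operator of order less than `n` is recovered from its coefficients. -/
theorem diffOp_negCoeff {n : ℕ} {A : PsiDO R} (hA : A.OrdLE ((n : ℤ) - 1)) (hA' : A.IsDiff) :
    diffOp n (negCoeff A) = A := by
  ext1 i
  rw [diffOp, coeff_sum]
  by_cases hi : 0 ≤ i ∧ i < n
  · rw [Finset.sum_eq_single i.toNat]
    · have e : ((i.toNat : ℕ) : ℤ) = i := by omega
      rw [monoNeg, coeff_mono, if_pos e.symm, negCoeff, negOnePow_natCast, e, zsmul_eq_mul]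
      push_cast
      rw [← mul_assoc, ← pow_add, ← two_mul, pow_mul]
      simp
    · intro j _ hj
      rw [monoNeg, coeff_mono, if_neg (by omega)]
    · intro h
      rw [Finset.mem_range] at h
      omega
  · rw [Finset.sum_eq_zero]
    · by_cases h0 : i < 0
      · exact (hA' i h0).symm
      · exact (hA i (by omega)).symm
    · intro j hj
      have := Finset.mem_range.mp hj
      rw [monoNeg, coeff_mono, if_neg (by omega)]

end DiffOp

variable {r : ℕ} [NeZero r] {p : Fin r → ℕ}
  {Ω : TimeDomain 𝕜 (Fin r × ℕ+)} {τ : (Fin r → ℤ) → SmoothFn Ω} {m : Fin r → ℤ} {ε : 𝕜}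

/-- The defining expression is already differential of order less than `p_a`, so truncating to the
coefficients `w_j` loses nothing. -/
theorem solW21_apply (a : Blk2 p) (b : Blk1 p) : solW21 p τ m ε a b =
    ∑ j ∈ Finset.range (p a.1), ∑ i ∈ Finset.range (j + 1), mono 1 (j : ℤ) *
      mono (solQ p τ m ε (-1) b.1 a.1 (j - i + 1) * divPowX (solDomain p τ m ε) i) 0 := by
  refine diffOp_negCoeff ?_ ?_
  · refine PsiDO.OrdLE.sum fun j hj => PsiDO.OrdLE.sum fun i _ =>
      ((ordLE_mono _ _).mul (ordLE_mono _ _)).mono ?_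
    have := Finset.mem_range.mp hj
    omega
  · exact IsDiff.sum fun j _ => IsDiff.sum fun i _ =>
      (isDiff_mono _ (by omega)).mul (isDiff_mono _ le_rfl)

/-- Each summand has order at most `(p_c - 1) - p_c + (p_c - 1)`, and `p_c ≤ p_1` because the parts
decrease. This leaves room for `W_11` to have order below `p_1`. -/
theorem ordLE_solW_product (hp : Antitone p) :
    PsiMat.OrdLE (solW12 p τ m ε * negDq p τ m ε * solW21 p τ m ε) ((p 0 : ℤ) - 1) := by
  intro a b
  rw [Matrix.mul_apply]
  refine PsiDO.OrdLE.sum fun c _ => ?_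
  rw [negDq, Matrix.mul_diagonal]
  refine (((ordLE_diffOp (p c.1) _).mul (ordLE_monoNeg _ _)).mul
    (ordLE_diffOp (p c.1) _)).mono ?_
  have : p c.1 ≤ p 0 := hp (Fin.zero_le c.1)
  omega

theorem solQ_eq (σ : ℤˣ) (a b : Fin r) (n : ℕ) : solQ p τ m ε σ a b n =
    pullback (flipMap ε) (pullback (diagMap p) (waveQ p τ m σ a b n)) := rfl

theorem isDiff_solW_product (a b : Blk1 p) :
    ((solW12 p τ m ε * negDq p τ m ε * solW21 p τ m ε) a b +
      ∑ c : Blk2 p, ∑ n ∈ Finset.range (p c.1), ((-1) ^ (p c.1 - n) : ℤ) •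
        (mono (solQ p τ m ε 1 a.1 c.1 (n + 1)) (-1) *
          mono (solQ p τ m ε (-1) b.1 c.1 (p c.1 - n)) 0)).IsDiff := by
  rw [Matrix.mul_apply, ← Finset.sum_add_distrib]
  refine IsDiff.sum fun c _ => ?_
  rw [negDq, Matrix.mul_diagonal, solW21_apply]
  exact neg_part_product (divPowX_zero _) (deriv_divPowX_succ _) (divPowX_mul _) (p c.1)
    (solQ p τ m ε 1 a.1 c.1) (solQ p τ m ε (-1) b.1 c.1)

section Wave

variable {k : ℤ} (hτ : IsTauFunction p k τ) (hm : ∑ a, m a = k)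

include hτ hm

theorem laxFlip_eq (hp : 0 < p 0) : laxFlip p τ m ε = ((dressed p τ m (p 0)).map
    (diagHom (waveDomain p τ m))).map (flipHom (laxDomain p τ m) ε) := by
  rw [laxFlip, laxTilde_eq hτ hm hp]
  rfl

/-- The image of `isDiff_dressed` under the identification and the flip. The sign `(-1)^{p_c - n}`
comes from the coefficients of `Q^-(-z)`, and the change of sign of the sum from `∂⁻¹ ↦ -∂⁻¹`. -/
theorem isDiff_laxFlip (hp : 0 < p 0) (a b : Blk1 p) : (laxFlip p τ m ε a b -
    ∑ c : Blk2 p, ∑ n ∈ Finset.range (p c.1), ((-1) ^ (p c.1 - n) : ℤ) •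
      (mono (solQ p τ m ε 1 a.1 c.1 (n + 1)) (-1) *
        mono (solQ p τ m ε (-1) b.1 c.1 (p c.1 - n)) 0)).IsDiff := by
  have h := isDiff_dressed hτ hm a b
  set F : PsiDO (SmoothFn (waveDomain p τ m)) →+* PsiDO (SmoothFn (solDomain p τ m ε)) :=
    (flipHom (laxDomain p τ m) ε).comp (diagHom (waveDomain p τ m))
  have hcF : ∀ A i, (F A).coeff i = (Int.negOnePow i : ℤ) •
      pullback (flipMap ε) (pullback (diagMap p) (A.coeff i)) := fun _ _ => rfl
  have hmono : ∀ f n, F (mono f n) = (Int.negOnePow n : ℤ) •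
      mono (pullback (flipMap ε) (pullback (diagMap p) f)) n := by
    intro f n
    ext1 i
    rw [hcF, coeff_zsmul, coeff_mono, coeff_mono]
    split_ifs with hi
    · rw [hi]
    · rw [map_zero, map_zero, smul_zero, smul_zero]
  have h2 : (F (dressed p τ m (p 0) a b + ∑ c : Blk2 p, ∑ n ∈ Finset.range (p c.1),
      mono (waveQ p τ m 1 a.1 c.1 (n + 1)) (-1) *
      mono (waveQNeg p τ m b.1 c.1 (p c.1 - n)) 0)).IsDiff := by
    intro i hi
    rw [hcF, h i hi, map_zero, map_zero, smul_zero]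
  rw [map_add, map_sum] at h2
  convert h2 using 1
  rw [laxFlip_eq hτ hm hp, sub_eq_add_neg, ← Finset.sum_neg_distrib]
  congr 1
  refine Finset.sum_congr rfl fun c _ => ?_
  rw [map_sum, ← Finset.sum_neg_distrib]
  refine Finset.sum_congr rfl fun n _ => ?_
  rw [map_mul, hmono, hmono, waveQNeg, map_zsmul, map_zsmul, mono_zsmul, ← solQ_eq, ← solQ_eq,
    Int.negOnePow_zero, Int.negOnePow_neg, Int.negOnePow_one, Units.val_neg, Units.val_one,
    one_smul, neg_smul, one_smul, neg_mul, mul_smul_comm]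

theorem ordLE_laxFlip_sub (hp : 0 < p 0) :
    PsiMat.OrdLE (laxFlip p τ m ε - negDp p τ m ε) ((p 0 : ℤ) - 1) := by
  refine PsiMat.ordLE_pred ?_ ?_
  · intro a b i hi
    rw [laxFlip_eq hτ hm hp, Matrix.sub_apply, coeff_sub, Matrix.map_apply, Matrix.map_apply,
      coeff_flipHom, coeff_diagHom, ordLE_dressed _ a b i hi, negDp, Matrix.diagonal_apply]
    split_ifs
    · rw [ordLE_monoNeg _ _ i hi]; simp
    · simp
  · ext1 a b
    have e : (dressed p τ m (p 0) a b).coeff (p 0) = (1 : Matrix (Blk1 p) (Blk1 p) _) a b :=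
      congrFun (congrFun (cf_dressed (p := p) (τ := τ) (m := m) (p 0)) a) b
    change ((laxFlip p τ m ε - negDp p τ m ε) a b).coeff (p 0) = 0
    rw [laxFlip_eq hτ hm hp, Matrix.sub_apply, coeff_sub, Matrix.map_apply, Matrix.map_apply,
      coeff_flipHom, coeff_diagHom, e, negDp, Matrix.diagonal_apply, Matrix.one_apply]
    split_ifs
    · rw [map_one, map_one, monoNeg, coeff_mono, if_pos rfl, sub_self]
    · simp

/-- The differential parts agree by the choice of `W_11`; the negative parts agree because
`isDiff_solW_product` and `isDiff_laxFlip` involve the same sum with opposite signs. -/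
theorem laxSol_eq (hp : Antitone p) (hp0 : 0 < p 0) :
    laxSol p τ m ε = -laxFlip p τ m ε := by
  set P := solW12 p τ m ε * negDq p τ m ε * solW21 p τ m ε with hP
  -- No term is lost by keeping only powers below `p_1`: the leading term `(-∂)^{p_1}` cancels and
  -- the product `P` has lower order.
  have hW11 : solW11 p τ m ε =
      -(laxFlip p τ m ε).map pos + negDp p τ m ε - P.map pos := by
    ext1 a b
    have ho1 := ordLE_laxFlip_sub (ε := ε) hτ hm hp0 a b
    have ho2 := ordLE_solW_product (τ := τ) (m := m) (ε := ε) hp a b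
    have hd : ((negDp p τ m ε) a b).IsDiff := by
      rw [negDp, Matrix.diagonal_apply]
      split_ifs
      · exact isDiff_monoNeg _ (by omega)
      · exact isDiff_zero
    have hpos : ∀ A : PsiDO (SmoothFn (solDomain p τ m ε)), A.pos.IsDiff := fun A i hi => by
      rw [coeff_pos, if_neg (by omega)]
    refine diffOp_negCoeff ?_ ?_
    · intro i hi
      have h1 := ho1 i hi
      have h2 := ho2 i hi
      rw [Matrix.sub_apply, coeff_sub] at h1
      rw [Matrix.sub_apply, Matrix.add_apply, Matrix.neg_apply, Matrix.map_apply, Matrix.map_apply,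
        coeff_sub, coeff_add, coeff_neg, coeff_pos, coeff_pos, if_pos (by omega),
        if_pos (by omega), h2, sub_zero, neg_add_eq_zero]
      exact sub_eq_zero.mp h1
    · rw [Matrix.sub_apply, Matrix.add_apply, Matrix.neg_apply, sub_eq_add_neg]
      exact ((hpos _).neg.add hd).add (hpos _).neg
  rw [laxSol, hW11]
  ext1 a b
  ext1 i
  -- Adding the two relations removes the sum over the second block, so `P` plus the flipped
  -- operator is differential.
  have hdiff := (isDiff_solW_product (τ := τ) (m := m) (ε := ε) a b).add
    (isDiff_laxFlip (ε := ε) hτ hm hp0 a b)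
  simp only [Matrix.sub_apply, Matrix.add_apply, Matrix.neg_apply, Matrix.map_apply,
    coeff_sub, coeff_add, coeff_neg, coeff_pos, ← hP]
  split_ifs with hi
  · ring
  · have h := hdiff i (by omega)
    simp only [coeff_sub, coeff_add, ← hP] at h
    linear_combination h

end Wave

end Solution

end

theorem mainTheorem6 {𝕜 : Type*} [RCLike 𝕜] [NormedAlgebra 𝕜 ℂ] {r : ℕ} [NeZero r]
    (p : Fin r → ℕ) (hp : Antitone p) (hp_pos : ∀ a, 0 < p a)
    (k : ℤ) (Ω : TimeDomain 𝕜 (Fin r × ℕ+)) (τ : (Fin r → ℤ) → SmoothFn Ω)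
    (hτ : IsTauFunction p k τ) (m : Fin r → ℤ) (hm : ∑ a, m a = k) :
    IsUnit (waveQ11 p τ m) ∧
    SolvesLax 1 (p 0) (laxTilde p τ m) ∧
    ∀ ε : 𝕜, ε ^ p 0 = -1 →
      laxSol p τ m ε = -laxFlip p τ m ε ∧
      SolvesLax (-algebraMap 𝕜 ℂ ε) (p 0) (laxSol p τ m ε) := by
  have hp0 := hp_pos 0
  refine ⟨isUnit_waveQ11 hτ hm, solvesLax_of_root one_ne_zero hp0
    (isRootWithLeading_laxTilde hτ hm hp0) (laxTilde_evolution hτ hm hp0), fun ε hε => ?_⟩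
  have h := laxSol_eq (ε := ε) hτ hm hp hp0
  refine ⟨h, ?_⟩
  rw [h]
  exact solvesLax_flip ε hp0 hε (isRootWithLeading_laxTilde hτ hm hp0)
    (laxTilde_evolution hτ hm hp0)
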